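/- **Conventions.** Signature $(+,-,-,-)$, $R^{\mu}{}_{\nu\rho\sigma}=\partial_\sigma\Gamma^\mu_{\nu\rho}-\partial_\rho\Gamma^\mu_{\nu\sigma}+\Gamma^\mu_{\sigma\alpha}\Gamma^\alpha_{\nu\rho}-\Gamma^\mu_{\rho\alpha}\Gamma^\alpha_{\nu\sigma}$, $R_{\mu\nu}=R^\alpha{}_{\mu\alpha\nu}$, $R=g^{\mu\nu}R_{\mu\nu}$, $C_{\mu\nu\rho\sigma}$ the Weyl tensor, $E^{\mu\nu\rho\sigma}$ the Levi-Civita tensor with $E^{0123}=1/\sqrt{-g}$. For a timelike Killing four-temperature $\beta$: $T=1/\sqrt{\beta^2}$, $u=T\beta$, $\Delta_{\mu\nu}=g_{\mu\nu}-u_\mu u_\nu$, $A_\mu=u^\nu\nabla_\nu u_\mu$, $\omega_\mu=\frac12E_{\mu\nu\rho\sigma}u^\nu\nabla^\rho u^\sigma$, $l^\mu=E^{\mu\nu\rho\sigma}\omega_\nu A_\rho u_\sigma$ (along the rotation, for a rigidly rotating state). **Distillates.** Let $f$ be a function of $\kappa^2$ on the plane cut along the negative real axis which, on regions $\{\kappa:\arg\kappa\in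 I_i\}$ covering $|\arg\kappa|<\pi/2$, has asymptotic expansions in integer powers of $\kappa$ as $\kappa\to0$. Its analytic distillate is the power series $\sum_{n\ge0}c_n(\kappa^2)^n$ formed by the terms whose coefficient is common to all regions, if this series has a positive radius of convergence. The scalar coefficients of the following stress-energy tensors of the conformally coupled massless real scalar field (vacuum-subtracted) are distilled in $\kappa^2=0$ at fixed $\beta_0=1/T_0$ and fixed dimensionless variables ($q=\kappa r$; $S,\omega_0$). * AdS: ${\rm d}s^2=(1+\kappa^2r^2){\rm d}t^2-\frac{{\rm d}r^2}{1+\kappa^2r^2}-r^2{\rm d}\Omega^2$, $\beta=\frac1{T_0}\partial_t$. With $q=\kappa r$, $\epsilon\in\{1,-1,0\}$ (Dirichlet, Neumann, transparent boundary conditions), $f_3=\sum_{n\ge1}\frac{n^3}{e^{n\kappa\beta_0}-1}$, and $S_m$, $C_m$ the sums $\sum_{n\ge1}\frac{(-1)^nn^m}{e^{n\kappa\beta_0}-1}\left\{\begin{smallmatrix}\sin\\ \cos\end{smallmatrix}\right\}(2n\arctan q)$, $$\langle T_{\mu\nu}\rangle=\tfrac1{6\pi^2}\Big(\tfrac{\kappa^2}{1+q^2}\Big)^2f_3\,(4u_\mu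 u_\nu-g_{\mu\nu})+\epsilon\tfrac{\kappa^4}{8\pi^2q}\Big\{\Big[\tfrac{1-q^2}{6q^2}S_0-\tfrac{C_1}{3q}-\tfrac{2S_2}{3(1+q^2)}\Big]g_{\mu\nu}+\Big[\tfrac16\big(3-\tfrac1{q^2}\big)S_0+\tfrac1q\big(1-\tfrac{2}{3(1+q^2)}\big)C_1+\tfrac{2S_2}{1+q^2}\Big]u_\mu u_\nu$$ $$\qquad+\Big[\tfrac16\big(\tfrac{3(1+q^2)}{q^2}-4\big)S_0+\tfrac1q\big(\tfrac{2q^2}{3(1+q^2)}-1\big)C_1-\tfrac{2S_2}{3(1+q^2)}\Big]\tfrac{1+q^2}{q^2\kappa^2}A_\mu A_\nu\Big\}.$$ * dS, static patch: the metric with $\kappa^2\to-\kappa^2$, $\kappa r<1$, $\beta=\frac1{T_0}\partial_t$, $\langle T_{\mu\nu}\rangle=\big(\frac{\pi^2}{90}T_0^4-\frac{\kappa^4}{1440\pi^2}\big)(1-q^2)^{-2}(4u_\mu u_\nu-g_{\mu\nu})$. * Closed Einstein universe (CEU): ${\rm d}s^2={\rm d}t^2-\kappa^{-2}[{\rm d}\chi^2+\sin^2\chi\,{\rm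 d}\Omega^2]$, $\beta=\frac1{T_0}(\partial_t+\kappa\omega_0\partial_\varphi)$, $0\le\omega_0<1$, $S=\sin^2\chi\sin^2\theta$. If $\omega_0=0$: $\langle T_{\mu\nu}\rangle=\rho u_\mu u_\nu-\frac\rho3\Delta_{\mu\nu}$ with $\rho=\frac{\kappa^4}{16\pi^2}\sum_{n\ge1}\frac{2+\cosh n\kappa\beta_0}{\sinh^4(n\kappa\beta_0/2)}$. If $0<\omega_0<1$ (and $S\ne1$): $\langle T_{\mu\nu}\rangle=\rho u_\mu u_\nu-p\Delta_{\mu\nu}+W\omega_\mu\omega_\nu+\mathcal A A_\mu A_\nu+G(u_\mu l_\nu+u_\nu l_\mu)$ with, writing $\Sigma[F]=\sum_{n\ge1}\frac{F(n\kappa\beta_0)}{[1-S-\cosh n\kappa\beta_0+S\cosh n\kappa\beta_0\omega_0]^3}$, $w=\omega_0$, $c=\cosh z$, $s=\sinh z$, $c_w=\cosh wz$, $s_w=\sinh wz$, $$\rho=\tfrac{\kappa^4\Sigma[F_\rho]}{12\pi^2(1-Sw^2)},\quad p=\tfrac{\kappa^4\Sigma[F_p]}{24\pi^2(1-Sw^2)},\quad(\mathcal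 A,W,G)=\tfrac{\kappa^2(1-Sw^2)}{6\pi^2(1-S)}\Big(\tfrac{\Sigma[F_A]}{w^4},\tfrac{\Sigma[F_W]}{w^2},-\tfrac{\Sigma[F_q]}{w^3}\Big),$$ $F_\rho=2(1+S^2w^2)+(-2+S+S^2w^2)c+(1+Sw^2-2S^2w^2)c_w-(1+S+Sw^2+S^2w^2)cc_w-(3+Sw^2)s^2-S(1+3Sw^2)s_w^2+12Sw\,ss_w$, $F_p=1+7S+S(7+S)w^2-(1+3Sw^2)\cosh2z+2(1+S(w^2-2))c_w-2c[S(-1-(S-2)w^2)+(1+S)(1+Sw^2)c_w]-S(3+Sw^2)\cosh2wz+24Sw\,ss_w$, $F_A=-2(1+w^2)+w^2\cosh2z+c(w^2-1+(1+w^2)c_w)-(w^2-1)c_w+\cosh2wz-6w\,ss_w$, $F_W=1-3S+(S-3)Sw^2+Sw^2\cosh2z-(1+S(Sw^2-2))c_w+S\cosh2wz+c(-1-(S-2)Sw^2+(1+S^2w^2)c_w)-6Sw\,ss_w$, $F_q=(1+S)w-(1-S)wc+(1-S)wc_w-(1+S)wcc_w-2ws^2-2Sws_w^2+3(1+Sw^2)ss_w$.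 All these distillates exist and are combinations of $T_0^4,T_0^3,\dots,T_0^0$; the part of order $j$ in the derivatives of $\beta$ and $g$ is the part proportional to $T_0^{4-j}$. **Second order.** Consider the general parity-consistent form, with constants $b_i,c_i,d_i$, $$\langle T_{\mu\nu}\rangle^{(2)}=\rho^{(2)}u_\mu u_\nu-p^{(2)}\Delta_{\mu\nu}+T^2\Big[d_1A_\mu A_\nu+d_2\omega_\mu\omega_\nu+d_3(u_\mu l_\nu+u_\nu l_\mu)+d_4R_{\mu\nu}+d_5(u_\mu R_\nu{}^\alpha u_\alpha+u_\nu R_\mu{}^\alpha u_\alpha)+d_6C_{\mu\rho\nu\sigma}u^\rho u^\sigma\Big],$$ $\rho^{(2)}=T^2(b_1A^2+b_2\omega^2+b_3R+b_4R_{\rho\sigma}u^\rho u^\sigma)$, $p^{(2)}=T^2(c_1A^2+c_2\omega^2+c_3R+c_4R_{\rho\sigma}u^\rho u^\sigma)$. It equals the second order part of the distillates in AdS, dS and CEU, for all values of the parameters and at all points, if and only if $b_2=c_2=d_5=-\frac1{36}$, $b_4=d_3=\frac1{18}$, $d_2=-\frac1{18}$ and $b_1=b_3=c_1=c_3=c_4=d_1=d_4=0$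 ($d_6$ is not determined, since $C=0$ in these space-times). So, up to the term $d_6T^2C_{\mu\rho\nu\sigma}u^\rho u^\sigma$, the universal second order form is $$\langle T_{\mu\nu}\rangle^{(2)}=\Big(-\tfrac{T^2\omega^2}{36}+\tfrac{T^2}{18}R_{\rho\sigma}u^\rho u^\sigma\Big)u_\mu u_\nu+\tfrac{T^2\omega^2}{36}\Delta_{\mu\nu}-\tfrac{T^2}{18}\omega_\mu\omega_\nu+\tfrac{T^2}{18}(u_\mu l_\nu+u_\nu l_\mu)-\tfrac{T^2}{36}(u_\mu R_\nu{}^\alpha u_\alpha+u_\nu R_\mu{}^\alpha u_\alpha).$$ **Minkowski limit.** In Minkowski space-time, for $\beta_\mu=b_\mu+\varpi_{\mu\nu}x^\nu$ with $\varpi$ antisymmetric and wherever $\beta^2>0$, it coincides with the second order part of $\langle T_{\mu\nu}\rangle=\rho u_\mu u_\nu-p\Delta_{\mu\nu}+W\omega_\mu\omega_\nu+\mathcal AA_\mu A_\nu+G(u_\mu l_\nu+u_\nu l_\mu)$, where $\rho=\frac{\pi^2T^4}{30}-\frac{T^2\omega^2}{36}-\frac{3A^4+10\omega^4+32A^2\omega^2}{1440\pi^2}$,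 $p=\frac{\pi^2T^4}{90}-\frac{T^2\omega^2}{36}-\frac{A^4+10\omega^4+64A^2\omega^2}{1440\pi^2}$, $W=-\frac{T^2}{18}-\frac{5A^2+\omega^2}{72\pi^2}$, $\mathcal A=-\frac{\omega^2}{24\pi^2}$, $G=\frac{T^2}{18}+\frac{\omega^2-A^2}{360\pi^2}$. **Fourth order.** Consider likewise the form $$\langle T_{\mu\nu}\rangle^{(4)}=\rho^{(4)}u_\mu u_\nu-p^{(4)}\Delta_{\mu\nu}+\mathcal A^{(2)}A_\mu A_\nu+W^{(2)}\omega_\mu\omega_\nu+2q^{(2)}u_{(\mu}l_{\nu)}+p_R^{(2)}R_{\mu\nu}+2p^{(2)}_{Ru}u_{(\mu}R_{\nu)}{}^\alpha u_\alpha+2p_{RA}A_{(\mu}R_{\nu)}{}^\alpha A_\alpha+2p_{R\omega}\omega_{(\mu}R_{\nu)}{}^\alpha\omega_\alpha$$ $$+p_{RR}R_\mu{}^\alpha R_{\nu\alpha}+p_{RuRu}R_\mu{}^\alpha u_\alpha R_\nu{}^\beta u_\beta+2i_1(A\cdot\omega)A_{(\mu}\omega_{\nu)}+2p_{uRl}u_{(\mu}R_{\nu)}{}^\alpha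 l_\alpha+2p_{lRu}l_{(\mu}R_{\nu)}{}^\alpha u_\alpha,$$ where $\mathcal A^{(2)},W^{(2)},q^{(2)},p_R^{(2)},p_{Ru}^{(2)}$ are linear combinations (coefficients $d_i,e_i,f_i,g_i,h_i$, $i=1,\dots,4$) of $A^2,\omega^2,R,R_{\mu\nu}u^\mu u^\nu$, and $\rho^{(4)},p^{(4)}$ are linear combinations (coefficients $b_i,c_i$, $i=1,\dots,16$) of $A^4$, $RA^2$, $R\omega^2$, $R^2$, $\omega^4$, $A^2\omega^2$, $(R_{uu})^2$, $R_{uu}R$, $R_{uu}A^2$, $R_{uu}\omega^2$, $R_{ul}$, $R^{\mu\nu}R_{\mu\nu}$, $R^{\mu\nu}R_{\mu\alpha}u^\alpha u_\nu$, $R_{AA}$, $R_{\omega\omega}$, $(A\cdot\omega)^2$, with $R_{vw}=R_{\mu\nu}v^\mu w^\nu$; all coefficients are pure numbers. There are coefficients for which it equals the fourth order part of the distillates in AdS, dS and CEU, and for every such choice the coefficients of the flat-space terms not involving $A\cdot\omega$ are $b_1=-\frac{3}{1440\pi^2}$, $b_5=-\frac{10}{1440\pi^2}$, $b_6=-\frac{32}{1440\pi^2}$,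 $c_1=-\frac1{1440\pi^2}$, $c_5=-\frac{10}{1440\pi^2}$, $c_6=-\frac{64}{1440\pi^2}$, $d_1=0$, $d_2=-\frac1{24\pi^2}$, $e_1=-\frac5{72\pi^2}$, $e_2=-\frac1{72\pi^2}$, $f_1=-\frac1{360\pi^2}$, $f_2=\frac1{360\pi^2}$. In Minkowski space-time, where $\beta^2>0$ and $A\cdot\omega=0$, the form with any such choice coincides with the fourth order part of the Minkowski tensor above. -/

import Mathlib

noncomputable section

namespace ThermalDistillate

/-! ### Tensor calculus in a coordinate chart

Signature `(+,-,-,-)`; all indices run over `Fin 4`, index `0` being the time coordinate. -/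

/-- Points of a coordinate chart. -/
abbrev Coord := Fin 4 → ℝ

/-- Covariant components `g_{μν}` of a metric in a chart. -/
abbrev Metric := Coord → Matrix (Fin 4) (Fin 4) ℝ

/-- Contravariant components of a vector field in a chart. -/
abbrev VField := Coord → Fin 4 → ℝ

/-- A rank two tensor, by components. -/
abbrev Tensor2 := Fin 4 → Fin 4 → ℝ

/-- The partial derivative `∂_i f` at `x`. -/
def pd (i : Fin 4) (f : Coord → ℝ) (x : Coord) : ℝ :=
  deriv (fun s : ℝ => f (Function.update x i s)) (x i)

/-- Christoffel symbols `Γ^μ_{νρ}`. -/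
def christoffel (g : Metric) (x : Coord) (μ ν ρ : Fin 4) : ℝ :=
  (1 / 2) * ∑ σ, (g x)⁻¹ μ σ *
    (pd ν (fun y => g y σ ρ) x + pd ρ (fun y => g y σ ν) x - pd σ (fun y => g y ν ρ) x)

/-- The Riemann tensor
`R^μ_{νρσ} = ∂_σ Γ^μ_{νρ} - ∂_ρ Γ^μ_{νσ} + Γ^μ_{σα} Γ^α_{νρ} - Γ^μ_{ρα} Γ^α_{νσ}`. -/
def riemann (g : Metric) (x : Coord) (μ ν ρ σ : Fin 4) : ℝ :=
  pd σ (fun y => christoffel g y μ ν ρ) x - pd ρ (fun y => christoffel g y μ ν σ) x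
    + ∑ α, (christoffel g x μ σ α * christoffel g x α ν ρ
      - christoffel g x μ ρ α * christoffel g x α ν σ)

/-- The Ricci tensor `R_{μν} = R^α_{μαν}`. -/
def ricci (g : Metric) (x : Coord) (μ ν : Fin 4) : ℝ := ∑ α, riemann g x α μ α ν

/-- The curvature scalar `R = g^{μν} R_{μν}`. -/
def scalarCurv (g : Metric) (x : Coord) : ℝ := ∑ μ, ∑ ν, (g x)⁻¹ μ ν * ricci g x μ ν

/-- The Weyl tensor `C_{μνρσ}` in four dimensions. -/
def weyl (g : Metric) (x : Coord) (μ ν ρ σ : Fin 4) : ℝ :=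
  (∑ α, g x μ α * riemann g x α ν ρ σ)
    - (1 / 2) * (g x μ ρ * ricci g x ν σ - g x μ σ * ricci g x ν ρ
        - g x ν ρ * ricci g x μ σ + g x ν σ * ricci g x μ ρ)
    + (scalarCurv g x / 6) * (g x μ ρ * g x ν σ - g x μ σ * g x ν ρ)

/-- `v_μ = g_{μν} v^ν`. -/
def lower (g : Metric) (x : Coord) (v : Fin 4 → ℝ) (μ : Fin 4) : ℝ := ∑ ν, g x μ ν * v ν

/-- `v^μ = g^{μν} v_ν`. -/
def raise (g : Metric) (x : Coord) (v : Fin 4 → ℝ) (μ : Fin 4) : ℝ := ∑ ν, (g x)⁻¹ μ ν * v ν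

/-- `g^{μν} v_μ w_ν` for two covectors. -/
def dot (g : Metric) (x : Coord) (v w : Fin 4 → ℝ) : ℝ := ∑ μ, ∑ ν, (g x)⁻¹ μ ν * v μ * w ν

/-- The Levi-Civita symbol with value `+1` on `(0,1,2,3)`. -/
def levi (μ ν ρ σ : Fin 4) : ℤ :=
  Int.sign ((ν : ℤ) - (μ : ℤ)) * Int.sign ((ρ : ℤ) - (μ : ℤ)) * Int.sign ((σ : ℤ) - (μ : ℤ)) *
  Int.sign ((ρ : ℤ) - (ν : ℤ)) * Int.sign ((σ : ℤ) - (ν : ℤ)) * Int.sign ((σ : ℤ) - (ρ : ℤ))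

/-- The Levi-Civita tensor with upper indices, `E^{0123} = + 1 / √(-g)`. -/
def leviUp (g : Metric) (x : Coord) (μ ν ρ σ : Fin 4) : ℝ :=
  (levi μ ν ρ σ : ℝ) / Real.sqrt (-(g x).det)

/-- The same tensor with lower indices, `E_{0123} = - √(-g)` (lowering four indices multiplies by
`det g < 0`). -/
def leviDown (g : Metric) (x : Coord) (μ ν ρ σ : Fin 4) : ℝ :=
  -(Real.sqrt (-(g x).det) * (levi μ ν ρ σ : ℝ))

/-! ### Kinematics of a four-temperature field `β` -/

/-- `β² = g_{μν} β^μ β^ν`. -/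
def betaSq (g : Metric) (β : VField) (x : Coord) : ℝ := ∑ μ, ∑ ν, g x μ ν * β x μ * β x ν

/-- The proper temperature `T = 1 / √β²`. -/
def temp (g : Metric) (β : VField) (x : Coord) : ℝ := 1 / Real.sqrt (betaSq g β x)

/-- The four-velocity `u^μ = β^μ / √β²`. -/
def velUp (g : Metric) (β : VField) (x : Coord) (μ : Fin 4) : ℝ :=
  β x μ / Real.sqrt (betaSq g β x)

/-- `u_μ`. -/
def vel (g : Metric) (β : VField) (x : Coord) (μ : Fin 4) : ℝ := lower g x (velUp g β x) μ

/-- `∇_ν u_μ`. -/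
def gradVel (g : Metric) (β : VField) (x : Coord) (ν μ : Fin 4) : ℝ :=
  pd ν (fun y => vel g β y μ) x - ∑ α, christoffel g x α ν μ * vel g β x α

/-- `∇^ρ u^σ`. -/
def gradVelUp (g : Metric) (β : VField) (x : Coord) (ρ σ : Fin 4) : ℝ :=
  ∑ α, ∑ τ, (g x)⁻¹ ρ α * (g x)⁻¹ σ τ * gradVel g β x α τ

/-- The acceleration `A_μ = u^ν ∇_ν u_μ`. -/
def acc (g : Metric) (β : VField) (x : Coord) (μ : Fin 4) : ℝ :=
  ∑ ν, velUp g β x ν * gradVel g β x ν μ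

/-- The vorticity `ω_μ = (1/2) E_{μνρσ} u^ν ∇^ρ u^σ`. -/
def vort (g : Metric) (β : VField) (x : Coord) (μ : Fin 4) : ℝ :=
  (1 / 2) * ∑ ν, ∑ ρ, ∑ σ, leviDown g x μ ν ρ σ * velUp g β x ν * gradVelUp g β x ρ σ

/-- The transverse vector `l^μ = E^{μνρσ} ω_ν A_ρ u_σ`; for a rigidly rotating state it points in
the direction of the rotation. -/
def lvecUp (g : Metric) (β : VField) (x : Coord) (μ : Fin 4) : ℝ :=
  ∑ ν, ∑ ρ, ∑ σ, leviUp g x μ ν ρ σ * vort g β x ν * acc g β x ρ * vel g β x σ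

/-- `l_μ`. -/
def lvec (g : Metric) (β : VField) (x : Coord) (μ : Fin 4) : ℝ := lower g x (lvecUp g β x) μ

/-- `A²`. -/
def accSq (g : Metric) (β : VField) (x : Coord) : ℝ := dot g x (acc g β x) (acc g β x)

/-- `ω²`. -/
def vortSq (g : Metric) (β : VField) (x : Coord) : ℝ := dot g x (vort g β x) (vort g β x)

/-- `A · ω`. -/
def accVort (g : Metric) (β : VField) (x : Coord) : ℝ := dot g x (acc g β x) (vort g β x)

/-- `Δ_{μν} = g_{μν} - u_μ u_ν`. -/
def proj (g : Metric) (β : VField) (x : Coord) (μ ν : Fin 4) : ℝ :=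
  g x μ ν - vel g β x μ * vel g β x ν

/-- The symmetrized product `v_μ w_ν + v_ν w_μ`. -/
def sym (v w : Fin 4 → ℝ) (μ ν : Fin 4) : ℝ := v μ * w ν + v ν * w μ

/-- The covector `R_ν^α v_α`, for a covector `v`. -/
def ricciApply (g : Metric) (x : Coord) (v : Fin 4 → ℝ) (ν : Fin 4) : ℝ :=
  ∑ α, ricci g x ν α * raise g x v α

/-- `R_ν^α u_α`. -/
def ricciVel (g : Metric) (β : VField) (x : Coord) : Fin 4 → ℝ := ricciApply g x (vel g β x)

/-- `R_{ρσ} u^ρ u^σ`. -/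
def ricciUU (g : Metric) (β : VField) (x : Coord) : ℝ :=
  dot g x (ricciVel g β x) (vel g β x)

/-- `C_{μρνσ} u^ρ u^σ`. -/
def weylUU (g : Metric) (β : VField) (x : Coord) (μ ν : Fin 4) : ℝ :=
  ∑ ρ, ∑ σ, weyl g x μ ρ ν σ * velUp g β x ρ * velUp g β x σ

/-! ### The general forms at second and fourth order -/

/-- The unknown coefficients of the general form at second order. -/
structure SecondCoeffs where
  (b1 b2 b3 b4 c1 c2 c3 c4 d1 d2 d3 d4 d5 d6 : ℝ)

/-- The general parity-consistent form of the stress-energy tensor at second order. -/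
def secondOrder (k : SecondCoeffs) (g : Metric) (β : VField) (x : Coord) : Tensor2 :=
  fun μ ν =>
  let T := temp g β x
  let u := vel g β x
  let A := acc g β x
  let w := vort g β x
  let ρ₂ := k.b1 * T ^ 2 * accSq g β x + k.b2 * T ^ 2 * vortSq g β x
    + k.b3 * T ^ 2 * scalarCurv g x + k.b4 * T ^ 2 * ricciUU g β x
  let p₂ := k.c1 * T ^ 2 * accSq g β x + k.c2 * T ^ 2 * vortSq g β x
    + k.c3 * T ^ 2 * scalarCurv g x + k.c4 * T ^ 2 * ricciUU g β x
  ρ₂ * (u μ * u ν) - p₂ * proj g β x μ ν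
    + k.d1 * T ^ 2 * (A μ * A ν) + k.d2 * T ^ 2 * (w μ * w ν)
    + k.d3 * T ^ 2 * sym u (lvec g β x) μ ν
    + k.d4 * T ^ 2 * ricci g x μ ν
    + k.d5 * T ^ 2 * sym u (ricciVel g β x) μ ν
    + k.d6 * T ^ 2 * weylUU g β x μ ν

/-- The unknown (pure number) coefficients of the general form at fourth order. -/
structure FourthCoeffs where
  (b1 b2 b3 b4 b5 b6 b7 b8 b9 b10 b11 b12 b13 b14 b15 b16 : ℝ)
  (c1 c2 c3 c4 c5 c6 c7 c8 c9 c10 c11 c12 c13 c14 c15 c16 : ℝ)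
  (d1 d2 d3 d4 e1 e2 e3 e4 f1 f2 f3 f4 g1 g2 g3 g4 h1 h2 h3 h4 i1 : ℝ)
  (pRA pRw pRR pRuRu puRl plRu : ℝ)

/-- The form of the stress-energy tensor at fourth order, up to terms with the Weyl tensor or with
gradients of the Ricci tensor. -/
def fourthOrder (k : FourthCoeffs) (g : Metric) (β : VField) (x : Coord) : Tensor2 :=
  fun μ ν =>
  let u := vel g β x
  let A := acc g β x
  let w := vort g β x
  let l := lvec g β x
  let A2 := accSq g β x
  let w2 := vortSq g β x
  let Aw := accVort g β x
  let R := scalarCurv g x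
  let Ru := ricciVel g β x
  let RA := ricciApply g x A
  let Rw := ricciApply g x w
  let Rl := ricciApply g x l
  let Ruu := ricciUU g β x
  let Rul := dot g x Ru l
  let RR := ∑ α, dot g x (fun τ => ricci g x τ α) (fun τ => ∑ γ, (g x)⁻¹ α γ * ricci g x τ γ)
  let RuRu := dot g x Ru Ru
  let RAA := dot g x RA A
  let Rww := dot g x Rw w
  let ρ₄ := k.b1 * A2 ^ 2 + k.b2 * R * A2 + k.b3 * R * w2 + k.b4 * R ^ 2 + k.b5 * w2 ^ 2
    + k.b6 * A2 * w2 + k.b7 * Ruu ^ 2 + k.b8 * Ruu * R + k.b9 * Ruu * A2 + k.b10 * Ruu * w2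
    + k.b11 * Rul + k.b12 * RR + k.b13 * RuRu + k.b14 * RAA + k.b15 * Rww + k.b16 * Aw ^ 2
  let p₄ := k.c1 * A2 ^ 2 + k.c2 * R * A2 + k.c3 * R * w2 + k.c4 * R ^ 2 + k.c5 * w2 ^ 2
    + k.c6 * A2 * w2 + k.c7 * Ruu ^ 2 + k.c8 * Ruu * R + k.c9 * Ruu * A2 + k.c10 * Ruu * w2
    + k.c11 * Rul + k.c12 * RR + k.c13 * RuRu + k.c14 * RAA + k.c15 * Rww + k.c16 * Aw ^ 2
  ρ₄ * (u μ * u ν) - p₄ * proj g β x μ ν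
    + (k.d1 * A2 + k.d2 * w2 + k.d3 * R + k.d4 * Ruu) * (A μ * A ν)
    + (k.e1 * A2 + k.e2 * w2 + k.e3 * R + k.e4 * Ruu) * (w μ * w ν)
    + (k.f1 * A2 + k.f2 * w2 + k.f3 * R + k.f4 * Ruu) * sym u l μ ν
    + (k.g1 * A2 + k.g2 * w2 + k.g3 * R + k.g4 * Ruu) * ricci g x μ ν
    + (k.h1 * A2 + k.h2 * w2 + k.h3 * R + k.h4 * Ruu) * sym u Ru μ ν
    + k.pRA * sym A RA μ ν + k.pRw * sym w Rw μ ν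
    + k.pRR * dot g x (ricci g x μ) (ricci g x ν)
    + k.pRuRu * (Ru μ * Ru ν)
    + (k.i1 * Aw) * sym A w μ ν
    + k.puRl * sym u Rl μ ν + k.plRu * sym l Ru μ ν

/-! ### Analytic distillation in `κ²` at `κ² = 0`

Functions of `κ²` on the plane cut along the negative real semi-axis are written as functions of
`κ = (κ²)^(1/2)`, i.e. `arg κ ∈ (-π/2, π/2)`; the transmonomials used are the integer and
half-integer powers of `κ²`, i.e. the integer powers of `κ`. -/

/-- The angular region `{κ ≠ 0 : arg κ ∈ I}`. -/
def sector (I : Set ℝ) : Set ℂ := {κ | κ ≠ 0 ∧ Complex.arg κ ∈ I}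

/-- `f(κ) ∼ ∑_k a_k κ^k` as `κ → 0` in `s` (finitely many negative powers). -/
def HasExpansion (f : ℂ → ℂ) (s : Set ℂ) (a : ℤ → ℂ) : Prop :=
  ∃ M : ℕ, (∀ k : ℤ, k < -(M : ℤ) → a k = 0) ∧
    ∀ N : ℕ, (fun κ : ℂ => f κ - ∑ k ∈ Finset.Icc (-(M : ℤ)) (N : ℤ), a k * κ ^ k)
      =o[nhdsWithin 0 s] (fun κ : ℂ => κ ^ N)

/-- `∑_n c_n (κ²)^n` is the analytic distillate of `f` in `κ² = 0`: the domain is covered by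
angular regions in each of which `f` has an expansion, the integer powers `(κ²)^n`, `n ≥ 0`, are
kept with their coefficient if this is common to all the regions and are discarded otherwise, and
the resulting power series has a positive radius of convergence. -/
def IsDistillate (f : ℂ → ℂ) (c : ℕ → ℂ) : Prop :=
  ∃ (ι : Type) (I : ι → Set ℝ) (a : ι → ℤ → ℂ),
    (∀ i, (I i).Nonempty) ∧
    (⋃ i, I i) = Set.Ioo (-(Real.pi / 2)) (Real.pi / 2) ∧
    (∀ i, HasExpansion f (sector (I i)) (a i)) ∧
    (∀ n : ℕ, (∀ i, a i (2 * (n : ℤ)) = c n) ∨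
      (c n = 0 ∧ ∃ i j, a i (2 * (n : ℤ)) ≠ a j (2 * (n : ℤ)))) ∧
    ∃ r : ℝ, 0 < r ∧ Summable fun n => ‖c n‖ * r ^ n

/-- The analytic distillate of `f` exists and its power series has the value `v` at `κ² = z`. -/
def IsDistilledValue (f : ℂ → ℂ) (z v : ℂ) : Prop :=
  ∃ c : ℕ → ℂ, IsDistillate f c ∧ HasSum (fun n => c n * z ^ n) v

/-! ### Anti-de Sitter space-time

Chart `(t, r, θ, φ)`, curvature parameter `κ`, `β = (1/T₀) ∂_t`. The scalar functions are distilled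
with the auxiliary variable `q = κ r` held fixed, and then evaluated at `q = κ r`. -/

/-- The Killing field `(1/T₀)(1,0,0,0)`. -/
def staticKilling (T0 : ℝ) : VField := fun _ => ![1 / T0, 0, 0, 0]

/-- `ds² = (1+κ²r²) dt² - (1+κ²r²)⁻¹ dr² - r² (dθ² + sin²θ dφ²)`. -/
def adsMetric (κ : ℝ) : Metric := fun x =>
  Matrix.diagonal ![1 + κ ^ 2 * x 1 ^ 2, -(1 + κ ^ 2 * x 1 ^ 2)⁻¹, -(x 1 ^ 2),
    -(x 1 ^ 2 * Real.sin (x 2) ^ 2)]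

/-- `f₃(z) = ∑_{n ≥ 1} n³ / (e^{nz} - 1)`. -/
def f3 (z : ℂ) : ℂ := ∑' n : ℕ, ((n : ℂ) + 1) ^ 3 / (Complex.exp (((n : ℂ) + 1) * z) - 1)

/-- `S_m = ∑_{n ≥ 1} n^m (-1)^n / (e^{nz} - 1) sin(2 n arctan q)`. -/
def serS (m : ℕ) (q : ℝ) (z : ℂ) : ℂ :=
  ∑' n : ℕ, ((n : ℂ) + 1) ^ m * (-1) ^ (n + 1) / (Complex.exp (((n : ℂ) + 1) * z) - 1)
    * (Real.sin (2 * ((n : ℝ) + 1) * Real.arctan q) : ℂ)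

/-- `C_m = ∑_{n ≥ 1} n^m (-1)^n / (e^{nz} - 1) cos(2 n arctan q)`. -/
def serC (m : ℕ) (q : ℝ) (z : ℂ) : ℂ :=
  ∑' n : ℕ, ((n : ℂ) + 1) ^ m * (-1) ^ (n + 1) / (Complex.exp (((n : ℂ) + 1) * z) - 1)
    * (Real.cos (2 * ((n : ℝ) + 1) * Real.arctan q) : ℂ)

/-- The bulk scalar `(1/6π²) (κ²/(1+q²))² f₃(κβ₀)`. -/
def adsBulk (b0 q : ℝ) (κ : ℂ) : ℂ :=
  1 / (6 * (Real.pi : ℂ) ^ 2) * (κ ^ 2 / (1 + (q : ℂ) ^ 2)) ^ 2 * f3 (κ * b0)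

/-- Boundary term: coefficient of `g_{μν}`. Note `κ³/r = κ⁴/q`. -/
def adsBoundG (b0 q : ℝ) (κ : ℂ) : ℂ :=
  κ ^ 4 / (8 * (Real.pi : ℂ) ^ 2 * q) *
    (1 / 6 * ((1 - (q : ℂ) ^ 2) / (q : ℂ) ^ 2) * serS 0 q (κ * b0)
      - 1 / (3 * (q : ℂ)) * serC 1 q (κ * b0)
      - 2 / 3 * (1 / (1 + (q : ℂ) ^ 2)) * serS 2 q (κ * b0))

/-- Boundary term: coefficient of `u_μ u_ν`. -/
def adsBoundU (b0 q : ℝ) (κ : ℂ) : ℂ :=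
  κ ^ 4 / (8 * (Real.pi : ℂ) ^ 2 * q) *
    (1 / 6 * (3 - 1 / (q : ℂ) ^ 2) * serS 0 q (κ * b0)
      + 1 / (q : ℂ) * (1 - 2 / 3 * (1 / (1 + (q : ℂ) ^ 2))) * serC 1 q (κ * b0)
      + 2 / (1 + (q : ℂ) ^ 2) * serS 2 q (κ * b0))

/-- Boundary term: coefficient of `A_μ A_ν`. Note `(1+κ²r²)/(r²κ⁴) = (1+q²)/(q²κ²)`. -/
def adsBoundA (b0 q : ℝ) (κ : ℂ) : ℂ :=
  κ ^ 4 / (8 * (Real.pi : ℂ) ^ 2 * q) *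
    (1 / 6 * (3 * ((1 + (q : ℂ) ^ 2) / (q : ℂ) ^ 2) - 4) * serS 0 q (κ * b0)
      + 1 / (q : ℂ) * (2 / 3 * ((q : ℂ) ^ 2 / (1 + (q : ℂ) ^ 2)) - 1) * serC 1 q (κ * b0)
      - 2 / 3 * (1 / (1 + (q : ℂ) ^ 2)) * serS 2 q (κ * b0))
    * ((1 + (q : ℂ) ^ 2) / ((q : ℂ) ^ 2 * κ ^ 2))

/-- `D` is the analytic distillate at `x` of the vacuum-subtracted stress-energy tensor of the
conformally coupled massless real scalar field in AdS; `ε = 1, -1, 0` for Dirichlet, Neumann,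
transparent boundary conditions. -/
def IsAdSDistillate (ε κ T0 : ℝ) (x : Coord) (D : Fin 4 → Fin 4 → ℂ) : Prop :=
  ∃ G U A : ℂ,
    IsDistilledValue (fun k => -adsBulk (1 / T0) (κ * x 1) k
      + ε * adsBoundG (1 / T0) (κ * x 1) k) ((κ : ℂ) ^ 2) G ∧
    IsDistilledValue (fun k => 4 * adsBulk (1 / T0) (κ * x 1) k
      + ε * adsBoundU (1 / T0) (κ * x 1) k) ((κ : ℂ) ^ 2) U ∧
    IsDistilledValue (fun k => ε * adsBoundA (1 / T0) (κ * x 1) k) ((κ : ℂ) ^ 2) A ∧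
    ∀ μ ν, D μ ν = G * (adsMetric κ x μ ν : ℝ)
      + U * ((vel (adsMetric κ) (staticKilling T0) x μ
          * vel (adsMetric κ) (staticKilling T0) x ν : ℝ) : ℂ)
      + A * ((acc (adsMetric κ) (staticKilling T0) x μ
          * acc (adsMetric κ) (staticKilling T0) x ν : ℝ) : ℂ)

/-! ### De Sitter space-time, static patch -/

/-- `ds² = (1-κ²r²) dt² - (1-κ²r²)⁻¹ dr² - r² (dθ² + sin²θ dφ²)`. -/
def dsMetric (κ : ℝ) : Metric := fun x =>
  Matrix.diagonal ![1 - κ ^ 2 * x 1 ^ 2, -(1 - κ ^ 2 * x 1 ^ 2)⁻¹, -(x 1 ^ 2),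
    -(x 1 ^ 2 * Real.sin (x 2) ^ 2)]

/-- The scalar `(π²T₀⁴/90 - κ⁴/(1440π²)) / (1-q²)²`, with `q = κ r`. -/
def dsPressure (T0 q : ℝ) (κ : ℂ) : ℂ :=
  ((Real.pi : ℂ) ^ 2 / 90 * (T0 : ℂ) ^ 4 - κ ^ 4 / (1440 * (Real.pi : ℂ) ^ 2))
    * (1 / (1 - (q : ℂ) ^ 2)) ^ 2

/-- `D` is the analytic distillate at `x` of the stress-energy tensor (the trace anomaly
removed) of the conformally coupled massless real scalar field in dS. -/
def IsDSDistillate (κ T0 : ℝ) (x : Coord) (D : Fin 4 → Fin 4 → ℂ) : Prop :=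
  ∃ P : ℂ, IsDistilledValue (dsPressure T0 (κ * x 1)) ((κ : ℂ) ^ 2) P ∧
    ∀ μ ν, D μ ν = P * ((-(dsMetric κ x μ ν)
      + 4 * (vel (dsMetric κ) (staticKilling T0) x μ
          * vel (dsMetric κ) (staticKilling T0) x ν) : ℝ) : ℂ)

/-! ### Closed Einstein universe

Chart `(t, χ, θ, φ)`, radius `1/κ`, `β = (1/T₀)(1,0,0,κω₀)`. The scalar functions depend on
`κ`, `β₀ = 1/T₀`, `ω₀` and `S = sin²χ sin²θ`. -/

/-- `ds² = dt² - κ⁻² (dχ² + sin²χ (dθ² + sin²θ dφ²))`. -/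
def ceuMetric (κ : ℝ) : Metric := fun x =>
  Matrix.diagonal ![1, -(1 / κ ^ 2), -(1 / κ ^ 2 * Real.sin (x 1) ^ 2),
    -(1 / κ ^ 2 * Real.sin (x 1) ^ 2 * Real.sin (x 2) ^ 2)]

/-- The Killing field `(1/T₀)(1,0,0,κω₀)`. -/
def ceuKilling (κ w0 T0 : ℝ) : VField := fun _ => ![1 / T0, 0, 0, κ * w0 / T0]

/-- The variable `S = sin²χ sin²θ`. -/
def ceuS (x : Coord) : ℝ := Real.sin (x 1) ^ 2 * Real.sin (x 2) ^ 2

/-- The energy density of the non-rotating state,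
`(κ⁴/16π²) ∑_{n ≥ 1} (2 + cosh nκβ₀) / sinh⁴(nκβ₀/2)`. -/
def ceuRhoStatic (b0 : ℝ) (κ : ℂ) : ℂ :=
  κ ^ 4 / (16 * (Real.pi : ℂ) ^ 2) *
    ∑' n : ℕ, (2 + Complex.cosh (((n : ℂ) + 1) * (κ * b0)))
      / Complex.sinh (((n : ℂ) + 1) * (κ * b0) / 2) ^ 4

/-- The common denominator `(1 - S - cosh z + S cosh(ω₀z))³`. -/
def ceuDen (S w z : ℂ) : ℂ := (1 - S - Complex.cosh z + S * Complex.cosh (w * z)) ^ 3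

/-- Numerator for `ρ`. -/
def ceuNumR (S w z : ℂ) : ℂ :=
  2 * (1 + S ^ 2 * w ^ 2) + (-2 + S + S ^ 2 * w ^ 2) * Complex.cosh z
    + (1 + S * w ^ 2 - 2 * S ^ 2 * w ^ 2) * Complex.cosh (w * z)
    - (1 + S + S * w ^ 2 + S ^ 2 * w ^ 2) * Complex.cosh z * Complex.cosh (w * z)
    - (3 + S * w ^ 2) * Complex.sinh z ^ 2
    - S * (1 + 3 * S * w ^ 2) * Complex.sinh (w * z) ^ 2
    + 12 * S * w * Complex.sinh z * Complex.sinh (w * z)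

/-- Numerator for `p`. -/
def ceuNumP (S w z : ℂ) : ℂ :=
  1 + 7 * S + S * (7 + S) * w ^ 2 - (1 + 3 * S * w ^ 2) * Complex.cosh (2 * z)
    + 2 * (1 + S * (-2 + w ^ 2)) * Complex.cosh (w * z)
    - 2 * Complex.cosh z * (S * (-1 - (-2 + S) * w ^ 2)
        + (1 + S) * (1 + S * w ^ 2) * Complex.cosh (w * z))
    - S * (3 + S * w ^ 2) * Complex.cosh (2 * (w * z))
    + 24 * S * w * Complex.sinh z * Complex.sinh (w * z)

/-- Numerator for the coefficient of `A^μ A^ν`. -/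
def ceuNumA (w z : ℂ) : ℂ :=
  -(2 * (1 + w ^ 2)) + w ^ 2 * Complex.cosh (2 * z)
    + Complex.cosh z * (-1 + w ^ 2 + (1 + w ^ 2) * Complex.cosh (w * z))
    - (-1 + w ^ 2) * Complex.cosh (w * z) + Complex.cosh (2 * (w * z))
    - 6 * w * Complex.sinh z * Complex.sinh (w * z)

/-- Numerator for the coefficient of `ω^μ ω^ν`. -/
def ceuNumW (S w z : ℂ) : ℂ :=
  1 - 3 * S + (-3 + S) * S * w ^ 2 + S * w ^ 2 * Complex.cosh (2 * z)
    - (1 + S * (-2 + S * w ^ 2)) * Complex.cosh (w * z)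
    + S * Complex.cosh (2 * (w * z))
    + Complex.cosh z * (-1 - (-2 + S) * S * w ^ 2 + (1 + S ^ 2 * w ^ 2) * Complex.cosh (w * z))
    - 6 * S * w * Complex.sinh z * Complex.sinh (w * z)

/-- Numerator for the coefficient of `u^μ l^ν + u^ν l^μ` (up to the sign put in `ceuG`). -/
def ceuNumG (S w z : ℂ) : ℂ :=
  (1 + S) * w - (1 - S) * w * Complex.cosh z + (1 - S) * w * Complex.cosh (w * z)
    - (1 + S) * w * Complex.cosh z * Complex.cosh (w * z)
    - 2 * w * Complex.sinh z ^ 2 - 2 * S * w * Complex.sinh (w * z) ^ 2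
    + 3 * (1 + S * w ^ 2) * Complex.sinh z * Complex.sinh (w * z)

/-- `∑_{n ≥ 1} F(n z) / (1 - S - cosh(nz) + S cosh(n ω₀ z))³`. -/
def ceuSeries (F : ℂ → ℂ) (S w z : ℂ) : ℂ :=
  ∑' n : ℕ, F (((n : ℂ) + 1) * z) / ceuDen S w (((n : ℂ) + 1) * z)

/-- The energy density of the rotating state. -/
def ceuRho (b0 S w : ℝ) (κ : ℂ) : ℂ :=
  κ ^ 4 / (12 * (Real.pi : ℂ) ^ 2 * (1 - S * w ^ 2)) * ceuSeries (ceuNumR S w) S w (κ * b0)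

/-- The pressure of the rotating state. -/
def ceuP (b0 S w : ℝ) (κ : ℂ) : ℂ :=
  κ ^ 4 / (24 * (Real.pi : ℂ) ^ 2 * (1 - S * w ^ 2)) * ceuSeries (ceuNumP S w) S w (κ * b0)

/-- The coefficient of `A^μ A^ν`. -/
def ceuA (b0 S w : ℝ) (κ : ℂ) : ℂ :=
  κ ^ 2 * (1 - S * w ^ 2) / (6 * (Real.pi : ℂ) ^ 2 * (1 - S) * w ^ 4)
    * ceuSeries (ceuNumA w) S w (κ * b0)

/-- The coefficient of `ω^μ ω^ν`. -/
def ceuW (b0 S w : ℝ) (κ : ℂ) : ℂ :=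
  κ ^ 2 * (1 - S * w ^ 2) / (6 * (Real.pi : ℂ) ^ 2 * (1 - S) * w ^ 2)
    * ceuSeries (ceuNumW S w) S w (κ * b0)

/-- The coefficient of `u^μ l^ν + u^ν l^μ`. With `l` pointing in the direction of the rotation the
overall sign is the one for which the stress-energy tensor is covariantly conserved. -/
def ceuG (b0 S w : ℝ) (κ : ℂ) : ℂ :=
  -(κ ^ 2 * (1 - S * w ^ 2) / (6 * (Real.pi : ℂ) ^ 2 * (1 - S) * w ^ 3)
    * ceuSeries (ceuNumG S w) S w (κ * b0))

/-- `D` is the analytic distillate at `x` of the stress-energy tensor of the conformally coupled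
massless real scalar field in the non-rotating equilibrium state of the closed Einstein universe. -/
def IsCEUStaticDistillate (κ T0 : ℝ) (x : Coord) (D : Fin 4 → Fin 4 → ℂ) : Prop :=
  ∃ ρ : ℂ, IsDistilledValue (ceuRhoStatic (1 / T0)) ((κ : ℂ) ^ 2) ρ ∧
    ∀ μ ν, D μ ν = ρ * ((vel (ceuMetric κ) (staticKilling T0) x μ
          * vel (ceuMetric κ) (staticKilling T0) x ν : ℝ) : ℂ)
      - ρ / 3 * (proj (ceuMetric κ) (staticKilling T0) x μ ν : ℝ)

/-- `D` is the analytic distillate at `x` of the stress-energy tensor of the conformally coupled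
massless real scalar field in the rotating equilibrium state of the closed Einstein universe. -/
def IsCEUDistillate (κ w0 T0 : ℝ) (x : Coord) (D : Fin 4 → Fin 4 → ℂ) : Prop :=
  ∃ ρ p A W G : ℂ,
    IsDistilledValue (ceuRho (1 / T0) (ceuS x) w0) ((κ : ℂ) ^ 2) ρ ∧
    IsDistilledValue (ceuP (1 / T0) (ceuS x) w0) ((κ : ℂ) ^ 2) p ∧
    IsDistilledValue (ceuA (1 / T0) (ceuS x) w0) ((κ : ℂ) ^ 2) A ∧
    IsDistilledValue (ceuW (1 / T0) (ceuS x) w0) ((κ : ℂ) ^ 2) W ∧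
    IsDistilledValue (ceuG (1 / T0) (ceuS x) w0) ((κ : ℂ) ^ 2) G ∧
    ∀ μ ν, D μ ν =
      ρ * ((vel (ceuMetric κ) (ceuKilling κ w0 T0) x μ
          * vel (ceuMetric κ) (ceuKilling κ w0 T0) x ν : ℝ) : ℂ)
      - p * (proj (ceuMetric κ) (ceuKilling κ w0 T0) x μ ν : ℝ)
      + A * ((acc (ceuMetric κ) (ceuKilling κ w0 T0) x μ
          * acc (ceuMetric κ) (ceuKilling κ w0 T0) x ν : ℝ) : ℂ)
      + W * ((vort (ceuMetric κ) (ceuKilling κ w0 T0) x μ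
          * vort (ceuMetric κ) (ceuKilling κ w0 T0) x ν : ℝ) : ℂ)
      + G * (sym (vel (ceuMetric κ) (ceuKilling κ w0 T0) x)
          (lvec (ceuMetric κ) (ceuKilling κ w0 T0) x) μ ν : ℝ)

/-! ### Orders in the gradient expansion and matching

Under a rescaling of the global temperature `T₀` at fixed geometry, `T` is proportional to `T₀`
while `u`, `A`, `ω`, `l` and the curvature do not change. By dimensional analysis, the part of order
`j` in the derivatives is thus the part of the stress-energy tensor proportional to `T₀^(4-j)`. -/

/-- `F(T₀) = ∑_{j ≤ 4} c_j T₀^(4-j)` and `G` is the part of order `j` of `F`. -/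
def IsOrderPart (j : ℕ) (F G : ℝ → ℂ) : Prop :=
  ∃ c : ℕ → ℂ, ∀ T0 : ℝ, 0 < T0 →
    F T0 = ∑ i ∈ Finset.range 5, c i * (T0 : ℂ) ^ (4 - i) ∧ G T0 = c j * (T0 : ℂ) ^ (4 - j)

/-- For all global temperatures the distillate described by `P` exists, and its part of order `j`
is `Φ`. -/
def MatchesAtOrder (j : ℕ) (P : ℝ → (Fin 4 → Fin 4 → ℂ) → Prop) (Φ : ℝ → Tensor2) : Prop :=
  ∃ D : ℝ → Fin 4 → Fin 4 → ℂ, (∀ T0, 0 < T0 → P T0 (D T0)) ∧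
    ∀ μ ν, IsOrderPart j (fun T0 => D T0 μ ν) (fun T0 => (Φ T0 μ ν : ℂ))

/-- The covariant expression `Φ` is the order `j` part of the distillates in AdS, in dS and in the
closed Einstein universe (non-rotating and rotating; the points where the tetrad of the rotating
state degenerates are left out). -/
structure MatchesDistillates (j : ℕ) (Φ : Metric → VField → Coord → Tensor2) : Prop where
  ads : ∀ ε : ℝ, (ε = 1 ∨ ε = -1 ∨ ε = 0) → ∀ κ : ℝ, 0 < κ → ∀ x : Coord,
    0 < x 1 → 0 < x 2 → x 2 < Real.pi →
    MatchesAtOrder j (fun T0 => IsAdSDistillate ε κ T0 x)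
      (fun T0 => Φ (adsMetric κ) (staticKilling T0) x)
  ds : ∀ κ : ℝ, 0 < κ → ∀ x : Coord,
    0 < x 1 → κ * x 1 < 1 → 0 < x 2 → x 2 < Real.pi →
    MatchesAtOrder j (fun T0 => IsDSDistillate κ T0 x)
      (fun T0 => Φ (dsMetric κ) (staticKilling T0) x)
  ceuStatic : ∀ κ : ℝ, 0 < κ → ∀ x : Coord,
    0 < x 1 → x 1 < Real.pi → 0 < x 2 → x 2 < Real.pi →
    MatchesAtOrder j (fun T0 => IsCEUStaticDistillate κ T0 x)
      (fun T0 => Φ (ceuMetric κ) (staticKilling T0) x)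
  ceu : ∀ κ : ℝ, 0 < κ → ∀ w0 : ℝ, 0 < w0 → w0 < 1 → ∀ x : Coord,
    0 < x 1 → x 1 < Real.pi → 0 < x 2 → x 2 < Real.pi → ceuS x ≠ 1 →
    MatchesAtOrder j (fun T0 => IsCEUDistillate κ w0 T0 x)
      (fun T0 => Φ (ceuMetric κ) (ceuKilling κ w0 T0) x)

/-! ### Minkowski space-time -/

/-- The Minkowski metric in Cartesian coordinates. -/
def minkMetric : Metric := fun _ => Matrix.diagonal ![1, -1, -1, -1]

/-- The field with covariant components `β_μ = (b_μ + ϖ_{μν} x^ν) / T₀`. -/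
def minkKilling (b : Fin 4 → ℝ) (ϖ : Matrix (Fin 4) (Fin 4) ℝ) (T0 : ℝ) : VField := fun x =>
  raise minkMetric x (fun μ => (b μ + ∑ ν, ϖ μ ν * x ν) / T0)

/-- The stress-energy tensor of the conformally coupled massless scalar field at global equilibrium
in Minkowski space-time, for `A · ω = 0`:
`ρ u_μ u_ν - p Δ_{μν} + W ω_μ ω_ν + 𝒜 A_μ A_ν + G (u_μ l_ν + u_ν l_μ)`. -/
def minkTensor (β : VField) (x : Coord) : Tensor2 :=
  fun μ ν =>
  let T := temp minkMetric β x
  let u := vel minkMetric β x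
  let A := acc minkMetric β x
  let w := vort minkMetric β x
  let A2 := accSq minkMetric β x
  let w2 := vortSq minkMetric β x
  let π2 := Real.pi ^ 2
  let ρ := π2 / 30 * T ^ 4 - T ^ 2 * w2 / 36
    - (3 * A2 ^ 2 + 10 * w2 ^ 2 + 32 * A2 * w2) / (1440 * π2)
  let p := π2 / 90 * T ^ 4 - T ^ 2 * w2 / 36
    - (A2 ^ 2 + 10 * w2 ^ 2 + 64 * A2 * w2) / (1440 * π2)
  let W := -(T ^ 2 / 18) - (5 * A2 + w2) / (72 * π2)
  let a := -(w2 / (24 * π2))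
  let G := T ^ 2 / 18 + (w2 - A2) / (360 * π2)
  ρ * (u μ * u ν) - p * proj minkMetric β x μ ν + W * (w μ * w ν) + a * (A μ * A ν)
    + G * sym u (lvec minkMetric β x) μ ν

end ThermalDistillate

end

noncomputable section

namespace ThermalDistillate

open Filter Topology Asymptotics

/-! ### Uniqueness of asymptotic expansions and of distillates -/

/-! The proof has three ingredients: explicit distillates, explicit geometry, and linear algebra
that compares the two.

Distillates. Every scalar coefficient is a power of `κ` times a thermal sum `∑ F(nz)`, `z = κβ₀`,
with `F` even, holomorphic for `Re z > 0`, exponentially decaying, and of the form `a/z⁴ + b/z² + c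
+ o(1)` at `0`. Remove the polar part: it sums to `ζ(4)` and `ζ(2)` terms. What is left is regular
and decays quadratically in a strip around any ray of the right half-plane. Poisson summation on
that ray gives `C/z - c/2` up to a remainder smaller than every power
(`IsThermalTerm.hasThermalExpansion`). The constant `C` might depend on the ray, but after
multiplication by `κ⁴` or `κ²` it stands at an odd power of `κ`, which distillation discards. Hence
each distillate is a polynomial in `κ²` fixed by the Taylor data `a`, `b`, `c` of `F` at `0`
(`isDistilledValue_of_rays`). Distillates are unique (`IsDistillate.unique`), because any two
coverings by angular regions can be compared along single rays. The numerators of the rotating state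
are combinations of seven hyperbolic cosines, so `a`, `b`, `c` follow from even moments. The AdS
boundary sums have no polar part, and their constants cancel, so the AdS distillate does not depend
on the boundary conditions.

Geometry. AdS and dS are the two signs of one static family, and the closed Einstein universe is
another warped metric. All these space-times have vanishing Weyl tensor. In the static states `ω = l
= 0`, and the Ricci tensor is a combination of `u u` and `Δ`. In the rotating state `u`, `A`, `ω`,
`l` are an orthogonal frame, in which the Ricci tensor and the product `l l` are combinations of `u
u`, `Δ`, `A A`, `ω ω` and `u l + l u`. The general forms therefore reduce to a few scalar functions
of the curvature and of `y = Sω₀²`, `o = ω²`, `A² = yo` (`StaticFrame.secondOrder_eq`,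
`RotatingFrame.fourthOrder_eq`), and matching becomes a list of scalar equations.

Linear algebra. At second order finitely many sample points fix the thirteen coefficients, and the
solution is then checked at all points. At fourth order the system is underdetermined, and one
explicit solution proves existence. The coefficients of flat terms are nevertheless fixed: for given
`y` they stand at the highest power of `ω²` in the rotating equations, because each curvature factor
replaces a power of `ω²`. A second difference in `ω²` isolates them (`fourthCoeffs_of_matches`). In
Minkowski space-time only these terms survive, and they reproduce the known tensor. -/

lemma neBot_nhdsWithin_sector {I : Set ℝ} {θ : ℝ} (hθ : θ ∈ I)
    (h : θ ∈ Set.Ioo (-(Real.pi / 2)) (Real.pi / 2)) : (𝓝[sector I] (0 : ℂ)).NeBot := by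
  rw [← mem_closure_iff_nhdsWithin_neBot]
  have ht : Tendsto (fun t : ℝ => (t : ℂ) * Complex.exp (θ * Complex.I)) (𝓝[>] 0) (𝓝 0) := by
    have : Continuous (fun t : ℝ => (t : ℂ) * Complex.exp (θ * Complex.I)) := by fun_prop
    have h := this.tendsto 0
    simp only [Complex.ofReal_zero, zero_mul] at h
    exact h.mono_left nhdsWithin_le_nhds
  refine mem_closure_of_tendsto ht ?_
  filter_upwards [self_mem_nhdsWithin] with t ht
  have ht' : (0 : ℝ) < t := ht
  refine ⟨mul_ne_zero (by exact_mod_cast ht'.ne') (Complex.exp_ne_zero _), ?_⟩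
  have := Complex.arg_mul_cos_add_sin_mul_I ht' (θ := θ)
    ⟨by linarith [h.1, Real.pi_pos], by linarith [h.2, Real.pi_pos]⟩
  rw [Complex.exp_mul_I, this]
  exact hθ

lemma HasExpansion.mono {f : ℂ → ℂ} {s t : Set ℂ} {a : ℤ → ℂ} (h : HasExpansion f t a)
    (hst : s ⊆ t) : HasExpansion f s a := by
  obtain ⟨M, hM, h⟩ := h
  exact ⟨M, hM, fun N => (h N).mono (nhdsWithin_mono _ hst)⟩

lemma sum_Icc_eq_of_vanish {a : ℤ → ℂ} {m m' N : ℤ} (hm : m' ≤ m)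
    (ha : ∀ k < m, a k = 0) (κ : ℂ) :
    ∑ k ∈ Finset.Icc m' N, a k * κ ^ k = ∑ k ∈ Finset.Icc m N, a k * κ ^ k := by
  symm
  refine Finset.sum_subset (Finset.Icc_subset_Icc_left hm) fun k hk hk' => ?_
  rw [Finset.mem_Icc] at hk hk'
  rw [ha k (by omega), zero_mul]

/-- At the least index `m` where the coefficients differ, the difference of the truncated sums times
`κ ^ (-m)` tends to `a m - b m`. It also tends to `0`, by the two remainder estimates. -/
lemma HasExpansion.unique {f : ℂ → ℂ} {s : Set ℂ} {a b : ℤ → ℂ} (hs : (𝓝[s] (0 : ℂ)).NeBot)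
    (h0 : (0 : ℂ) ∉ s) (ha : HasExpansion f s a) (hb : HasExpansion f s b) : a = b := by
  obtain ⟨M, hM, ha⟩ := ha
  obtain ⟨M', hM', hb⟩ := hb
  by_contra hne
  obtain ⟨k₀, hk₀⟩ : ∃ k, a k - b k ≠ 0 := by
    by_contra! hc
    exact hne (funext fun k => sub_eq_zero.mp (hc k))
  obtain ⟨m, hm, hmin⟩ := Int.exists_least_of_bdd (P := fun k => a k - b k ≠ 0)
    ⟨-(max M M' : ℕ), fun k hk => by
      by_contra! hlt
      exact hk (by rw [hM k (by omega), hM' k (by omega), sub_zero])⟩ ⟨k₀, hk₀⟩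
  have hvan : ∀ k < m, a k - b k = 0 := fun k hk => by
    by_contra hc
    exact absurd (hmin k hc) (by omega)
  have hmM : -((max M M' : ℕ) : ℤ) ≤ m := by
    by_contra! hlt
    exact hm (by rw [hM m (by omega), hM' m (by omega), sub_zero])
  -- Remainders are controlled only at natural orders. For negative `m` order `0` serves: `N ≥ m` is
  -- enough for `κ ^ (-m) * κ ^ N` to stay bounded.
  set N : ℕ := m.toNat with hN
  have key : (fun κ : ℂ => ∑ k ∈ Finset.Icc m (N : ℤ), (a k - b k) * κ ^ k)
      =o[𝓝[s] 0] (fun κ : ℂ => κ ^ N) := by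
    have := (hb N).sub (ha N)
    refine this.congr_left fun κ => ?_
    rw [← sum_Icc_eq_of_vanish hmM hvan,
      ← sum_Icc_eq_of_vanish (m := -(M : ℤ)) (m' := -((max M M' : ℕ) : ℤ)) (by omega) hM,
      ← sum_Icc_eq_of_vanish (m := -(M' : ℤ)) (m' := -((max M M' : ℕ) : ℤ)) (by omega) hM']
    simp only [sub_mul, Finset.sum_sub_distrib]
    ring
  have hmem : ∀ᶠ κ : ℂ in 𝓝[s] 0, κ ≠ 0 := by
    filter_upwards [self_mem_nhdsWithin] with κ hκ h
    exact h0 (h ▸ hκ)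
  have hlim0 : Tendsto (fun κ : ℂ => κ ^ (-m) * ∑ k ∈ Finset.Icc m (N : ℤ), (a k - b k) * κ ^ k)
      (𝓝[s] 0) (𝓝 0) := by
    have h1 : (fun κ : ℂ => κ ^ (-m) * ∑ k ∈ Finset.Icc m (N : ℤ), (a k - b k) * κ ^ k)
        =o[𝓝[s] 0] (fun κ : ℂ => κ ^ (-m) * κ ^ N) := (isBigO_refl _ _).mul_isLittleO key
    have h2 : (fun κ : ℂ => κ ^ (-m) * κ ^ N) =O[𝓝[s] 0] (fun _ => (1 : ℂ)) := by
      have : (fun κ : ℂ => κ ^ (-m).toNat) =O[𝓝[s] 0] (fun _ => (1 : ℂ)) := by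
        have : Continuous fun κ : ℂ => κ ^ (-m).toNat := by fun_prop
        exact (this.tendsto 0).isBigO_one ℂ |>.mono nhdsWithin_le_nhds
      refine this.congr' ?_ EventuallyEq.rfl
      filter_upwards [hmem] with κ hκ
      rw [← zpow_natCast κ N, ← zpow_add₀ hκ, ← zpow_natCast]
      congr 1
      omega
    exact (isLittleO_one_iff ℂ).mp (h1.trans_isBigO h2)
  have hlim1 : Tendsto (fun κ : ℂ => κ ^ (-m) * ∑ k ∈ Finset.Icc m (N : ℤ), (a k - b k) * κ ^ k)
      (𝓝[s] 0) (𝓝 (a m - b m)) := by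
    have hc : Continuous fun κ : ℂ =>
        ∑ k ∈ Finset.Icc m (N : ℤ), (a k - b k) * κ ^ (k - m).toNat := by fun_prop
    have h := (hc.tendsto 0).mono_left (nhdsWithin_le_nhds (s := s))
    have hv : ∑ k ∈ Finset.Icc m (N : ℤ), (a k - b k) * (0 : ℂ) ^ (k - m).toNat = a m - b m := by
      rw [Finset.sum_eq_single m]
      · simp
      · intro k hk hkm
        rw [Finset.mem_Icc] at hk
        rw [zero_pow (by omega), mul_zero]
      · intro hc
        exact absurd (Finset.mem_Icc.mpr ⟨le_rfl, by omega⟩) hc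
    rw [hv] at h
    refine h.congr' ?_
    filter_upwards [hmem] with κ hκ
    rw [Finset.mul_sum]
    refine Finset.sum_congr rfl fun k hk => ?_
    rw [Finset.mem_Icc] at hk
    rw [mul_left_comm, ← zpow_add₀ hκ, ← zpow_natCast]
    congr 2
    omega
  exact hm (tendsto_nhds_unique hlim1 hlim0)

/-- Two regions sharing an angle `θ` carry the same coefficients, by uniqueness along the ray of
angle `θ`. Both families cover the same interval by nonempty regions, so each region of one meets a
region of the other. The two sets of coefficient sequences therefore coincide, and "common to all
regions" means the same for both. -/
lemma IsDistillate.unique {f : ℂ → ℂ} {c c' : ℕ → ℂ} (h : IsDistillate f c)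
    (h' : IsDistillate f c') : c = c' := by
  obtain ⟨ι, I, a, hne, hcov, hexp, hc, -⟩ := h
  obtain ⟨ι', I', a', hne', hcov', hexp', hc', -⟩ := h'
  have key : ∀ i j, ∀ θ ∈ I i, θ ∈ I' j → a i = a' j := fun i j θ hi hj => by
    have hθ : θ ∈ Set.Ioo (-(Real.pi / 2)) (Real.pi / 2) := hcov ▸ Set.mem_iUnion.mpr ⟨i, hi⟩
    exact HasExpansion.unique (neBot_nhdsWithin_sector (Set.mem_singleton θ) hθ)
      (fun h => h.1 rfl)
      ((hexp i).mono fun κ hκ => ⟨hκ.1, by rw [hκ.2]; exact hi⟩)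
      ((hexp' j).mono fun κ hκ => ⟨hκ.1, by rw [hκ.2]; exact hj⟩)
  have k1 : ∀ i, ∃ j, a i = a' j := fun i => by
    obtain ⟨θ, hi⟩ := hne i
    have hθ : θ ∈ ⋃ j, I' j := by rw [hcov', ← hcov]; exact Set.mem_iUnion.mpr ⟨i, hi⟩
    obtain ⟨j, hj⟩ := Set.mem_iUnion.mp hθ
    exact ⟨j, key i j θ hi hj⟩
  have k2 : ∀ j, ∃ i, a i = a' j := fun j => by
    obtain ⟨θ, hj⟩ := hne' j
    have hθ : θ ∈ ⋃ i, I i := by rw [hcov, ← hcov']; exact Set.mem_iUnion.mpr ⟨j, hj⟩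
    obtain ⟨i, hi⟩ := Set.mem_iUnion.mp hθ
    exact ⟨i, key i j θ hi hj⟩
  have hpos : (0 : ℝ) ∈ ⋃ i, I i := by
    rw [hcov]; exact ⟨by linarith [Real.pi_pos], by linarith [Real.pi_pos]⟩
  obtain ⟨i₀, -⟩ := Set.mem_iUnion.mp hpos
  funext n
  rcases hc n with h1 | ⟨h1, i, j, hij⟩ <;> rcases hc' n with h2 | ⟨h2, i', j', hij'⟩
  · obtain ⟨j, hj⟩ := k1 i₀
    rw [← h1 i₀, ← h2 j, hj]
  · obtain ⟨i, hi⟩ := k2 i'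
    obtain ⟨j, hj⟩ := k2 j'
    exact absurd (by rw [← hi, ← hj, h1, h1]) hij'
  · obtain ⟨i', hi⟩ := k1 i
    obtain ⟨j', hj⟩ := k1 j
    exact absurd (by rw [hi, hj, h2, h2]) hij
  · rw [h1, h2]

lemma IsDistilledValue.unique {f : ℂ → ℂ} {z v v' : ℂ} (h : IsDistilledValue f z v)
    (h' : IsDistilledValue f z v') : v = v' := by
  obtain ⟨c, hc, hv⟩ := h
  obtain ⟨c', hc', hv'⟩ := h'
  obtain rfl := hc.unique hc'
  exact hv.unique hv'

/-! ### Existence of distillates -/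

/-- Truncating `Q` at order `N` drops only powers above `N`, which are `o(κ ^ N)`. The remainder is
`O(κ ^ (N + 1))`, hence also `o(κ ^ N)`. -/
lemma hasExpansion_of_polynomial {f : ℂ → ℂ} {s : Set ℂ} (Q : Polynomial ℂ)
    (h : ∀ N : ℕ, (fun κ => f κ - Q.eval κ) =O[𝓝[s] 0] (fun κ : ℂ => κ ^ N)) :
    HasExpansion f s (fun k => if 0 ≤ k then Q.coeff k.toNat else 0) := by
  refine ⟨0, fun k hk => if_neg (by simpa using hk), fun N => ?_⟩
  have hlt : ∀ n : ℕ, N < n → (fun κ : ℂ => κ ^ n) =o[𝓝[s] 0] (fun κ : ℂ => κ ^ N) :=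
    fun n hn => (isLittleO_pow_pow hn).mono nhdsWithin_le_nhds
  have hsum : ∀ κ : ℂ, ∑ k ∈ Finset.Icc (-((0 : ℕ) : ℤ)) (N : ℤ),
      (if 0 ≤ k then Q.coeff k.toNat else 0) * κ ^ k
      = ∑ k ∈ Finset.range (N + 1), Q.coeff k * κ ^ k := fun κ => by
    symm
    refine Finset.sum_nbij' (fun k : ℕ => (k : ℤ)) Int.toNat ?_ ?_ ?_ ?_ ?_
    · intro k hk; simp at hk ⊢; omega
    · intro k hk; simp at hk ⊢; omega
    · intro k hk; simp
    · intro k hk; simp at hk ⊢; omega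
    · intro k hk; simp
  have heval : ∀ κ : ℂ, Q.eval κ = ∑ k ∈ Finset.range (N + 1), Q.coeff k * κ ^ k
      + ∑ k ∈ Finset.Ico (N + 1) (N + 1 + Q.natDegree + 1), Q.coeff k * κ ^ k := fun κ => by
    rw [Finset.sum_range_add_sum_Ico _ (by omega)]
    exact Polynomial.eval_eq_sum_range' (by omega) κ
  have h1 : (fun κ => f κ - Q.eval κ) =o[𝓝[s] 0] (fun κ : ℂ => κ ^ N) :=
    (h (N + 1)).trans_isLittleO (hlt _ (by omega))
  have h2 : (fun κ : ℂ => ∑ k ∈ Finset.Ico (N + 1) (N + 1 + Q.natDegree + 1), Q.coeff k * κ ^ k)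
      =o[𝓝[s] 0] (fun κ : ℂ => κ ^ N) :=
    IsLittleO.fun_sum fun k hk => (hlt k (by rw [Finset.mem_Ico] at hk; omega)).const_mul_left _
  refine (h1.add h2).congr_left fun κ => ?_
  rw [hsum, heval]
  ring

/-- The ray-dependent constant multiplies an odd power of `κ`, and distillation looks only at even
powers. Nothing has to be known about how `C` varies with the angle. -/
lemma isDistilledValue_of_rays {f : ℂ → ℂ} {e₀ e₁ e₂ : ℂ} {p : ℕ} (hp : Odd p)
    (h : ∀ θ ∈ Set.Ioo (-(Real.pi / 2)) (Real.pi / 2), ∃ C : ℂ, ∀ N : ℕ,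
      (fun κ => f κ - (e₀ + e₁ * κ ^ 2 + e₂ * κ ^ 4 + C * κ ^ p)) =O[𝓝[sector {θ}] 0]
        (fun κ : ℂ => κ ^ N)) (z : ℂ) :
    IsDistilledValue f z (e₀ + e₁ * z + e₂ * z ^ 2) := by
  classical
  choose! C hC using h
  let Q : ℝ → Polynomial ℂ := fun θ => Polynomial.C e₀ + Polynomial.C e₁ * Polynomial.X ^ 2
    + Polynomial.C e₂ * Polynomial.X ^ 4 + Polynomial.C (C θ) * Polynomial.X ^ p
  let c : ℕ → ℂ := fun n => if n = 0 then e₀ else if n = 1 then e₁ else if n = 2 then e₂ else 0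
  have hc0 : ∀ n ∉ Finset.range 3, c n = 0 := fun n hn => by
    simp only [Finset.mem_range, not_lt] at hn
    simp only [c]
    rw [if_neg (by omega), if_neg (by omega), if_neg (by omega)]
  -- The covering consists of the single rays, so no uniformity in the angle is required.
  refine ⟨c, ⟨Set.Ioo (-(Real.pi / 2)) (Real.pi / 2), fun θ => {(θ : ℝ)},
    fun θ k => if 0 ≤ k then (Q θ).coeff k.toNat else 0, fun θ => ⟨θ, rfl⟩, ?_, ?_, ?_, ?_⟩, ?_⟩
  · ext x; simp
  · intro θ
    refine hasExpansion_of_polynomial (Q θ) fun N => ?_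
    simpa [Q] using hC θ θ.2 N
  · intro n
    left
    intro θ
    have hcoe : (2 * (n : ℤ)).toNat = 2 * n := by omega
    have h3 : 2 * n ≠ p := fun h => by
      rw [← h] at hp
      exact (Nat.not_odd_iff_even.mpr (even_two_mul n)) hp
    beta_reduce
    rw [if_pos (by positivity), hcoe]
    simp only [Q, Polynomial.coeff_add, Polynomial.coeff_C_mul, Polynomial.coeff_X_pow,
      Polynomial.coeff_C, if_neg h3, c]
    rcases n with _ | _ | _ | n
    · simp
    · simp
    · simp
    · have : ¬ (2 * (n + 1 + 1 + 1) = 2) ∧ ¬ (2 * (n + 1 + 1 + 1) = 4) := by omega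
      simp [this.1, this.2]
  · exact ⟨1, one_pos, summable_of_ne_finset_zero (s := Finset.range 3) fun n hn => by
      rw [hc0 n hn]; simp⟩
  · have hv : e₀ + e₁ * z + e₂ * z ^ 2 = ∑ n ∈ Finset.range 3, c n * z ^ n := by
      simp [Finset.sum_range_succ, c]
    rw [hv]
    exact hasSum_sum_of_ne_finset_zero fun n hn => by rw [hc0 n hn, zero_mul]

section Poisson

open MeasureTheory FourierTransform

/-! ### Sums `∑ h(nt)` as `t → 0` for functions holomorphic in a strip -/

/-- `h` is holomorphic and decays quadratically in a strip around the real axis. -/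
def StripDecay (h : ℂ → ℂ) : Prop :=
  ∃ δ > 0, ∃ C : ℝ, DifferentiableOn ℂ h {z | |z.im| < δ} ∧
    ∀ z : ℂ, |z.im| < δ → ‖h z‖ ≤ C / (1 + z.re ^ 2)

lemma isOpen_strip (δ : ℝ) : IsOpen {z : ℂ | |z.im| < δ} :=
  isOpen_lt (by fun_prop) continuous_const

/-- Cauchy's estimate on discs of radius `δ / 4`, inside the strip of half the width. -/
lemma StripDecay.deriv {h : ℂ → ℂ} (hh : StripDecay h) : StripDecay (deriv h) := by
  obtain ⟨δ₀, hδ₀, C, hd, hb⟩ := hh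
  set δ := min δ₀ 1 with hδ
  have hδ0 : 0 < δ := lt_min hδ₀ one_pos
  have hδ1 : δ ≤ 1 := min_le_right _ _
  have hδ2 : δ ≤ δ₀ := min_le_left _ _
  have hC : 0 ≤ C := by
    have := (norm_nonneg _).trans (hb 0 (by simpa using hδ₀))
    simpa using this
  refine ⟨δ / 2, by positivity, 3 * C / (δ / 4), ?_, fun z hz => ?_⟩
  · refine (hd.deriv (isOpen_strip δ₀)).mono fun z hz => ?_
    have : |z.im| < δ / 2 := hz
    show |z.im| < δ₀
    linarith
  · have hball : ∀ w ∈ Metric.closedBall z (δ / 4), |w.im| < δ₀ ∧ |w.re - z.re| ≤ 1 := by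
      intro w hw
      rw [mem_closedBall_iff_norm] at hw
      have h1 := (Complex.abs_im_le_norm (w - z)).trans hw
      have h2 := (Complex.abs_re_le_norm (w - z)).trans hw
      rw [Complex.sub_im] at h1
      rw [Complex.sub_re] at h2
      refine ⟨?_, by linarith⟩
      have := abs_sub_abs_le_abs_sub w.im z.im
      linarith
    have hdc : DiffContOnCl ℂ h (Metric.ball z (δ / 4)) := by
      refine (DifferentiableOn.mono hd fun w hw => ?_).diffContOnCl
      exact (hball w (Metric.closure_ball_subset_closedBall hw)).1
    -- On the disc the real part moves by at most `1`, so `1 + (re z)² ≤ 3 (1 + (re w)²)`; this is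
    -- the factor `3`.
    have := Complex.norm_deriv_le_of_forall_mem_sphere_norm_le (C := 3 * C / (1 + z.re ^ 2))
      (by positivity : 0 < δ / 4) hdc fun w hw => by
        obtain ⟨h1, h2⟩ := hball w (Metric.sphere_subset_closedBall hw)
        refine (hb w h1).trans ?_
        rw [div_le_div_iff₀ (by positivity) (by positivity), mul_comm 3 C, mul_assoc]
        refine mul_le_mul_of_nonneg_left ?_ hC
        have h3 := abs_le.mp h2
        nlinarith [sq_nonneg (w.re + (w.re - z.re))]
    refine this.trans (le_of_eq ?_)
    field_simp

lemma StripDecay.iterate_deriv {h : ℂ → ℂ} (hh : StripDecay h) (n : ℕ) :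
    StripDecay (_root_.deriv^[n] h) := by
  induction n with
  | zero => exact hh
  | succ n ih => rw [Function.iterate_succ_apply']; exact ih.deriv

lemma StripDecay.differentiableAt {h : ℂ → ℂ} (hh : StripDecay h) (x : ℝ) :
    DifferentiableAt ℂ h x := by
  obtain ⟨δ, hδ, C, hd, -⟩ := hh
  exact (hd x (by simpa using hδ)).differentiableAt
    ((isOpen_strip δ).mem_nhds (by simpa using hδ))

lemma StripDecay.iteratedDeriv_comp_ofReal {h : ℂ → ℂ} (hh : StripDecay h) (n : ℕ) :
    iteratedDeriv n (fun x : ℝ => h x) = fun x : ℝ => (_root_.deriv^[n] h) x := by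
  induction n with
  | zero => rfl
  | succ n ih =>
    rw [iteratedDeriv_succ, ih]
    funext x
    rw [Function.iterate_succ_apply']
    exact ((hh.iterate_deriv n).differentiableAt x).hasDerivAt.comp_ofReal.deriv

lemma StripDecay.continuous {h : ℂ → ℂ} (hh : StripDecay h) : Continuous fun x : ℝ => h x :=
  continuous_iff_continuousAt.mpr fun x =>
    (hh.differentiableAt x).continuousAt.comp Complex.continuous_ofReal.continuousAt

lemma StripDecay.exists_bound {h : ℂ → ℂ} (hh : StripDecay h) :
    ∃ C : ℝ, ∀ x : ℝ, ‖h x‖ ≤ C * (1 + x ^ 2)⁻¹ := by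
  obtain ⟨δ, hδ, C, -, hb⟩ := hh
  refine ⟨C, fun x => ?_⟩
  simpa [div_eq_mul_inv] using hb x (by simpa using hδ)

lemma StripDecay.integrable {h : ℂ → ℂ} (hh : StripDecay h) : Integrable fun x : ℝ => h x := by
  obtain ⟨C, hC⟩ := hh.exists_bound
  exact (integrable_inv_one_add_sq.const_mul C).mono' hh.continuous.aestronglyMeasurable
    (Eventually.of_forall hC)

lemma StripDecay.contDiff {h : ℂ → ℂ} (hh : StripDecay h) :
    ContDiff ℝ ((⊤ : ℕ∞) : WithTop ℕ∞) fun x : ℝ => h x := by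
  refine contDiff_of_differentiable_iteratedDeriv fun m _ => ?_
  rw [hh.iteratedDeriv_comp_ofReal]
  exact fun x => ((hh.iterate_deriv m).differentiableAt x).hasDerivAt.comp_ofReal.differentiableAt

/-- All derivatives on the real axis are integrable, and the transform of the `n`-th one is
`(2πiξ)ⁿ` times the original transform. -/
lemma StripDecay.fourier_bound {h : ℂ → ℂ} (hh : StripDecay h) (n : ℕ) :
    ∃ C : ℝ, ∀ ξ : ℝ, |ξ| ^ n * ‖𝓕 (fun x : ℝ => h x) ξ‖ ≤ C := by
  have h1 := Real.fourier_iteratedDeriv (n := n) hh.contDiff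
    (fun m _ => by rw [hh.iteratedDeriv_comp_ofReal]; exact (hh.iterate_deriv m).integrable)
    (by exact_mod_cast le_top)
  refine ⟨∫ x : ℝ, ‖iteratedDeriv n (fun x : ℝ => h x) x‖, fun ξ => ?_⟩
  have h2 : ‖𝓕 (iteratedDeriv n fun x : ℝ => h x) ξ‖
      ≤ ∫ x : ℝ, ‖iteratedDeriv n (fun x : ℝ => h x) x‖ :=
    VectorFourier.norm_fourierIntegral_le_integral_norm _ _ _ _ _
  rw [h1] at h2
  refine le_trans ?_ h2
  rw [norm_smul, norm_pow]
  refine mul_le_mul_of_nonneg_right (pow_le_pow_left₀ (abs_nonneg _) ?_ _) (norm_nonneg _)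
  rw [norm_mul, norm_mul, norm_mul, Complex.norm_I, Complex.norm_real, Complex.norm_real,
    Real.norm_eq_abs, Real.norm_eq_abs, abs_of_pos Real.pi_pos]
  have : (1 : ℝ) ≤ ‖(2 : ℂ)‖ * Real.pi * 1 := by
    rw [Complex.norm_ofNat]; linarith [Real.pi_gt_three]
  nlinarith [abs_nonneg ξ]

lemma fourier_comp_mul_left_of_pos {g : ℝ → ℂ} {t : ℝ} (ht : 0 < t) (ξ : ℝ) :
    𝓕 (fun x => g (t * x)) ξ = (t⁻¹ : ℝ) • 𝓕 g (ξ / t) := by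
  rw [Real.fourier_real_eq_integral_exp_smul, Real.fourier_real_eq_integral_exp_smul]
  have := Measure.integral_comp_mul_left
    (fun y : ℝ => Complex.exp (↑(-2 * Real.pi * y * (ξ / t)) * Complex.I) • g y) t
  rw [abs_of_pos (inv_pos.mpr ht)] at this
  rw [← this]
  congr 1
  funext x
  have : -2 * Real.pi * (t * x) * (ξ / t) = -2 * Real.pi * x * ξ := by field_simp
  rw [this]

lemma StripDecay.summable_comp_mul {h : ℂ → ℂ} (hh : StripDecay h) {t : ℝ} (ht : 0 < t) :
    Summable fun n : ℤ => h ((t * n : ℝ) : ℂ) := by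
  obtain ⟨C, hC⟩ := hh.exists_bound
  have hC0 : 0 ≤ C := by simpa using (norm_nonneg _).trans (hC 0)
  have h1 : Summable fun n : ℤ => C / t ^ 2 * (1 / (n : ℝ) ^ 2) :=
    (Real.summable_one_div_int_pow.mpr one_lt_two).mul_left _
  refine h1.of_norm_bounded_eventually ?_
  filter_upwards [(Set.finite_singleton (0 : ℤ)).compl_mem_cofinite] with n hn
  have hn' : (n : ℝ) ≠ 0 := by exact_mod_cast hn
  refine (hC _).trans ?_
  rw [div_mul_div_comm, mul_one, ← mul_pow, div_eq_mul_inv]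
  have : 0 < (t * n) ^ 2 := by positivity
  gcongr
  linarith

/-- By Poisson summation the dilated sum equals `t⁻¹ ∑ ĥ(m/t)`. The term `m = 0` is the leading one,
and the rapid decay of `ĥ` makes all the others small to any order. -/
lemma StripDecay.poisson {h : ℂ → ℂ} (hh : StripDecay h) (N : ℕ) :
    ∃ C : ℝ, ∀ t : ℝ, 0 < t →
      ‖∑' n : ℤ, h ((t * n : ℝ) : ℂ) - 𝓕 (fun x : ℝ => h x) 0 / t‖ ≤ C * t ^ (N + 1) := by
  -- Of the `N + 2` powers of `t`, one is lost to the prefactor `t⁻¹`; of the powers of `m`, two are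
  -- kept to sum over `m`.
  obtain ⟨C, hC⟩ := hh.fourier_bound (N + 2)
  set S : ℝ := ∑' m : ℤ, 1 / (m : ℝ) ^ 2 with hS
  have hsum : Summable fun m : ℤ => 1 / (m : ℝ) ^ 2 := Real.summable_one_div_int_pow.mpr one_lt_two
  have hC0 : 0 ≤ C := le_trans (by positivity) (hC 0)
  refine ⟨C * S, fun t ht => ?_⟩
  set g : ℝ → ℂ := fun x => h x with hg
  have hbound : ∀ m : ℤ, m ≠ 0 →
      ‖𝓕 (fun x => g (t * x)) (m : ℝ)‖ ≤ C * t ^ (N + 1) * (1 / (m : ℝ) ^ 2) := fun m hm => by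
    have hm1 : (1 : ℝ) ≤ |(m : ℝ)| := by exact_mod_cast Int.one_le_abs hm
    have h1 := hC ((m : ℝ) / t)
    rw [fourier_comp_mul_left_of_pos ht, norm_smul, Real.norm_of_nonneg (inv_pos.mpr ht).le]
    rw [abs_div, abs_of_pos ht, div_pow, div_mul_eq_mul_div, div_le_iff₀ (by positivity)] at h1
    have h2 : |(m : ℝ)| ^ 2 ≤ |(m : ℝ)| ^ (N + 2) := pow_le_pow_right₀ hm1 (by omega)
    have h3 : |(m : ℝ)| ^ 2 * ‖𝓕 g ((m : ℝ) / t)‖ ≤ C * t ^ (N + 2) :=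
      (mul_le_mul_of_nonneg_right h2 (norm_nonneg _)).trans h1
    rw [sq_abs] at h3
    have hm2 : 0 < (m : ℝ) ^ 2 := by
      have : (m : ℝ) ≠ 0 := by exact_mod_cast hm
      positivity
    rw [mul_one_div, le_div_iff₀ hm2, inv_mul_eq_div, div_mul_eq_mul_div, div_le_iff₀ ht]
    calc _ = (m : ℝ) ^ 2 * ‖𝓕 g ((m : ℝ) / t)‖ := by ring
      _ ≤ _ := h3
      _ = _ := by ring
  have hFsum : Summable fun m : ℤ => 𝓕 (fun x => g (t * x)) (m : ℝ) := by
    refine (hsum.mul_left (C * t ^ (N + 1))).of_norm_bounded_eventually ?_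
    filter_upwards [(Set.finite_singleton (0 : ℤ)).compl_mem_cofinite] with n hn
    exact hbound n hn
  have hcont : Continuous fun x => g (t * x) := hh.continuous.comp (by fun_prop)
  have hdecay : (fun x => g (t * x)) =O[cocompact ℝ] fun x : ℝ => |x| ^ (-(2 : ℝ)) := by
    obtain ⟨B, hB⟩ := hh.exists_bound
    have hB0 : 0 ≤ B := by simpa using (norm_nonneg _).trans (hB 0)
    refine IsBigO.of_bound (B / t ^ 2) ?_
    have : ({0}ᶜ : Set ℝ) ∈ cocompact ℝ := isCompact_singleton.compl_mem_cocompact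
    filter_upwards [this] with x hx
    have hx' : x ≠ 0 := hx
    rw [Real.norm_of_nonneg (by positivity), Real.rpow_neg (abs_nonneg _), Real.rpow_two, sq_abs,
      div_eq_mul_inv, mul_assoc, ← mul_inv, ← mul_pow]
    refine (hB _).trans ?_
    have : 0 < (t * x) ^ 2 := by positivity
    gcongr
    linarith
  have hP := Real.tsum_eq_tsum_fourier_of_rpow_decay_of_summable hcont one_lt_two hdecay hFsum 0
  simp only [zero_add, QuotientAddGroup.mk_zero, fourier_eval_zero, mul_one] at hP
  have hP' : ∑' n : ℤ, h ((t * n : ℝ) : ℂ) = ∑' m : ℤ, 𝓕 (fun x => g (t * x)) (m : ℝ) := hP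
  rw [hP', hFsum.tsum_eq_add_tsum_ite 0]
  have h0 : 𝓕 (fun x => g (t * x)) ((0 : ℤ) : ℝ) = 𝓕 g 0 / t := by
    rw [fourier_comp_mul_left_of_pos ht, Int.cast_zero, zero_div, Complex.real_smul,
      Complex.ofReal_inv, inv_mul_eq_div]
  rw [h0, add_sub_cancel_left]
  have hHS : HasSum (fun m : ℤ => C * t ^ (N + 1) * (1 / (m : ℝ) ^ 2)) (C * S * t ^ (N + 1)) := by
    have := hsum.hasSum.mul_left (C * t ^ (N + 1))
    rwa [mul_right_comm] at this
  refine tsum_of_norm_bounded hHS fun m => ?_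
  split_ifs with hm
  · rw [norm_zero, hm]; simp
  · exact hbound m hm

/-- The sum over `n ≥ 1` for an even function, to all orders in `t`. -/
lemma StripDecay.tsum_even {h : ℂ → ℂ} (hh : StripDecay h) (he : ∀ x : ℝ, h (-x) = h x) :
    ∃ C : ℂ, ∀ N : ℕ, (fun t : ℝ => ∑' n : ℕ, h ((((n : ℝ) + 1) * t : ℝ) : ℂ)
      - (C / t - h 0 / 2)) =O[𝓝[>] 0] (fun t : ℝ => t ^ N) := by
  refine ⟨𝓕 (fun x : ℝ => h x) 0 / 2, fun N => ?_⟩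
  obtain ⟨C, hC⟩ := hh.poisson N
  have h1 : (fun t : ℝ => ∑' n : ℕ, h ((((n : ℝ) + 1) * t : ℝ) : ℂ)
      - (𝓕 (fun x : ℝ => h x) 0 / 2 / t - h 0 / 2)) =O[𝓝[>] 0] (fun t : ℝ => t ^ (N + 1)) := by
    refine IsBigO.of_bound (C / 2) ?_
    filter_upwards [self_mem_nhdsWithin] with t ht
    have ht : 0 < t := ht
    have hs := hh.summable_comp_mul ht
    have hsplit : ∑' n : ℤ, h ((t * n : ℝ) : ℂ)
        = h 0 + 2 * ∑' n : ℕ, h ((((n : ℝ) + 1) * t : ℝ) : ℂ) := by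
      rw [tsum_of_nat_of_neg_add_one (f := fun n : ℤ => h ((t * n : ℝ) : ℂ))
        (hs.comp_injective Nat.cast_injective)
        (hs.comp_injective (i := fun n : ℕ => -((n : ℤ) + 1)) fun a b hab => by
          simpa using hab)]
      have hn : Summable fun n : ℕ => h ((t * ((n : ℤ) : ℝ) : ℝ) : ℂ) :=
        hs.comp_injective Nat.cast_injective
      rw [hn.tsum_eq_zero_add]
      have e1 : ∀ n : ℕ, h ((t * ((-((n : ℤ) + 1) : ℤ) : ℝ) : ℝ) : ℂ)
          = h ((((n : ℝ) + 1) * t : ℝ) : ℂ) := fun n => by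
        rw [← he]; congr 1; push_cast; ring
      have e2 : ∀ n : ℕ, h ((t * (((n + 1 : ℕ) : ℤ) : ℝ) : ℝ) : ℂ)
          = h ((((n : ℝ) + 1) * t : ℝ) : ℂ) := fun n => by
        congr 1; push_cast; ring
      simp only [e1, e2]
      simp
      ring
    have h2 := hC t ht
    rw [hsplit] at h2
    rw [Real.norm_of_nonneg (by positivity : (0 : ℝ) ≤ t ^ (N + 1)), div_mul_eq_mul_div,
      le_div_iff₀ two_pos]
    refine le_trans (le_of_eq ?_) h2
    rw [← Complex.norm_two, ← norm_mul]
    congr 1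
    ring
  refine h1.trans ?_
  have : (fun t : ℝ => t ^ (N + 1)) =O[𝓝 0] (fun t : ℝ => t ^ N) :=
    (isLittleO_pow_pow (Nat.lt_succ_self N)).isBigO
  exact this.mono nhdsWithin_le_nhds

end Poisson

/-! ### Expansions of thermal series -/

/-- On each ray of the right half-plane, `s z = a / z⁴ + b / z² + C / z + c` up to a remainder of
infinite order, where `C` may depend on the ray. -/
def HasThermalExpansion (s : ℂ → ℂ) (a b c : ℂ) : Prop :=
  ∀ θ ∈ Set.Ioo (-(Real.pi / 2)) (Real.pi / 2), ∃ C : ℂ, ∀ N : ℕ,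
    (fun z => s z - (a / z ^ 4 + b / z ^ 2 + C / z + c)) =O[𝓝[sector {θ}] 0] (fun z : ℂ => z ^ N)

lemma re_pos_of_mem_sector {θ : ℝ} (hθ : θ ∈ Set.Ioo (-(Real.pi / 2)) (Real.pi / 2)) {z : ℂ}
    (hz : z ∈ sector {θ}) : 0 < z.re := by
  have h1 : z.arg = θ := hz.2
  have h2 : |z.arg| < Real.pi / 2 := by rw [h1]; exact abs_lt.mpr hθ
  rcases Complex.abs_arg_lt_pi_div_two_iff.mp h2 with h | h
  · exact h
  · exact absurd h hz.1

lemma HasThermalExpansion.congr {s s' : ℂ → ℂ} {a b c : ℂ} (h : HasThermalExpansion s a b c)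
    (hs : ∀ z : ℂ, 0 < z.re → s' z = s z) : HasThermalExpansion s' a b c := by
  intro θ hθ
  obtain ⟨C, hC⟩ := h θ hθ
  refine ⟨C, fun N => (hC N).congr' ?_ EventuallyEq.rfl⟩
  filter_upwards [self_mem_nhdsWithin] with z hz
  rw [hs z (re_pos_of_mem_sector hθ hz)]

lemma HasThermalExpansion.add {s s' : ℂ → ℂ} {a b c a' b' c' : ℂ}
    (h : HasThermalExpansion s a b c) (h' : HasThermalExpansion s' a' b' c') :
    HasThermalExpansion (fun z => s z + s' z) (a + a') (b + b') (c + c') := by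
  intro θ hθ
  obtain ⟨C, hC⟩ := h θ hθ
  obtain ⟨C', hC'⟩ := h' θ hθ
  refine ⟨C + C', fun N => ((hC N).add (hC' N)).congr_left fun z => ?_⟩
  ring

lemma HasThermalExpansion.const_mul {s : ℂ → ℂ} {a b c : ℂ} (h : HasThermalExpansion s a b c)
    (r : ℂ) : HasThermalExpansion (fun z => r * s z) (r * a) (r * b) (r * c) := by
  intro θ hθ
  obtain ⟨C, hC⟩ := h θ hθ
  refine ⟨r * C, fun N => ((hC N).const_mul_left r).congr_left fun z => ?_⟩
  ring

lemma tendsto_mul_ofReal_sector {β θ : ℝ} (hβ : 0 < β) :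
    Tendsto (fun κ : ℂ => κ * β) (𝓝[sector {θ}] 0) (𝓝[sector {θ}] 0) := by
  refine tendsto_nhdsWithin_iff.mpr ⟨?_, ?_⟩
  · have : Continuous fun κ : ℂ => κ * β := by fun_prop
    have h := this.tendsto 0
    rw [zero_mul] at h
    exact h.mono_left nhdsWithin_le_nhds
  · filter_upwards [self_mem_nhdsWithin] with κ hκ
    have h1 : κ.arg = θ := hκ.2
    refine ⟨mul_ne_zero hκ.1 (by exact_mod_cast hβ.ne'), ?_⟩
    rw [Set.mem_singleton_iff, mul_comm, Complex.arg_real_mul _ hβ, h1]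

/-- Multiplication by a positive real preserves each ray, so the same ray-dependent constant serves.
-/
lemma HasThermalExpansion.comp_mul_ofReal {s : ℂ → ℂ} {a b c : ℂ}
    (h : HasThermalExpansion s a b c) {β : ℝ} (hβ : 0 < β) {θ : ℝ}
    (hθ : θ ∈ Set.Ioo (-(Real.pi / 2)) (Real.pi / 2)) : ∃ C : ℂ, ∀ N : ℕ,
    (fun κ => s (κ * β) - (a / (κ * β) ^ 4 + b / (κ * β) ^ 2 + C / (κ * β) + c))
      =O[𝓝[sector {θ}] 0] (fun κ : ℂ => κ ^ N) := by
  obtain ⟨C, hC⟩ := h θ hθ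
  refine ⟨C, fun N => ((hC N).comp_tendsto (tendsto_mul_ofReal_sector hβ)).trans ?_⟩
  have : ((fun z : ℂ => z ^ N) ∘ fun κ : ℂ => κ * β) = fun κ : ℂ => (β : ℂ) ^ N * κ ^ N := by
    funext κ; simp [mul_pow, mul_comm]
  rw [this]
  exact isBigO_const_mul_self _ _ _

lemma isBigO_pow_mul {l : Filter ℂ} (hl : l ≤ 𝓝 0) {r : ℂ → ℂ} {N : ℕ}
    (h : r =O[l] fun κ : ℂ => κ ^ N) (j : ℕ) (A : ℂ) :
    (fun κ : ℂ => A * κ ^ j * r κ) =O[l] fun κ : ℂ => κ ^ N := by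
  have h1 : (fun κ : ℂ => A * κ ^ j) =O[l] fun _ => (1 : ℂ) := by
    have : Continuous fun κ : ℂ => A * κ ^ j := by fun_prop
    exact (this.tendsto 0).isBigO_one ℂ |>.mono hl
  simpa using h1.mul h

/-- The prefactor `κ⁴` turns the four terms into `κ⁰`, `κ²`, `κ³`, `κ⁴`. The `C` term is the odd one
and drops out. With `β = 1 / T₀` the survivors carry `T₀⁴`, `T₀²`, `T₀⁰`. -/
lemma HasThermalExpansion.isDistilledValue_four {s : ℂ → ℂ} {a b c : ℂ}
    (h : HasThermalExpansion s a b c) {β : ℝ} (hβ : 0 < β) (A z : ℂ) :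
    IsDistilledValue (fun κ => A * κ ^ 4 * s (κ * β)) z
      (A * a / β ^ 4 + A * b / β ^ 2 * z + A * c * z ^ 2) := by
  refine isDistilledValue_of_rays (p := 3) (by decide) (fun θ hθ => ?_) z
  obtain ⟨C, hC⟩ := h.comp_mul_ofReal hβ hθ
  refine ⟨A * C / β, fun N => (isBigO_pow_mul nhdsWithin_le_nhds (hC N) 4 A).congr' ?_
    EventuallyEq.rfl⟩
  have hβ' : (β : ℂ) ≠ 0 := by exact_mod_cast hβ.ne'
  filter_upwards [self_mem_nhdsWithin] with κ hκ
  have := hκ.1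
  field_simp
  ring

/-- With the prefactor `κ²` the ray-dependent term has order `κ`. A nonzero `a` would leave a
negative power, hence the `0`. -/
lemma HasThermalExpansion.isDistilledValue_two {s : ℂ → ℂ} {b c : ℂ}
    (h : HasThermalExpansion s 0 b c) {β : ℝ} (hβ : 0 < β) (A z : ℂ) :
    IsDistilledValue (fun κ => A * κ ^ 2 * s (κ * β)) z (A * b / β ^ 2 + A * c * z) := by
  have := isDistilledValue_of_rays (f := fun κ => A * κ ^ 2 * s (κ * β)) (e₀ := A * b / β ^ 2)
    (e₁ := A * c) (e₂ := 0) (p := 1) (by decide) (fun θ hθ => by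
      obtain ⟨C, hC⟩ := h.comp_mul_ofReal hβ hθ
      refine ⟨A * C / β, fun N => (isBigO_pow_mul nhdsWithin_le_nhds (hC N) 2 A).congr' ?_
        EventuallyEq.rfl⟩
      have hβ' : (β : ℂ) ≠ 0 := by exact_mod_cast hβ.ne'
      filter_upwards [self_mem_nhdsWithin] with κ hκ
      have := hκ.1
      field_simp
      ring) z
  simpa using this

/-- The properties of `F` that determine the expansion of `∑ F(nz)`, `n ≥ 1`. -/
structure IsThermalTerm (F : ℂ → ℂ) (a b c : ℂ) : Prop where
  even : ∀ z, F (-z) = F z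
  differentiableAt : ∀ z : ℂ, 0 < z.re → DifferentiableAt ℂ F z
  near : ∀ᶠ z in 𝓝[≠] (0 : ℂ), DifferentiableAt ℂ F z
  polar : Tendsto (fun z => F z - a / z ^ 4 - b / z ^ 2) (𝓝[≠] 0) (𝓝 c)
  decay : ∃ C X : ℝ, ∀ z : ℂ, X ≤ z.re → ‖F z‖ ≤ C * Real.exp (-z.re)

/-- `F` without its polar part. -/
def regularPart (F : ℂ → ℂ) (a b c : ℂ) : ℂ → ℂ :=
  Function.update (fun z => F z - a / z ^ 4 - b / z ^ 2) 0 c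

lemma regularPart_of_ne {F : ℂ → ℂ} {a b c z : ℂ} (hz : z ≠ 0) :
    regularPart F a b c z = F z - a / z ^ 4 - b / z ^ 2 := Function.update_of_ne hz _ _

lemma regularPart_zero {F : ℂ → ℂ} {a b c : ℂ} : regularPart F a b c 0 = c :=
  Function.update_self _ _ _

lemma regularPart_differentiableAt_of_ne {F : ℂ → ℂ} {a b c z : ℂ} (hz : z ≠ 0)
    (h : DifferentiableAt ℂ F z) : DifferentiableAt ℂ (regularPart F a b c) z := by
  have h1 : DifferentiableAt ℂ (fun z => F z - a / z ^ 4 - b / z ^ 2) z := by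
    refine (h.sub ?_).sub ?_
    · exact (differentiableAt_const _).div (by fun_prop) (pow_ne_zero _ hz)
    · exact (differentiableAt_const _).div (by fun_prop) (pow_ne_zero _ hz)
  refine h1.congr_of_eventuallyEq ?_
  filter_upwards [isOpen_ne.mem_nhds hz] with w hw
  exact regularPart_of_ne hw

namespace IsThermalTerm

variable {F : ℂ → ℂ} {a b c : ℂ}

lemma regularPart_even (h : IsThermalTerm F a b c) (z : ℂ) :
    regularPart F a b c (-z) = regularPart F a b c z := by
  by_cases hz : z = 0
  · rw [hz, neg_zero]
  · rw [regularPart_of_ne hz, regularPart_of_ne (neg_ne_zero.mpr hz), h.even]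
    norm_num [neg_pow]

/-- Removable singularity at `0`: the polar limit makes the extended function continuous there. -/
lemma exists_ball (h : IsThermalTerm F a b c) :
    ∃ r > 0, ∀ z : ℂ, ‖z‖ < r → DifferentiableAt ℂ (regularPart F a b c) z := by
  have h0 : DifferentiableAt ℂ (regularPart F a b c) 0 := by
    refine (Complex.analyticAt_of_differentiable_on_punctured_nhds_of_continuousAt ?_
      ?_).differentiableAt
    · filter_upwards [h.near, self_mem_nhdsWithin] with z hz hz0
      exact regularPart_differentiableAt_of_ne hz0 hz
    · rw [continuousAt_iff_punctured_nhds, regularPart_zero]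
      refine h.polar.congr' ?_
      filter_upwards [self_mem_nhdsWithin] with z hz
      exact (regularPart_of_ne hz).symm
  obtain ⟨r, hr, hb⟩ := Metric.mem_nhdsWithin_iff.mp h.near
  refine ⟨r, hr, fun z hz => ?_⟩
  by_cases hz0 : z = 0
  · rw [hz0]; exact h0
  · exact regularPart_differentiableAt_of_ne hz0 (hb ⟨by simpa using hz, hz0⟩)

lemma regularPart_differentiableAt (h : IsThermalTerm F a b c) {z : ℂ} (hz : z.re ≠ 0) :
    DifferentiableAt ℂ (regularPart F a b c) z := by
  have hpos : ∀ w : ℂ, 0 < w.re → DifferentiableAt ℂ (regularPart F a b c) w := fun w hw =>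
    regularPart_differentiableAt_of_ne (fun h0 => by simp [h0] at hw) (h.differentiableAt w hw)
  rcases lt_or_gt_of_ne hz with hz | hz
  · have h1 : DifferentiableAt ℂ (regularPart F a b c) (-z) := hpos _ (by simpa using hz)
    have h2 : DifferentiableAt ℂ (fun w => regularPart F a b c (-w)) z :=
      DifferentiableAt.comp z h1 differentiableAt_fun_id.fun_neg
    simpa only [h.regularPart_even] using h2
  · exact hpos z hz

lemma norm_le_exp_abs (h : IsThermalTerm F a b c) :
    ∃ C X : ℝ, 0 ≤ C ∧ ∀ z : ℂ, X ≤ |z.re| → ‖F z‖ ≤ C * Real.exp (-|z.re|) := by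
  obtain ⟨C, X, hC⟩ := h.decay
  refine ⟨C, X, ?_, fun z hz => ?_⟩
  · have := (norm_nonneg _).trans (hC (X : ℂ) (by simp))
    exact nonneg_of_mul_nonneg_left this (Real.exp_pos _)
  · rcases le_total 0 z.re with h0 | h0
    · rw [abs_of_nonneg h0] at hz ⊢
      exact hC z hz
    · rw [abs_of_nonpos h0] at hz ⊢
      have := hC (-z) (by simpa using hz)
      rwa [h.even] at this

/-- Rotation by `e` carries the real axis to a line transverse to the imaginary axis, where other
singularities of `F` may lie. A thin strip around this line meets the imaginary axis only near `0`,
where the singularity has been removed. Far out, `F` is exponentially small and the subtracted polar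
part is quadratically small; the remaining piece is compact. -/
lemma stripDecay (h : IsThermalTerm F a b c) {e : ℂ} (he : ‖e‖ = 1) (he' : 0 < e.re) :
    StripDecay fun w => regularPart F a b c (e * w) := by
  obtain ⟨r, hr, hball⟩ := h.exists_ball
  obtain ⟨C, X, hC0, hC⟩ := h.norm_le_exp_abs
  have hre1 : e.re ≤ 1 := by rw [← he]; exact (le_abs_self _).trans (Complex.abs_re_le_norm e)
  have him1 : |e.im| ≤ 1 := by rw [← he]; exact Complex.abs_im_le_norm e
  -- If `Re (e w) = 0`, then `e.re * |w.re| ≤ |w.im| < δ`. So both parts of `w` are below `r / 3`,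
  -- and `e * w` lies in the ball of regularity.
  set δ : ℝ := min 1 (r * e.re / 3) with hδ
  have hδ0 : 0 < δ := lt_min one_pos (by positivity)
  have hδ1 : δ ≤ 1 := min_le_left _ _
  have hδ2 : δ ≤ r * e.re / 3 := min_le_right _ _
  have hnorm : ∀ w : ℂ, ‖e * w‖ = ‖w‖ := fun w => by rw [norm_mul, he, one_mul]
  have hre : ∀ w : ℂ, e.re * |w.re| - |w.im| ≤ |(e * w).re| := fun w => by
    rw [Complex.mul_re]
    have h1 := abs_sub_abs_le_abs_sub (e.re * w.re) (e.im * w.im)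
    rw [abs_mul, abs_mul, abs_of_pos he'] at h1
    nlinarith [abs_nonneg w.im]
  have hdiff : ∀ w : ℂ, |w.im| < δ →
      DifferentiableAt ℂ (fun w => regularPart F a b c (e * w)) w := fun w hw => by
    refine DifferentiableAt.comp (g := regularPart F a b c) w ?_ (by fun_prop)
    by_cases hz : (e * w).re = 0
    · refine hball _ ?_
      have h1 := hre w
      rw [hz, abs_zero] at h1
      rw [hnorm]
      have h2 : e.re * |w.re| < e.re * (r / 3) := by nlinarith
      have h3 : |w.re| < r / 3 := lt_of_mul_lt_mul_left h2 he'.le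
      have h4 := Complex.norm_le_abs_re_add_abs_im w
      nlinarith
    · exact h.regularPart_differentiableAt hz
  -- Beyond `R` the bound `|Re (e w)| ≥ e.re |w.re| - |w.im|` yields both `|Re (e w)| ≥ e.re |w.re|
  -- / 2` and `|Re (e w)| ≥ X`, so the decay hypothesis applies.
  set R : ℝ := max (2 / e.re) (2 * |X| / e.re) with hR
  have hR1 : 2 ≤ e.re * R := by
    have : 2 / e.re ≤ R := le_max_left _ _
    rwa [div_le_iff₀ he', mul_comm] at this
  have hR2 : 2 * |X| ≤ e.re * R := by
    have : 2 * |X| / e.re ≤ R := le_max_right _ _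
    rwa [div_le_iff₀ he', mul_comm R] at this
  have hR0 : 1 ≤ R := by nlinarith
  obtain ⟨B, hB⟩ : ∃ B, ∀ w ∈ (Set.Icc (-R) R ×ℂ Set.Icc (-(δ / 2)) (δ / 2)),
      ‖regularPart F a b c (e * w)‖ ≤ B := by
    refine IsCompact.exists_bound_of_continuousOn (isCompact_Icc.reProdIm isCompact_Icc) ?_
    intro w hw
    have h2 : |w.im| ≤ δ / 2 := abs_le.mpr hw.2
    exact (hdiff w (by linarith)).continuousAt.continuousWithinAt
  set D : ℝ := C * (2 / (e.re / 2) ^ 2) + ‖a‖ + ‖b‖ with hD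
  have hD0 : 0 ≤ D := by positivity
  have hlarge : ∀ w : ℂ, |w.im| < δ → R ≤ |w.re| →
      ‖regularPart F a b c (e * w)‖ ≤ D / w.re ^ 2 := fun w hw hwR => by
    have hx0 : 1 ≤ |w.re| := hR0.trans hwR
    have hw0 : w ≠ 0 := fun h0 => by rw [h0] at hx0; norm_num at hx0
    have he0 : e ≠ 0 := fun h0 => by rw [h0] at he; norm_num at he
    rw [regularPart_of_ne (mul_ne_zero he0 hw0)]
    have hx2 : 0 < w.re ^ 2 := by rw [← sq_abs]; positivity
    have h1 : e.re / 2 * |w.re| ≤ |(e * w).re| := by nlinarith [hre w]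
    have h2 : X ≤ |(e * w).re| := by nlinarith [le_abs_self X]
    have h3 : ‖F (e * w)‖ ≤ C * (2 / (e.re / 2) ^ 2) / w.re ^ 2 := by
      refine (hC _ h2).trans ?_
      rw [mul_div_assoc]
      refine mul_le_mul_of_nonneg_left ?_ hC0
      have h4 : Real.exp (-|(e * w).re|) ≤ Real.exp (-(e.re / 2 * |w.re|)) :=
        Real.exp_le_exp.mpr (by linarith)
      refine h4.trans ?_
      have h5 := Real.quadratic_le_exp_of_nonneg (x := e.re / 2 * |w.re|) (by positivity)
      rw [Real.exp_neg, div_div, inv_le_comm₀ (Real.exp_pos _) (by positivity), inv_div]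
      have h6 : (e.re / 2) ^ 2 * w.re ^ 2 = (e.re / 2 * |w.re|) ^ 2 := by
        rw [mul_pow, sq_abs]
      rw [h6]
      have : 0 ≤ e.re / 2 * |w.re| := by positivity
      linarith
    have hnw : w.re ^ 2 ≤ ‖w‖ ^ 2 := by
      rw [← sq_abs]; exact pow_le_pow_left₀ (abs_nonneg _) (Complex.abs_re_le_norm w) 2
    have hnw1 : 1 ≤ ‖w‖ ^ 2 := by
      have := hx0.trans (Complex.abs_re_le_norm w)
      exact one_le_pow₀ this
    have h7 : ‖a / (e * w) ^ 4‖ ≤ ‖a‖ / w.re ^ 2 := by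
      rw [norm_div, norm_pow, hnorm]
      refine div_le_div_of_nonneg_left (norm_nonneg _) hx2 ?_
      nlinarith
    have h8 : ‖b / (e * w) ^ 2‖ ≤ ‖b‖ / w.re ^ 2 := by
      rw [norm_div, norm_pow, hnorm]
      exact div_le_div_of_nonneg_left (norm_nonneg _) hx2 hnw
    rw [hD, add_div, add_div]
    exact (norm_sub_le _ _).trans (add_le_add ((norm_sub_le _ _).trans (add_le_add h3 h7)) h8)
  refine ⟨δ / 2, by positivity, max (B * (1 + R ^ 2)) (2 * D), ?_, fun w hw => ?_⟩
  · intro w hw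
    have : |w.im| < δ / 2 := hw
    exact (hdiff w (by linarith)).differentiableWithinAt
  · rw [le_div_iff₀ (by positivity)]
    by_cases hwR : R ≤ |w.re|
    · refine le_max_of_le_right ?_
      have h1 := hlarge w (by linarith) hwR
      have hx1 : 1 ≤ w.re ^ 2 := by
        rw [← sq_abs]; exact one_le_pow₀ (hR0.trans hwR)
      rw [le_div_iff₀ (by linarith)] at h1
      nlinarith [norm_nonneg (regularPart F a b c (e * w))]
    · refine le_max_of_le_left ?_
      push Not at hwR
      have hB0 : 0 ≤ B := (norm_nonneg _).trans
        (hB 0 ⟨by simp; linarith, by simp; linarith⟩)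
      refine mul_le_mul (hB w ⟨abs_le.mp hwR.le, abs_le.mp hw.le⟩) ?_ (by positivity) hB0
      have : w.re ^ 2 ≤ R ^ 2 := by
        rw [← sq_abs]; exact pow_le_pow_left₀ (abs_nonneg _) hwR.le 2
      linarith

/-- The polar part is summed exactly by `ζ(4) = π⁴/90` and `ζ(2) = π²/6`. Poisson summation on the
ray handles the regular part, whose value at `0` is `c`; the missing `n = 0` term, shared by the two
half-sums, gives `-c/2`. -/
lemma hasThermalExpansion (h : IsThermalTerm F a b c) :
    HasThermalExpansion (fun z => ∑' n : ℕ, F (((n : ℂ) + 1) * z))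
      (a * (Real.pi : ℂ) ^ 4 / 90) (b * (Real.pi : ℂ) ^ 2 / 6) (-c / 2) := by
  intro θ hθ
  set e : ℂ := Complex.exp (θ * Complex.I) with he
  have hnorm : ‖e‖ = 1 := Complex.norm_exp_ofReal_mul_I θ
  have hre : 0 < e.re := by rw [he, Complex.exp_ofReal_mul_I_re]; exact Real.cos_pos_of_mem_Ioo hθ
  have he0 : e ≠ 0 := Complex.exp_ne_zero _
  have hS := h.stripDecay hnorm hre
  obtain ⟨C, hC⟩ := hS.tsum_even fun x => by rw [mul_neg, h.regularPart_even]
  -- On the ray `z = e t` with `t = ‖z‖`, hence `C / t = C e / z`.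
  refine ⟨C * e, fun N => ?_⟩
  have htend : Tendsto (fun z : ℂ => ‖z‖) (𝓝[sector {θ}] 0) (𝓝[>] 0) := by
    refine tendsto_nhdsWithin_iff.mpr ⟨?_, ?_⟩
    · have := (continuous_norm (E := ℂ)).tendsto 0
      rw [norm_zero] at this
      exact this.mono_left nhdsWithin_le_nhds
    · filter_upwards [self_mem_nhdsWithin] with z hz
      exact norm_pos_iff.mpr hz.1
  have h1 := (hC N).comp_tendsto htend
  have h2 : ((fun t : ℝ => t ^ N) ∘ fun z : ℂ => ‖z‖) =O[𝓝[sector {θ}] 0] fun z : ℂ => z ^ N :=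
    IsBigO.of_norm_right (by simpa [Function.comp_def] using isBigO_refl _ _)
  refine (h1.trans h2).congr' ?_ EventuallyEq.rfl
  filter_upwards [self_mem_nhdsWithin] with z hz
  have hz0 : z ≠ 0 := hz.1
  have hze : z = e * (‖z‖ : ℂ) := by
    have h3 : z.arg = θ := hz.2
    rw [he, ← h3, mul_comm, Complex.norm_mul_exp_arg_mul_I]
  have ht : 0 < ‖z‖ := norm_pos_iff.mpr hz0
  have harg : ∀ n : ℕ, e * (((((n : ℝ) + 1) * ‖z‖ : ℝ)) : ℂ) = ((n : ℂ) + 1) * z := fun n => by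
    conv_rhs => rw [hze]
    push_cast
    ring
  have hn0 : ∀ n : ℕ, (n : ℂ) + 1 ≠ 0 := fun n => by exact_mod_cast Nat.succ_ne_zero n
  have hsumH : Summable fun n : ℕ => regularPart F a b c (((n : ℂ) + 1) * z) := by
    have h3 := hS.summable_comp_mul ht
    have h4 := h3.comp_injective (i := fun n : ℕ => (n : ℤ) + 1) fun x y hxy => by simpa using hxy
    refine h4.congr fun n => ?_
    simp only [Function.comp]
    rw [← harg]
    congr 2
    push_cast
    ring
  have hz4 : HasSum (fun n : ℕ => 1 / ((n : ℂ) + 1) ^ 4) ((Real.pi : ℂ) ^ 4 / 90) := by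
    have h3 := (hasSum_nat_add_iff' 1).mpr hasSum_zeta_four
    have h4 := Complex.hasSum_ofReal.mpr h3
    convert h4 using 1
    · funext n; push_cast; ring
    · simp
  have hz2 : HasSum (fun n : ℕ => 1 / ((n : ℂ) + 1) ^ 2) ((Real.pi : ℂ) ^ 2 / 6) := by
    have h3 := (hasSum_nat_add_iff' 1).mpr hasSum_zeta_two
    have h4 := Complex.hasSum_ofReal.mpr h3
    convert h4 using 1
    · funext n; push_cast; ring
    · simp
  have hF : HasSum (fun n : ℕ => F (((n : ℂ) + 1) * z))
      (∑' n : ℕ, regularPart F a b c (((n : ℂ) + 1) * z)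
        + a / z ^ 4 * ((Real.pi : ℂ) ^ 4 / 90) + b / z ^ 2 * ((Real.pi : ℂ) ^ 2 / 6)) := by
    refine ((hsumH.hasSum.add (hz4.mul_left (a / z ^ 4))).add
      (hz2.mul_left (b / z ^ 2))).congr_fun ?_
    intro n
    rw [regularPart_of_ne (mul_ne_zero (hn0 n) hz0)]
    have := hn0 n
    field_simp
    ring
  simp only [Function.comp, harg]
  rw [hF.tsum_eq, mul_zero, regularPart_zero]
  have hCe : C * e / z = C / (‖z‖ : ℂ) := by
    conv_lhs => rw [hze]
    have : (‖z‖ : ℂ) ≠ 0 := by exact_mod_cast ht.ne'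
    field_simp
  rw [hCe]
  ring

end IsThermalTerm

/-! ### Quotients of hyperbolic polynomials -/

/-- The thermal denominators vanish to order six at `0`, so the constant term of a quotient needs
numerators through `z⁶`. -/
lemma cosh_jet (l : ℂ) : (fun z : ℂ => Complex.cosh (l * z)
    - (1 + l ^ 2 / 2 * z ^ 2 + l ^ 4 / 24 * z ^ 4 + l ^ 6 / 720 * z ^ 6))
      =O[𝓝 0] fun z : ℂ => z ^ 8 := by
  have h := Complex.exp_sub_sum_range_isBigO_pow 8
  have ht : ∀ m : ℂ, Tendsto (fun z : ℂ => m * z) (𝓝 0) (𝓝 0) := fun m => by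
    have : Continuous fun z : ℂ => m * z := by fun_prop
    simpa using this.tendsto 0
  have hO : ∀ m : ℂ, (fun z : ℂ => (m * z) ^ 8) =O[𝓝 0] fun z : ℂ => z ^ 8 := fun m => by
    simp only [mul_pow]
    exact isBigO_const_mul_self _ _ _
  have h1 := (h.comp_tendsto (ht l)).trans (hO l)
  have h2 := (h.comp_tendsto (ht (-l))).trans (hO (-l))
  refine ((h1.add h2).const_mul_left (1 / 2)).congr_left fun z => ?_
  simp only [Function.comp, Complex.cosh, Finset.sum_range_succ, Finset.sum_range_zero,
    Nat.factorial]
  push_cast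
  rw [neg_mul]
  ring

lemma norm_cosh_le {z : ℂ} (hz : 0 ≤ z.re) : ‖Complex.cosh z‖ ≤ Real.exp z.re := by
  rw [Complex.cosh, norm_div, Complex.norm_ofNat, div_le_iff₀ two_pos]
  refine (norm_add_le _ _).trans ?_
  rw [Complex.norm_exp, Complex.norm_exp, Complex.neg_re]
  have : Real.exp (-z.re) ≤ Real.exp z.re := Real.exp_le_exp.mpr (by linarith)
  linarith

lemma norm_cosh_mul_le {z : ℂ} (hz : 0 ≤ z.re) (l : ℝ) :
    ‖Complex.cosh (l * z)‖ ≤ Real.exp (|l| * z.re) := by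
  rcases le_total 0 l with hl | hl
  · have := norm_cosh_le (z := l * z) (by rw [Complex.re_ofReal_mul]; positivity)
    rw [abs_of_nonneg hl]
    rwa [Complex.re_ofReal_mul] at this
  · have := norm_cosh_le (z := -(l * z))
      (by rw [Complex.neg_re, Complex.re_ofReal_mul]; nlinarith)
    rw [abs_of_nonpos hl]
    rwa [Complex.cosh_neg, Complex.neg_re, Complex.re_ofReal_mul, ← neg_mul] at this

lemma le_norm_cosh (z : ℂ) : (Real.exp z.re - Real.exp (-z.re)) / 2 ≤ ‖Complex.cosh z‖ := by
  rw [Complex.cosh, norm_div, Complex.norm_ofNat]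
  have := norm_sub_norm_le (Complex.exp z) (-Complex.exp (-z))
  rw [norm_neg, sub_neg_eq_add, Complex.norm_exp, Complex.norm_exp, Complex.neg_re] at this
  linarith

/-- A linear combination of hyperbolic cosines. -/
def coshSum {n : ℕ} (k : Fin n → ℂ) (l : Fin n → ℝ) (z : ℂ) : ℂ :=
  ∑ i, k i * Complex.cosh (l i * z)

lemma coshSum_neg {n : ℕ} (k : Fin n → ℂ) (l : Fin n → ℝ) (z : ℂ) :
    coshSum k l (-z) = coshSum k l z := by
  simp only [coshSum, mul_neg, Complex.cosh_neg]

lemma differentiable_coshSum {n : ℕ} (k : Fin n → ℂ) (l : Fin n → ℝ) :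
    Differentiable ℂ (coshSum k l) := by
  unfold coshSum
  fun_prop

lemma norm_coshSum_le {n : ℕ} (k : Fin n → ℂ) {l : Fin n → ℝ} (hl : ∀ i, |l i| ≤ 2) {z : ℂ}
    (hz : 0 ≤ z.re) : ‖coshSum k l z‖ ≤ (∑ i, ‖k i‖) * Real.exp (2 * z.re) := by
  rw [Finset.sum_mul]
  refine norm_sum_le_of_le _ fun i _ => ?_
  rw [norm_mul]
  refine mul_le_mul_of_nonneg_left ((norm_cosh_mul_le hz _).trans ?_) (norm_nonneg _)
  exact Real.exp_le_exp.mpr (mul_le_mul_of_nonneg_right (hl i) hz)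

lemma coshSum_jet {n : ℕ} (k : Fin n → ℂ) (l : Fin n → ℝ) :
    (fun z : ℂ => coshSum k l z - (∑ i, k i + (∑ i, k i * l i ^ 2) / 2 * z ^ 2
      + (∑ i, k i * l i ^ 4) / 24 * z ^ 4 + (∑ i, k i * l i ^ 6) / 720 * z ^ 6))
      =O[𝓝 0] fun z : ℂ => z ^ 8 := by
  have h : (fun z : ℂ => ∑ i, k i * (Complex.cosh (l i * z)
      - (1 + (l i : ℂ) ^ 2 / 2 * z ^ 2 + (l i : ℂ) ^ 4 / 24 * z ^ 4 + (l i : ℂ) ^ 6 / 720 * z ^ 6)))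
      =O[𝓝 0] fun z : ℂ => z ^ 8 :=
    IsBigO.fun_sum fun i _ => (cosh_jet (l i)).const_mul_left (k i)
  refine h.congr_left fun z => ?_
  simp only [coshSum, Finset.sum_div, Finset.sum_mul, ← Finset.sum_add_distrib,
    ← Finset.sum_sub_distrib]
  exact Finset.sum_congr rfl fun i _ => by ring

/-- The cube root of `ceuDen`. -/
def ceuBase (S w z : ℂ) : ℂ := 1 - S - Complex.cosh z + S * Complex.cosh (w * z)

lemma ceuBase_neg (S w z : ℂ) : ceuBase S w (-z) = ceuBase S w z := by
  simp only [ceuBase, mul_neg, Complex.cosh_neg]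

lemma differentiable_ceuBase (S w : ℂ) : Differentiable ℂ (ceuBase S w) := by
  unfold ceuBase
  fun_prop

lemma ceuBase_jet (S w : ℂ) :
    (fun z : ℂ => ceuBase S w z + z ^ 2 * ((1 - S * w ^ 2) / 2 + (1 - S * w ^ 4) / 24 * z ^ 2
      + (1 - S * w ^ 6) / 720 * z ^ 4)) =O[𝓝 0] fun z : ℂ => z ^ 8 := by
  refine (((cosh_jet w).const_mul_left S).sub (cosh_jet 1)).congr_left fun z => ?_
  simp only [ceuBase, one_mul]
  ring

/-- A zero of `cosh z - 1 = S (cosh (wz) - 1)` with `0 ≤ S ≤ 1` and `0 < w < 1` is imaginary. -/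
lemma ceuBase_ne_zero {S w : ℝ} (hS : 0 ≤ S) (hS1 : S ≤ 1) (hw : 0 < w) (hw1 : w < 1) {z : ℂ}
    (hz : 0 < z.re) : ceuBase S w z ≠ 0 := by
  intro h0
  set y : ℂ := z / 2 with hy
  have ha : 0 < y.re := by rw [hy, Complex.div_ofNat_re]; positivity
  set σ : ℝ := Real.sqrt S with hσ
  have hσ2 : σ ^ 2 = S := Real.sq_sqrt hS
  have hσ2' : (σ : ℂ) ^ 2 = S := by exact_mod_cast hσ2
  have hzy : z = 2 * y := by rw [hy]; ring
  -- Half-angle formulas turn the equation into `sinh y = ± √S sinh (w y)` with `y = z / 2`.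
  have hsq : Complex.sinh y ^ 2 = (σ * Complex.sinh (w * y)) ^ 2 := by
    have h1 : ceuBase S w z = -2 * Complex.sinh y ^ 2 + 2 * S * Complex.sinh (w * y) ^ 2 := by
      have e1 : (w : ℂ) * z = 2 * (w * y) := by rw [hzy]; ring
      rw [ceuBase, e1, hzy, Complex.cosh_two_mul, Complex.cosh_two_mul, Complex.cosh_sq,
        Complex.cosh_sq]
      ring
    rw [h1] at h0
    rw [mul_pow, hσ2']
    linear_combination -(1 / 2) * h0
  have key : ∃ ε : ℝ, ε ^ 2 = S ∧ Complex.sinh y = ε * Complex.sinh (w * y) := by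
    rcases sq_eq_sq_iff_eq_or_eq_neg.mp hsq with h | h
    · exact ⟨σ, hσ2, h⟩
    · exact ⟨-σ, by rw [neg_sq, hσ2], by rw [h]; push_cast; ring⟩
  obtain ⟨ε, hε, hsinh⟩ := key
  have hreim : ∀ u : ℂ, (Complex.sinh u).re = Real.sinh u.re * Real.cos u.im ∧
      (Complex.sinh u).im = Real.cosh u.re * Real.sin u.im := fun u => by
    have h1 : Complex.sinh u = Complex.sinh (u.re + u.im * Complex.I) := by
      rw [Complex.re_add_im]
    rw [h1, Complex.sinh_add, Complex.cosh_mul_I, Complex.sinh_mul_I]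
    constructor <;> simp [Complex.sinh_ofReal_re, Complex.cosh_ofReal_re, Complex.cos_ofReal_re,
      Complex.sin_ofReal_re]
  have hre := congrArg Complex.re hsinh
  have him := congrArg Complex.im hsinh
  rw [Complex.re_ofReal_mul, (hreim _).1, (hreim _).1, Complex.re_ofReal_mul,
    Complex.im_ofReal_mul] at hre
  rw [Complex.im_ofReal_mul, (hreim _).2, (hreim _).2, Complex.re_ofReal_mul,
    Complex.im_ofReal_mul] at him
  have hwa : w * y.re < y.re := by nlinarith
  have hwa0 : 0 < w * y.re := by positivity
  have hs : Real.sinh (w * y.re) < Real.sinh y.re := Real.sinh_lt_sinh.mpr hwa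
  have hs0 : 0 < Real.sinh (w * y.re) := Real.sinh_pos_iff.mpr hwa0
  have hc : Real.cosh (w * y.re) < Real.cosh y.re :=
    Real.cosh_lt_cosh.mpr (by rw [abs_of_pos hwa0, abs_of_pos ha]; exact hwa)
  have hc0 : 0 < Real.cosh (w * y.re) := Real.cosh_pos _
  set s := Real.sinh y.re
  set s' := Real.sinh (w * y.re)
  set k := Real.cosh y.re
  set k' := Real.cosh (w * y.re)
  -- Both `sinh` and `cosh` are strictly larger at `Re y` than at `w Re y`. The real and imaginary
  -- parts then give `cos² ≤ cos²` and `sin² ≤ sin²` between the two arguments. Both pairs sum to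
  -- `1`, so equality holds in each, which forces `cos = sin = 0`: a contradiction.
  have h1 : s ^ 2 * Real.cos y.im ^ 2 ≤ s' ^ 2 * Real.cos (w * y.im) ^ 2 := by
    have : s ^ 2 * Real.cos y.im ^ 2 = S * (s' ^ 2 * Real.cos (w * y.im) ^ 2) := by
      rw [← hε, ← mul_pow, hre]; ring
    rw [this]
    exact mul_le_of_le_one_left (by positivity) hS1
  have h2 : k ^ 2 * Real.sin y.im ^ 2 ≤ k' ^ 2 * Real.sin (w * y.im) ^ 2 := by
    have : k ^ 2 * Real.sin y.im ^ 2 = S * (k' ^ 2 * Real.sin (w * y.im) ^ 2) := by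
      rw [← hε, ← mul_pow, him]; ring
    rw [this]
    exact mul_le_of_le_one_left (by positivity) hS1
  have hs2 : s' ^ 2 < s ^ 2 := pow_lt_pow_left₀ hs hs0.le two_ne_zero
  have hk2 : k' ^ 2 < k ^ 2 := pow_lt_pow_left₀ hc hc0.le two_ne_zero
  have hS2 : 0 < s' ^ 2 := by positivity
  have hK2 : 0 < k' ^ 2 := by positivity
  have t1 := Real.sin_sq_add_cos_sq y.im
  have t2 := Real.sin_sq_add_cos_sq (w * y.im)
  set A := Real.cos y.im ^ 2
  set B := Real.sin y.im ^ 2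
  set A' := Real.cos (w * y.im) ^ 2
  set B' := Real.sin (w * y.im) ^ 2
  have hA : 0 ≤ A := sq_nonneg _
  have hB : 0 ≤ B := sq_nonneg _
  have hAA : A ≤ A' := by
    have : s' ^ 2 * A ≤ s' ^ 2 * A' := (mul_le_mul_of_nonneg_right hs2.le hA).trans h1
    exact le_of_mul_le_mul_left this hS2
  have hBB : B ≤ B' := by
    have : k' ^ 2 * B ≤ k' ^ 2 * B' := (mul_le_mul_of_nonneg_right hk2.le hB).trans h2
    exact le_of_mul_le_mul_left this hK2
  have hAe : A = A' := by linarith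
  have hBe : B = B' := by linarith
  rw [← hAe] at h1
  rw [← hBe] at h2
  have hA0 : A = 0 := by nlinarith
  have hB0 : B = 0 := by nlinarith
  linarith

/-- Since `w < 1`, the term `cosh z` eventually dominates the constant and `cosh (w z)`. -/
lemma exists_le_norm_ceuBase {S w : ℝ} (hS : 0 ≤ S) (hS1 : S ≤ 1) (hw : 0 < w) (hw1 : w < 1) :
    ∃ X : ℝ, 0 ≤ X ∧ ∀ z : ℂ, X ≤ z.re → Real.exp z.re / 4 ≤ ‖ceuBase S w z‖ := by
  have h1 : Tendsto (fun x : ℝ => Real.exp (-x) / 2 + 1 + Real.exp (w * x) - Real.exp x / 4)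
      atTop atBot := by
    have hlim : Tendsto (fun x : ℝ => Real.exp (-x) * (Real.exp (-x) / 2) + Real.exp (-x)
        + Real.exp (-((1 - w) * x)) - 1 / 4) atTop (𝓝 (0 * (0 / 2) + 0 + 0 - 1 / 4)) := by
      have e0 : Tendsto (fun x : ℝ => Real.exp (-x)) atTop (𝓝 0) :=
        Real.tendsto_exp_neg_atTop_nhds_zero
      have e1 : Tendsto (fun x : ℝ => Real.exp (-((1 - w) * x))) atTop (𝓝 0) :=
        e0.comp (tendsto_id.const_mul_atTop (by linarith : 0 < 1 - w))
      exact (((e0.mul (e0.div_const 2)).add e0).add e1).sub_const _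
    have := Real.tendsto_exp_atTop.atTop_mul_neg (by norm_num) hlim
    refine this.congr fun x => ?_
    have a1 : Real.exp x * Real.exp (-x) = 1 := by rw [← Real.exp_add]; simp
    have a2 : Real.exp x * Real.exp (-((1 - w) * x)) = Real.exp (w * x) := by
      rw [← Real.exp_add]; congr 1; ring
    linear_combination (Real.exp (-x) / 2 + 1) * a1 + a2
  obtain ⟨X, hX⟩ := eventually_atTop.mp (h1.eventually_le_atBot 0)
  refine ⟨max X 0, le_max_right _ _, fun z hz => ?_⟩
  have hz0 : 0 ≤ z.re := (le_max_right _ _).trans hz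
  have h2 := hX z.re ((le_max_left _ _).trans hz)
  have h3 := le_norm_cosh z
  have h4 := norm_cosh_mul_le hz0 w
  rw [abs_of_pos hw] at h4
  have h5 : ‖Complex.cosh z‖ ≤ ‖ceuBase S w z‖ + 1 + ‖Complex.cosh (w * z)‖ := by
    have e : Complex.cosh z = -ceuBase S w z + ((1 - S : ℝ) : ℂ) + S * Complex.cosh (w * z) := by
      rw [ceuBase]; push_cast; ring
    conv_lhs => rw [e]
    refine (norm_add_le _ _).trans (add_le_add ((norm_add_le _ _).trans (add_le_add
      (norm_neg _).le ?_)) ?_)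
    · rw [Complex.norm_real, Real.norm_of_nonneg (by linarith)]; linarith
    · rw [norm_mul, Complex.norm_real, Real.norm_of_nonneg hS]
      exact mul_le_of_le_one_left (norm_nonneg _) hS1
  linarith

/-- The hypotheses `h0` to `h3` say that the numerator agrees through `z⁶` with `(a/z⁴ + b/z² + c)`
times the denominator, which starts as `-z⁶ ((1 - S w²)/2)³`. They are triangular in `a`, `b`, `c`,
so the polar part is read off from even moments of the frequencies. -/
lemma isThermalTerm_coshSum_div_ceuDen {S w : ℝ} (hS : 0 ≤ S) (hS1 : S ≤ 1) (hw : 0 < w)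
    (hw1 : w < 1) {n : ℕ} {k : Fin n → ℂ} {l : Fin n → ℝ} (hl : ∀ i, |l i| ≤ 2) {a b c : ℂ}
    (h0 : ∑ i, k i = 0)
    (h1 : (∑ i, k i * (l i : ℂ) ^ 2) / 2 = -(a * ((1 - S * w ^ 2) / 2) ^ 3))
    (h2 : (∑ i, k i * (l i : ℂ) ^ 4) / 24 = -(b * ((1 - S * w ^ 2) / 2) ^ 3
      + 3 * a * ((1 - S * w ^ 2) / 2) ^ 2 * ((1 - S * w ^ 4) / 24)))
    (h3 : (∑ i, k i * (l i : ℂ) ^ 6) / 720 = -(c * ((1 - S * w ^ 2) / 2) ^ 3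
      + 3 * b * ((1 - S * w ^ 2) / 2) ^ 2 * ((1 - S * w ^ 4) / 24)
      + 3 * a * (((1 - S * w ^ 2) / 2) ^ 2 * ((1 - S * w ^ 6) / 720)
        + (1 - S * w ^ 2) / 2 * ((1 - S * w ^ 4) / 24) ^ 2))) :
    IsThermalTerm (fun z => coshSum k l z / ceuDen S w z) a b c := by
  have hden : ∀ z, ceuDen S w z = ceuBase S w z ^ 3 := fun z => rfl
  simp only [hden]
  set δ₀ : ℂ := (1 - S * w ^ 2) / 2 with hδ₀
  set δ₁ : ℂ := (1 - S * w ^ 4) / 24 with hδ₁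
  set δ₂ : ℂ := (1 - S * w ^ 6) / 720 with hδ₂
  have hδ : δ₀ ≠ 0 := by
    have : (1 - S * w ^ 2) / 2 ≠ 0 := by
      have hw2 : w ^ 2 < 1 := by nlinarith
      have : S * w ^ 2 < 1 := by nlinarith [sq_nonneg w]
      exact (by linarith : 0 < (1 - S * w ^ 2) / 2).ne'
    rw [hδ₀]
    exact_mod_cast this
  have hbase := ceuBase_jet S w
  rw [← hδ₀, ← hδ₁, ← hδ₂] at hbase
  have hlim : Tendsto (fun z : ℂ => ceuBase S w z / z ^ 2) (𝓝[≠] 0) (𝓝 (-δ₀)) := by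
    have t1 : Tendsto (fun z : ℂ => (ceuBase S w z + z ^ 2 * (δ₀ + δ₁ * z ^ 2 + δ₂ * z ^ 4))
        / z ^ 2) (𝓝[≠] 0) (𝓝 0) := by
      have : (fun z : ℂ => ceuBase S w z + z ^ 2 * (δ₀ + δ₁ * z ^ 2 + δ₂ * z ^ 4))
          =o[𝓝[≠] 0] fun z : ℂ => z ^ 2 :=
        (hbase.trans_isLittleO (isLittleO_pow_pow (by norm_num))).mono nhdsWithin_le_nhds
      exact this.tendsto_div_nhds_zero
    have t2 : Tendsto (fun z : ℂ => δ₀ + δ₁ * z ^ 2 + δ₂ * z ^ 4) (𝓝[≠] 0) (𝓝 δ₀) := by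
      have : Continuous fun z : ℂ => δ₀ + δ₁ * z ^ 2 + δ₂ * z ^ 4 := by fun_prop
      simpa using (this.tendsto 0).mono_left (nhdsWithin_le_nhds (s := {0}ᶜ))
    have t3 := t1.sub t2
    rw [zero_sub] at t3
    refine t3.congr' ?_
    filter_upwards [self_mem_nhdsWithin] with z hz
    have : z ≠ 0 := hz
    field_simp
    ring
  have hnz : ∀ᶠ z in 𝓝[≠] (0 : ℂ), ceuBase S w z ≠ 0 := by
    filter_upwards [hlim.eventually_ne (neg_ne_zero.mpr hδ)] with z hz h
    rw [h, zero_div] at hz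
    exact hz rfl
  have hdiff : ∀ z, ceuBase S w z ≠ 0 →
      DifferentiableAt ℂ (fun z => coshSum k l z / ceuBase S w z ^ 3) z := fun z hz =>
    ((differentiable_coshSum k l) z).div (((differentiable_ceuBase S w) z).pow 3)
      (pow_ne_zero 3 hz)
  refine ⟨fun z => ?_, fun z hz => hdiff z (ceuBase_ne_zero hS hS1 hw hw1 hz),
    hnz.mono hdiff, ?_, ?_⟩
  · rw [coshSum_neg, ceuBase_neg]
  · set p : ℂ → ℂ := fun z => δ₀ + δ₁ * z ^ 2 + δ₂ * z ^ 4 with hp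
    have bdd : ∀ f : ℂ → ℂ, Continuous f → f =O[𝓝 0] fun _ => (1 : ℂ) := fun f hf =>
      (hf.tendsto 0).isBigO_one ℂ
    have hbase2 : ceuBase S w =O[𝓝 0] fun z : ℂ => z ^ 2 := by
      have e1 : (fun z : ℂ => z ^ 2 * p z) =O[𝓝 0] fun z : ℂ => z ^ 2 := by
        simpa using (isBigO_refl (fun z : ℂ => z ^ 2) (𝓝 0)).mul
          (bdd p (by simp only [hp]; fun_prop))
      have e2 : (fun z : ℂ => z ^ 8) =O[𝓝 0] fun z : ℂ => z ^ 2 :=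
        (isLittleO_pow_pow (by norm_num)).isBigO
      refine ((hbase.trans e2).sub e1).congr_left fun z => ?_
      simp only [hp]
      ring
    have hcube : (fun z : ℂ => ceuBase S w z ^ 3 + z ^ 6 * p z ^ 3) =O[𝓝 0]
        fun z : ℂ => z ^ 12 := by
      have e1 : (fun z : ℂ => z ^ 2 * p z) =O[𝓝 0] fun z : ℂ => z ^ 2 := by
        simpa using (isBigO_refl (fun z : ℂ => z ^ 2) (𝓝 0)).mul
          (bdd p (by simp only [hp]; fun_prop))
      have e2 := ((hbase2.mul hbase2).sub (hbase2.mul e1)).add (e1.mul e1)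
      refine (hbase.mul e2).congr (fun z => ?_) (fun z => ?_)
      · simp only [hp]; ring
      · ring
    have hnum := coshSum_jet k l
    rw [h0, h1, h2, h3] at hnum
    have htot : (fun z : ℂ => coshSum k l z * z ^ 4 - (a + b * z ^ 2 + c * z ^ 4)
        * ceuBase S w z ^ 3) =O[𝓝 0] fun z : ℂ => z ^ 12 := by
      have e1 : (fun z : ℂ => z ^ 4) =O[𝓝 0] fun z : ℂ => z ^ 4 := isBigO_refl _ _
      have e2 := (hnum.mul e1)
      have e3 := (bdd (fun z => a + b * z ^ 2 + c * z ^ 4) (by fun_prop)).mul hcube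
      -- `z¹² q(z)` collects everything of order twelve and higher in `z⁶ (a + b z² + c z⁴) p³`; the
      -- lower orders cancel against the numerator by `h1`, `h2`, `h3`.
      set q : ℂ → ℂ := fun z =>
        let x := z ^ 2
        let q₁ := 3 * δ₀ * (2 * δ₁ * δ₂ + δ₂ ^ 2 * x) + (δ₁ + δ₂ * x) ^ 3
        b * (3 * δ₀ ^ 2 * δ₂ + 3 * δ₀ * δ₁ ^ 2) + c * (3 * δ₀ ^ 2 * δ₁)
          + c * (3 * δ₀ ^ 2 * δ₂ + 3 * δ₀ * δ₁ ^ 2) * x + (a + b * x + c * x ^ 2) * q₁ with hq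
      have e4 := (isBigO_refl (fun z : ℂ => z ^ 12) (𝓝 0)).mul
        (bdd q (by simp only [hq]; fun_prop))
      have e2' : (fun z : ℂ => z ^ 8 * z ^ 4) = fun z : ℂ => z ^ 12 := by funext z; ring
      rw [e2'] at e2
      simp only [one_mul] at e3
      simp only [mul_one] at e4
      refine ((e2.sub e3).add e4).congr_left fun z => ?_
      simp only [hp, hq]
      ring
    -- Dividing by `z¹⁰` and multiplying by the inverse of `(base / z²)³` leaves exactly the
    -- quotient minus `a/z⁴ + b/z² + c`.
    have hl0 : Tendsto (fun z : ℂ => (coshSum k l z * z ^ 4 - (a + b * z ^ 2 + c * z ^ 4)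
        * ceuBase S w z ^ 3) / z ^ 10) (𝓝[≠] 0) (𝓝 0) :=
      ((htot.trans_isLittleO (isLittleO_pow_pow (by norm_num))).mono
        nhdsWithin_le_nhds).tendsto_div_nhds_zero
    have hl1 := (hlim.pow 3).inv₀ (pow_ne_zero 3 (neg_ne_zero.mpr hδ))
    have hl2 := (hl0.mul hl1).add_const c
    rw [zero_mul, zero_add] at hl2
    refine hl2.congr' ?_
    filter_upwards [hnz, self_mem_nhdsWithin] with z hz hz'
    have : z ≠ 0 := hz'
    field_simp
    ring
  -- Frequencies at most `2` against a cubed `cosh` leave the rate `e^{2x} / e^{3x}`; the factor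
  -- `64` is `4³`.
  · obtain ⟨X, hX0, hX⟩ := exists_le_norm_ceuBase hS hS1 hw hw1
    refine ⟨(∑ i, ‖k i‖) * 64, X, fun z hz => ?_⟩
    have e1 := norm_coshSum_le k hl (hX0.trans hz)
    have e2 : (Real.exp z.re / 4) ^ 3 ≤ ‖ceuBase S w z‖ ^ 3 :=
      pow_le_pow_left₀ (by positivity) (hX z hz) 3
    rw [norm_div, norm_pow]
    refine (div_le_div₀ (by positivity) e1 (by positivity) e2).trans (le_of_eq ?_)
    rw [div_pow, ← Real.exp_nat_mul, div_div_eq_mul_div, div_eq_iff (Real.exp_ne_zero _),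
      mul_assoc, mul_assoc, mul_assoc, ← Real.exp_add]
    norm_num
    left
    rw [mul_comm]
    congr 2
    ring

/-! ### Distillates in the closed Einstein universe -/

/-- The frequencies in the numerators of the rotating state. -/
def ceuFreq (w : ℝ) : Fin 7 → ℝ := ![0, 1, w, 2, 2 * w, 1 + w, 1 - w]

lemma abs_ceuFreq_le {w : ℝ} (hw : 0 < w) (hw1 : w < 1) (i : Fin 7) : |ceuFreq w i| ≤ 2 := by
  rw [abs_le]
  fin_cases i <;> simp only [ceuFreq, Fin.reduceFinMk, Matrix.cons_val] <;>
    constructor <;> norm_num <;> linarith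

/-- A combination of the hyperbolic functions in the numerators of the rotating state, as a
combination of hyperbolic cosines. -/
def ceuCoeff (k₀ k₁ kw k₂ k₂w kcc kss : ℂ) : Fin 7 → ℂ :=
  ![k₀, k₁, kw, k₂, k₂w, (kcc + kss) / 2, (kcc - kss) / 2]

lemma coshSum_ceuCoeff (w : ℝ) (k₀ k₁ kw k₂ k₂w kcc kss z : ℂ) :
    coshSum (ceuCoeff k₀ k₁ kw k₂ k₂w kcc kss) (ceuFreq w) z
      = k₀ + k₁ * Complex.cosh z + kw * Complex.cosh (w * z) + k₂ * Complex.cosh (2 * z)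
        + k₂w * Complex.cosh (2 * (w * z)) + kcc * (Complex.cosh z * Complex.cosh (w * z))
        + kss * (Complex.sinh z * Complex.sinh (w * z)) := by
  have e1 : ((1 + w : ℝ) : ℂ) * z = z + w * z := by push_cast; ring
  have e2 : ((1 - w : ℝ) : ℂ) * z = z - w * z := by push_cast; ring
  have e3 : ((2 * w : ℝ) : ℂ) * z = 2 * (w * z) := by push_cast; ring
  simp only [coshSum, ceuCoeff, ceuFreq, Fin.sum_univ_seven, Matrix.cons_val, e1, e2, e3,
    Complex.cosh_add, Complex.cosh_sub]
  simp
  ring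

lemma sum_ceuCoeff (k₀ k₁ kw k₂ k₂w kcc kss : ℂ) :
    ∑ i, ceuCoeff k₀ k₁ kw k₂ k₂w kcc kss i = k₀ + k₁ + kw + k₂ + k₂w + kcc := by
  simp only [ceuCoeff, Fin.sum_univ_seven, Matrix.cons_val]
  ring

lemma sum_ceuCoeff_mul_pow (w : ℝ) (k₀ k₁ kw k₂ k₂w kcc kss : ℂ) {j : ℕ} (hj : j ≠ 0) :
    ∑ i, ceuCoeff k₀ k₁ kw k₂ k₂w kcc kss i * (ceuFreq w i : ℂ) ^ j
      = k₁ + kw * w ^ j + k₂ * 2 ^ j + k₂w * (2 * w) ^ j + (kcc + kss) / 2 * (1 + w) ^ j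
        + (kcc - kss) / 2 * (1 - w) ^ j := by
  simp only [ceuCoeff, ceuFreq, Fin.sum_univ_seven, Matrix.cons_val]
  simp [hj]

/-- The product formulas for `cosh z cosh (w z)` and `sinh z sinh (w z)` produce the frequencies `1
± w`. The Taylor conditions thereby become polynomial identities in `S` and `w`, up to powers of `1
- S w²`. -/
lemma HasThermalExpansion.of_ceuCoeff {S w : ℝ} (hS : 0 ≤ S) (hS1 : S ≤ 1) (hw : 0 < w)
    (hw1 : w < 1) {F : ℂ → ℂ} {k₀ k₁ kw k₂ k₂w kcc kss a b c : ℂ}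
    (hF : ∀ z, F z = k₀ + k₁ * Complex.cosh z + kw * Complex.cosh (w * z)
      + k₂ * Complex.cosh (2 * z) + k₂w * Complex.cosh (2 * (w * z))
      + kcc * (Complex.cosh z * Complex.cosh (w * z))
      + kss * (Complex.sinh z * Complex.sinh (w * z)))
    (h0 : k₀ + k₁ + kw + k₂ + k₂w + kcc = 0)
    (h1 : (k₁ + kw * w ^ 2 + k₂ * 2 ^ 2 + k₂w * (2 * w) ^ 2 + (kcc + kss) / 2 * (1 + w) ^ 2
        + (kcc - kss) / 2 * (1 - w) ^ 2) / 2 = -(a * ((1 - S * w ^ 2) / 2) ^ 3))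
    (h2 : (k₁ + kw * w ^ 4 + k₂ * 2 ^ 4 + k₂w * (2 * w) ^ 4 + (kcc + kss) / 2 * (1 + w) ^ 4
        + (kcc - kss) / 2 * (1 - w) ^ 4) / 24 = -(b * ((1 - S * w ^ 2) / 2) ^ 3
      + 3 * a * ((1 - S * w ^ 2) / 2) ^ 2 * ((1 - S * w ^ 4) / 24)))
    (h3 : (k₁ + kw * w ^ 6 + k₂ * 2 ^ 6 + k₂w * (2 * w) ^ 6 + (kcc + kss) / 2 * (1 + w) ^ 6
        + (kcc - kss) / 2 * (1 - w) ^ 6) / 720 = -(c * ((1 - S * w ^ 2) / 2) ^ 3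
      + 3 * b * ((1 - S * w ^ 2) / 2) ^ 2 * ((1 - S * w ^ 4) / 24)
      + 3 * a * (((1 - S * w ^ 2) / 2) ^ 2 * ((1 - S * w ^ 6) / 720)
        + (1 - S * w ^ 2) / 2 * ((1 - S * w ^ 4) / 24) ^ 2))) :
    HasThermalExpansion (ceuSeries F S w) (a * (Real.pi : ℂ) ^ 4 / 90)
      (b * (Real.pi : ℂ) ^ 2 / 6) (-c / 2) := by
  have h := (isThermalTerm_coshSum_div_ceuDen hS hS1 hw hw1
    (k := ceuCoeff k₀ k₁ kw k₂ k₂w kcc kss) (l := ceuFreq w) (a := a) (b := b) (c := c)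
    (abs_ceuFreq_le hw hw1) (by rw [sum_ceuCoeff]; exact h0)
    (by rw [sum_ceuCoeff_mul_pow _ _ _ _ _ _ _ _ two_ne_zero]; exact h1)
    (by rw [sum_ceuCoeff_mul_pow _ _ _ _ _ _ _ _ four_ne_zero]; exact h2)
    (by rw [sum_ceuCoeff_mul_pow _ _ _ _ _ _ _ _ (by norm_num)]; exact h3)).hasThermalExpansion
  refine h.congr fun z _ => ?_
  unfold ceuSeries
  refine tsum_congr fun n => ?_
  rw [hF, coshSum_ceuCoeff]

/-! ### Thermal expansions and distillates of the rotating state of the closed Einstein universe. -/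

section Rotating

variable {S w : ℝ}

lemma one_sub_mul_sq_pos (hS1 : S ≤ 1) (hw : 0 < w) (hw1 : w < 1) : 0 < 1 - S * w ^ 2 := by
  have hw2 : w ^ 2 < 1 := by nlinarith
  nlinarith [sq_nonneg w]

lemma one_sub_mul_sq_ne_zero (hS1 : S ≤ 1) (hw : 0 < w) (hw1 : w < 1) :
    (1 : ℂ) - S * w ^ 2 ≠ 0 := by
  exact_mod_cast (one_sub_mul_sq_pos hS1 hw hw1).ne'

/-- The values `a`, `b`, `c` are obtained by solving the triangular Taylor system; `sinh²` is first
written through `cosh` of the doubled argument. -/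
lemma expansion_ceuNumR (hS : 0 ≤ S) (hS1 : S ≤ 1) (hw : 0 < w) (hw1 : w < 1) :
    HasThermalExpansion (ceuSeries (ceuNumR S w) S w)
      (36 / (1 - S * w ^ 2) * (Real.pi : ℂ) ^ 4 / 90)
      (2 * w ^ 2 * (1 - S) / (1 - S * w ^ 2) ^ 2 * (Real.pi : ℂ) ^ 2 / 6)
      (-((1 / 20 - 1 / 3 * w ^ 2 + 1 / 6 * w ^ 4 + S * (8 / 15 * w ^ 2 - 5 / 6 * w ^ 4
        + 8 / 15 * w ^ 6) + S ^ 2 * (1 / 6 * w ^ 4 - 1 / 3 * w ^ 6 + 1 / 20 * w ^ 8))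
        / (1 - S * w ^ 2) ^ 3) / 2) := by
  have hP := one_sub_mul_sq_ne_zero hS1 hw hw1
  refine HasThermalExpansion.of_ceuCoeff hS hS1 hw hw1 (F := ceuNumR S w)
    (k₀ := 2 * (1 + S ^ 2 * w ^ 2) + (3 + S * w ^ 2) / 2 + S * (1 + 3 * S * w ^ 2) / 2)
    (k₁ := -2 + S + S ^ 2 * w ^ 2) (kw := 1 + S * w ^ 2 - 2 * S ^ 2 * w ^ 2)
    (k₂ := -(3 + S * w ^ 2) / 2) (k₂w := -S * (1 + 3 * S * w ^ 2) / 2)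
    (kcc := -(1 + S + S * w ^ 2 + S ^ 2 * w ^ 2)) (kss := 12 * S * w) (fun z => ?_) ?_ ?_ ?_ ?_
  · rw [ceuNumR, Complex.cosh_two_mul, Complex.cosh_two_mul, Complex.cosh_sq, Complex.cosh_sq]
    ring
  · ring
  · field_simp; ring
  · field_simp; ring
  · field_simp; ring

lemma expansion_ceuNumP (hS : 0 ≤ S) (hS1 : S ≤ 1) (hw : 0 < w) (hw1 : w < 1) :
    HasThermalExpansion (ceuSeries (ceuNumP S w) S w)
      (24 / (1 - S * w ^ 2) * (Real.pi : ℂ) ^ 4 / 90)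
      (4 * w ^ 2 * (1 - S) / (1 - S * w ^ 2) ^ 2 * (Real.pi : ℂ) ^ 2 / 6)
      (-((1 / 30 - 2 / 3 * w ^ 2 + 1 / 3 * w ^ 4 + S * (32 / 15 * w ^ 2 - 11 / 3 * w ^ 4
        + 32 / 15 * w ^ 6) + S ^ 2 * (1 / 3 * w ^ 4 - 2 / 3 * w ^ 6 + 1 / 30 * w ^ 8))
        / (1 - S * w ^ 2) ^ 3) / 2) := by
  have hP := one_sub_mul_sq_ne_zero hS1 hw hw1
  refine HasThermalExpansion.of_ceuCoeff hS hS1 hw hw1 (F := ceuNumP S w)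
    (k₀ := 1 + 7 * S + S * (7 + S) * w ^ 2) (k₁ := -2 * S * (-1 - (-2 + S) * w ^ 2))
    (kw := 2 * (1 + S * (-2 + w ^ 2))) (k₂ := -(1 + 3 * S * w ^ 2))
    (k₂w := -S * (3 + S * w ^ 2)) (kcc := -2 * (1 + S) * (1 + S * w ^ 2)) (kss := 24 * S * w)
    (fun z => ?_) ?_ ?_ ?_ ?_
  · rw [ceuNumP]
    ring
  · ring
  · field_simp; ring
  · field_simp; ring
  · field_simp; ring

/-- This numerator starts only at `z⁶`, so the quotient is regular at `0`: the coefficient of `A A`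
has no `T₀²` part, which forces `d1 = d4 = 0` at second order. -/
lemma expansion_ceuNumA (hS : 0 ≤ S) (hS1 : S ≤ 1) (hw : 0 < w) (hw1 : w < 1) :
    HasThermalExpansion (ceuSeries (ceuNumA w) S w) (0 * (Real.pi : ℂ) ^ 4 / 90)
      (0 * (Real.pi : ℂ) ^ 2 / 6)
      (-(-w ^ 2 * (1 - w ^ 2) ^ 2 / 2 / (1 - S * w ^ 2) ^ 3) / 2) := by
  have hP := one_sub_mul_sq_ne_zero hS1 hw hw1
  refine HasThermalExpansion.of_ceuCoeff hS hS1 hw hw1 (F := ceuNumA w)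
    (k₀ := -(2 * (1 + w ^ 2))) (k₁ := -1 + w ^ 2) (kw := -(-1 + w ^ 2)) (k₂ := w ^ 2)
    (k₂w := 1) (kcc := 1 + w ^ 2) (kss := -6 * w) (fun z => ?_) ?_ ?_ ?_ ?_
  · rw [ceuNumA]
    ring
  · ring
  · field_simp; ring
  · field_simp; ring
  -- With `a = b = 0` the higher Taylor coefficients of the denominator drop out, and `1 - S w²` may
  -- be treated as an opaque unit.
  · generalize (1 : ℂ) - S * w ^ 2 = P at hP ⊢
    field_simp; ring

lemma expansion_ceuNumW (hS : 0 ≤ S) (hS1 : S ≤ 1) (hw : 0 < w) (hw1 : w < 1) :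
    HasThermalExpansion (ceuSeries (ceuNumW S w) S w) (0 * (Real.pi : ℂ) ^ 4 / 90)
      (-2 * w ^ 2 * (1 - S) / (1 - S * w ^ 2) ^ 2 * (Real.pi : ℂ) ^ 2 / 6)
      (-((1 / 3 * w ^ 2 - 1 / 6 * w ^ 4 + S * (-5 / 6 * w ^ 2 + 4 / 3 * w ^ 4 - 5 / 6 * w ^ 6)
        + S ^ 2 * (-1 / 6 * w ^ 4 + 1 / 3 * w ^ 6)) / (1 - S * w ^ 2) ^ 3) / 2) := by
  have hP := one_sub_mul_sq_ne_zero hS1 hw hw1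
  refine HasThermalExpansion.of_ceuCoeff hS hS1 hw hw1 (F := ceuNumW S w)
    (k₀ := 1 - 3 * S + (-3 + S) * S * w ^ 2) (k₁ := -1 - (-2 + S) * S * w ^ 2)
    (kw := -(1 + S * (-2 + S * w ^ 2))) (k₂ := S * w ^ 2)
    (k₂w := S) (kcc := 1 + S ^ 2 * w ^ 2) (kss := -6 * S * w) (fun z => ?_) ?_ ?_ ?_ ?_
  · rw [ceuNumW]
    ring
  · ring
  · field_simp; ring
  · field_simp; ring
  · field_simp; ring

lemma expansion_ceuNumG (hS : 0 ≤ S) (hS1 : S ≤ 1) (hw : 0 < w) (hw1 : w < 1) :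
    HasThermalExpansion (ceuSeries (ceuNumG S w) S w) (0 * (Real.pi : ℂ) ^ 4 / 90)
      (2 * w * (1 - w ^ 2) / (1 - S * w ^ 2) ^ 2 * (Real.pi : ℂ) ^ 2 / 6)
      (-(w * (1 - w ^ 4) / 30 / (1 - S * w ^ 2) ^ 2) / 2) := by
  have hP := one_sub_mul_sq_ne_zero hS1 hw hw1
  refine HasThermalExpansion.of_ceuCoeff hS hS1 hw hw1 (F := ceuNumG S w)
    (k₀ := (1 + S) * w + w + S * w) (k₁ := -((1 - S) * w))
    (kw := (1 - S) * w) (k₂ := -w)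
    (k₂w := -S * w) (kcc := -((1 + S) * w)) (kss := 3 * (1 + S * w ^ 2)) (fun z => ?_) ?_ ?_ ?_ ?_
  · rw [ceuNumG, Complex.cosh_two_mul, Complex.cosh_two_mul, Complex.cosh_sq, Complex.cosh_sq]
    ring
  · ring
  · field_simp; ring
  · field_simp; ring
  · field_simp; ring

variable {T₀ : ℝ}

lemma distilled_ceuRho (hS : 0 ≤ S) (hS1 : S ≤ 1) (hw : 0 < w) (hw1 : w < 1) (hT : 0 < T₀)
    (κ : ℝ) : IsDistilledValue (ceuRho (1 / T₀) S w) ((κ : ℂ) ^ 2)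
      ((Real.pi ^ 2 / (30 * (1 - S * w ^ 2) ^ 2) * T₀ ^ 4
        + κ ^ 2 * w ^ 2 * (1 - S) / (36 * (1 - S * w ^ 2) ^ 3) * T₀ ^ 2
        - κ ^ 4 * (1 / 20 - 1 / 3 * w ^ 2 + 1 / 6 * w ^ 4 + S * (8 / 15 * w ^ 2 - 5 / 6 * w ^ 4
        + 8 / 15 * w ^ 6) + S ^ 2 * (1 / 6 * w ^ 4 - 1 / 3 * w ^ 6 + 1 / 20 * w ^ 8))
        / (24 * Real.pi ^ 2 * (1 - S * w ^ 2) ^ 4) : ℝ) : ℂ) := by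
  have hP := one_sub_mul_sq_ne_zero hS1 hw hw1
  have hπ : (Real.pi : ℂ) ≠ 0 := by exact_mod_cast Real.pi_ne_zero
  have hT' : (T₀ : ℂ) ≠ 0 := by exact_mod_cast hT.ne'
  have h := (expansion_ceuNumR hS hS1 hw hw1).isDistilledValue_four (one_div_pos.mpr hT)
    (1 / (12 * (Real.pi : ℂ) ^ 2 * (1 - S * w ^ 2))) ((κ : ℂ) ^ 2)
  convert h using 1
  · funext k; rw [ceuRho]; ring
  · push_cast; field_simp; ring

lemma distilled_ceuP (hS : 0 ≤ S) (hS1 : S ≤ 1) (hw : 0 < w) (hw1 : w < 1) (hT : 0 < T₀)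
    (κ : ℝ) : IsDistilledValue (ceuP (1 / T₀) S w) ((κ : ℂ) ^ 2)
      ((Real.pi ^ 2 / (90 * (1 - S * w ^ 2) ^ 2) * T₀ ^ 4
        + κ ^ 2 * w ^ 2 * (1 - S) / (36 * (1 - S * w ^ 2) ^ 3) * T₀ ^ 2
        - κ ^ 4 * (1 / 30 - 2 / 3 * w ^ 2 + 1 / 3 * w ^ 4 + S * (32 / 15 * w ^ 2 - 11 / 3 * w ^ 4
        + 32 / 15 * w ^ 6) + S ^ 2 * (1 / 3 * w ^ 4 - 2 / 3 * w ^ 6 + 1 / 30 * w ^ 8))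
        / (48 * Real.pi ^ 2 * (1 - S * w ^ 2) ^ 4) : ℝ) : ℂ) := by
  have hP := one_sub_mul_sq_ne_zero hS1 hw hw1
  have hπ : (Real.pi : ℂ) ≠ 0 := by exact_mod_cast Real.pi_ne_zero
  have hT' : (T₀ : ℂ) ≠ 0 := by exact_mod_cast hT.ne'
  have h := (expansion_ceuNumP hS hS1 hw hw1).isDistilledValue_four (one_div_pos.mpr hT)
    (1 / (24 * (Real.pi : ℂ) ^ 2 * (1 - S * w ^ 2))) ((κ : ℂ) ^ 2)
  convert h using 1
  · funext k; rw [ceuP]; ring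
  · push_cast; field_simp; ring

/-- The strict bound on `S` is needed because the normalization of the coefficients of `A A`, `ω ω`
and `u l` divides by `1 - S`. -/
lemma distilled_ceuA (hS : 0 ≤ S) (hS1 : S < 1) (hw : 0 < w) (hw1 : w < 1) (hT : 0 < T₀)
    (κ : ℝ) : IsDistilledValue (ceuA (1 / T₀) S w) ((κ : ℂ) ^ 2)
      ((κ ^ 2 * (1 - w ^ 2) ^ 2 / (24 * Real.pi ^ 2 * (1 - S) * w ^ 2 * (1 - S * w ^ 2) ^ 2) : ℝ)
        : ℂ) := by
  have hP := one_sub_mul_sq_ne_zero hS1.le hw hw1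
  have hπ : (Real.pi : ℂ) ≠ 0 := by exact_mod_cast Real.pi_ne_zero
  have hT' : (T₀ : ℂ) ≠ 0 := by exact_mod_cast hT.ne'
  have hw' : (w : ℂ) ≠ 0 := by exact_mod_cast hw.ne'
  have hS' : (1 : ℂ) - S ≠ 0 := by exact_mod_cast (sub_pos.mpr hS1).ne'
  have h0 := expansion_ceuNumA hS hS1.le hw hw1
  rw [zero_mul, zero_div] at h0
  have h := h0.isDistilledValue_two (one_div_pos.mpr hT)
    ((1 - S * w ^ 2) / (6 * (Real.pi : ℂ) ^ 2 * (1 - S) * w ^ 4)) ((κ : ℂ) ^ 2)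
  convert h using 1
  · funext k; rw [ceuA]; ring
  · push_cast; field_simp; ring

lemma distilled_ceuW (hS : 0 ≤ S) (hS1 : S < 1) (hw : 0 < w) (hw1 : w < 1) (hT : 0 < T₀)
    (κ : ℝ) : IsDistilledValue (ceuW (1 / T₀) S w) ((κ : ℂ) ^ 2)
      ((-1 / (18 * (1 - S * w ^ 2)) * T₀ ^ 2
        - κ ^ 2 * (1 / 3 * w ^ 2 - 1 / 6 * w ^ 4 + S * (-5 / 6 * w ^ 2 + 4 / 3 * w ^ 4
          - 5 / 6 * w ^ 6) + S ^ 2 * (-1 / 6 * w ^ 4 + 1 / 3 * w ^ 6))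
        / (12 * Real.pi ^ 2 * (1 - S) * w ^ 2 * (1 - S * w ^ 2) ^ 2) : ℝ) : ℂ) := by
  have hP := one_sub_mul_sq_ne_zero hS1.le hw hw1
  have hπ : (Real.pi : ℂ) ≠ 0 := by exact_mod_cast Real.pi_ne_zero
  have hT' : (T₀ : ℂ) ≠ 0 := by exact_mod_cast hT.ne'
  have hw' : (w : ℂ) ≠ 0 := by exact_mod_cast hw.ne'
  have hS' : (1 : ℂ) - S ≠ 0 := by exact_mod_cast (sub_pos.mpr hS1).ne'
  have h0 := expansion_ceuNumW hS hS1.le hw hw1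
  rw [zero_mul, zero_div] at h0
  have h := h0.isDistilledValue_two (one_div_pos.mpr hT)
    ((1 - S * w ^ 2) / (6 * (Real.pi : ℂ) ^ 2 * (1 - S) * w ^ 2)) ((κ : ℂ) ^ 2)
  convert h using 1
  · funext k; rw [ceuW]; ring
  · push_cast; field_simp; ring

lemma distilled_ceuG (hS : 0 ≤ S) (hS1 : S < 1) (hw : 0 < w) (hw1 : w < 1) (hT : 0 < T₀)
    (κ : ℝ) : IsDistilledValue (ceuG (1 / T₀) S w) ((κ : ℂ) ^ 2)
      ((-(1 - w ^ 2) / (18 * (1 - S) * w ^ 2 * (1 - S * w ^ 2)) * T₀ ^ 2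
        + κ ^ 2 * (1 - w ^ 4) / (360 * Real.pi ^ 2 * (1 - S) * w ^ 2 * (1 - S * w ^ 2)) : ℝ)
        : ℂ) := by
  have hP := one_sub_mul_sq_ne_zero hS1.le hw hw1
  have hπ : (Real.pi : ℂ) ≠ 0 := by exact_mod_cast Real.pi_ne_zero
  have hT' : (T₀ : ℂ) ≠ 0 := by exact_mod_cast hT.ne'
  have hw' : (w : ℂ) ≠ 0 := by exact_mod_cast hw.ne'
  have hS' : (1 : ℂ) - S ≠ 0 := by exact_mod_cast (sub_pos.mpr hS1).ne'
  have h0 := expansion_ceuNumG hS hS1.le hw hw1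
  rw [zero_mul, zero_div] at h0
  have h := h0.isDistilledValue_two (one_div_pos.mpr hT)
    (-((1 - S * w ^ 2) / (6 * (Real.pi : ℂ) ^ 2 * (1 - S) * w ^ 3))) ((κ : ℂ) ^ 2)
  convert h using 1
  · funext k; rw [ceuG]; ring
  · push_cast; field_simp; ring

end Rotating

/-- The expansion for the non-rotating state. -/
lemma expansion_static : HasThermalExpansion
    (fun z => ∑' n : ℕ, (2 + Complex.cosh (((n : ℂ) + 1) * z))
      / Complex.sinh (((n : ℂ) + 1) * z / 2) ^ 4)
    (48 * (Real.pi : ℂ) ^ 4 / 90) 0 (-1 / 30) := by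
  -- At `S = 0` the rotating denominator is `(1 - cosh z)³ = -8 sinh⁶(z/2)`, with any `w`; `1 / 2`
  -- is a dummy value. The numerator is the static one multiplied by `-8 sinh²(z/2)`.
  have h := HasThermalExpansion.of_ceuCoeff (S := 0) (w := 1 / 2) le_rfl zero_le_one
    (by norm_num) (by norm_num) (F := fun z => 6 - 4 * Complex.cosh z - 2 * Complex.cosh (2 * z))
    (k₀ := 6) (k₁ := -4) (kw := 0) (k₂ := -2) (k₂w := 0) (kcc := 0) (kss := 0) (a := 48) (b := 0)
    (c := 1 / 15) (fun z => by ring) (by norm_num) (by norm_num) (by norm_num) (by norm_num)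
  norm_num at h
  refine HasThermalExpansion.congr (s := ceuSeries
    (fun z => 6 - 4 * Complex.cosh z - 2 * Complex.cosh (2 * z)) 0 (1 / 2)) ?_ fun z hz => ?_
  · norm_num
    exact h
  · unfold ceuSeries
    refine tsum_congr fun n => ?_
    set y : ℂ := ((n : ℂ) + 1) * z / 2 with hy
    have e1 : ((n : ℂ) + 1) * z = 2 * y := by rw [hy]; ring
    have hre : 0 < ((((n : ℂ) + 1) * z)).re := by
      have : ((n : ℂ) + 1) = ((n + 1 : ℝ) : ℂ) := by push_cast; rfl
      rw [this, Complex.re_ofReal_mul]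
      positivity
    have hs : Complex.sinh y ≠ 0 := fun h0 => by
      have := ceuBase_ne_zero (S := 0) (w := 1 / 2) le_rfl zero_le_one
        (by norm_num) (by norm_num) hre
      refine this ?_
      rw [ceuBase, e1, Complex.cosh_two_mul, Complex.cosh_sq, h0]
      simp
    beta_reduce
    rw [e1, ceuDen, Complex.cosh_two_mul (2 * y), Complex.sinh_sq (2 * y), Complex.cosh_two_mul y,
      Complex.cosh_sq y]
    have hd : (1 - 0 - (Complex.sinh y ^ 2 + 1 + Complex.sinh y ^ 2)
        + 0 * Complex.cosh (1 / 2 * (2 * y))) = -2 * Complex.sinh y ^ 2 := by ring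
    rw [hd]
    field_simp
    ring

lemma distilled_ceuRhoStatic {T₀ : ℝ} (hT : 0 < T₀) (κ : ℝ) :
    IsDistilledValue (ceuRhoStatic (1 / T₀)) ((κ : ℂ) ^ 2)
      ((Real.pi ^ 2 / 30 * T₀ ^ 4 - κ ^ 4 / (480 * Real.pi ^ 2) : ℝ) : ℂ) := by
  have hπ : (Real.pi : ℂ) ≠ 0 := by exact_mod_cast Real.pi_ne_zero
  have hT' : (T₀ : ℂ) ≠ 0 := by exact_mod_cast hT.ne'
  have h := expansion_static.isDistilledValue_four (one_div_pos.mpr hT)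
    (1 / (16 * (Real.pi : ℂ) ^ 2)) ((κ : ℂ) ^ 2)
  convert h using 1
  · funext k; rw [ceuRhoStatic]; ring
  · push_cast; field_simp; ring

/-! ### Distillates in anti-de Sitter and de Sitter space-time -/

lemma natCast_add_one_mul_re (i : ℕ) (z : ℂ) : (((i : ℂ) + 1) * z).re = ((i : ℝ) + 1) * z.re := by
  have : ((i : ℂ) + 1) = ((i + 1 : ℝ) : ℂ) := by push_cast; rfl
  rw [this, Complex.re_ofReal_mul]

lemma norm_exp_neg_lt_one {z : ℂ} (hz : 0 < z.re) : ‖Complex.exp (-z)‖ < 1 := by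
  rw [Complex.norm_exp, Complex.neg_re, Real.exp_lt_one_iff]
  linarith

lemma summable_add_one_pow_mul_geometric (k : ℕ) {r : ℝ} (h0 : 0 ≤ r) (h1 : r < 1) :
    Summable fun i : ℕ => ((i : ℝ) + 1) ^ k * r ^ i := by
  rcases h0.eq_or_lt with rfl | h0
  · exact summable_of_ne_finset_zero (s := {0}) fun i hi => by
      rw [zero_pow (by simpa using hi), mul_zero]
  · have h := summable_pow_mul_geometric_of_norm_lt_one k
      (by rwa [Real.norm_of_nonneg h0.le] : ‖r‖ < 1)
    have h2 := ((summable_nat_add_iff 1).mpr h).mul_left r⁻¹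
    refine h2.congr fun i => ?_
    push_cast
    rw [pow_succ]
    field_simp

/-- Expanding the Bose factor and interchanging the sums. -/
lemma tsum_div_exp_sub_one {u : ℕ → ℂ} (hu : ∀ i, ‖u i‖ ≤ ((i : ℝ) + 1) ^ 3) {z : ℂ}
    (hz : 0 < z.re) :
    ∑' i : ℕ, u i / (Complex.exp (((i : ℂ) + 1) * z) - 1)
      = ∑' j : ℕ, ∑' i : ℕ, u i * Complex.exp (-(((j : ℂ) + 1) * z)) ^ (i + 1) := by
  set y : ℂ := Complex.exp (-z) with hy
  have hy1 : ‖y‖ < 1 := norm_exp_neg_lt_one hz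
  have hexp : ∀ i : ℕ, Complex.exp (-(((i : ℂ) + 1) * z)) = y ^ (i + 1) := fun i => by
    rw [hy, ← Complex.exp_nat_mul]
    congr 1
    push_cast
    ring
  have hgeom : ∀ i : ℕ, u i / (Complex.exp (((i : ℂ) + 1) * z) - 1)
      = ∑' j : ℕ, u i * (y ^ (j + 1)) ^ (i + 1) := fun i => by
    have h1 : ‖y ^ (i + 1)‖ < 1 := by
      rw [norm_pow]; exact pow_lt_one₀ (norm_nonneg _) hy1 (Nat.succ_ne_zero i)
    have h2 : Complex.exp (((i : ℂ) + 1) * z) = (y ^ (i + 1))⁻¹ := by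
      rw [← hexp, Complex.exp_neg, inv_inv]
    have h3 : y ^ (i + 1) ≠ 0 := pow_ne_zero _ (Complex.exp_ne_zero _)
    have h4 : 1 - y ^ (i + 1) ≠ 0 := fun h => by
      rw [← sub_eq_zero.mp h, norm_one] at h1
      exact lt_irrefl _ h1
    have h5 : ∀ j : ℕ, u i * (y ^ (j + 1)) ^ (i + 1)
        = u i * y ^ (i + 1) * (y ^ (i + 1)) ^ j := fun j => by
      rw [← pow_mul, mul_comm (j + 1), pow_mul, pow_succ]; ring
    simp_rw [h5]
    rw [tsum_mul_left, tsum_geometric_of_norm_lt_one h1, h2]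
    field_simp
  simp_rw [hgeom, hexp]
  symm
  refine Summable.tsum_comm (f := fun i j : ℕ => u i * (y ^ (j + 1)) ^ (i + 1)) ?_
  have hs1 := summable_add_one_pow_mul_geometric 3 (norm_nonneg y) hy1
  have hs2 := summable_geometric_of_lt_one (norm_nonneg y) hy1
  have hs := hs1.mul_of_nonneg hs2 (fun i => by positivity) (fun i => by positivity)
  refine hs.of_norm_bounded fun p => ?_
  rw [Function.uncurry, norm_mul, norm_pow, norm_pow, ← pow_mul]
  -- The inequality `(i + 1)(j + 1) ≥ i + j` splits the majorant into a product of two convergent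
  -- series.
  have h6 : ‖y‖ ^ ((p.2 + 1) * (p.1 + 1)) ≤ ‖y‖ ^ (p.1 + p.2) :=
    pow_le_pow_of_le_one (norm_nonneg _) hy1.le (by nlinarith)
  calc ‖u p.1‖ * ‖y‖ ^ ((p.2 + 1) * (p.1 + 1)) ≤ ((p.1 : ℝ) + 1) ^ 3 * ‖y‖ ^ (p.1 + p.2) :=
        mul_le_mul (hu _) h6 (by positivity) (by positivity)
    _ = _ := by rw [pow_add]; ring

lemma hasSum_geometric_zero {r : ℂ} (hr : ‖r‖ < 1) :
    HasSum (fun i : ℕ => r ^ (i + 1)) (r / (1 - r)) := by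
  have := (hasSum_geometric_of_norm_lt_one hr).mul_left r
  simpa [pow_succ', div_eq_mul_inv] using this

lemma hasSum_choose_geometric (k : ℕ) {r : ℂ} (hr : ‖r‖ < 1) :
    HasSum (fun i : ℕ => ((i + k).choose k : ℂ) * r ^ (i + 1)) (r / (1 - r) ^ (k + 1)) := by
  have := (hasSum_choose_mul_geometric_of_norm_lt_one k hr).mul_left r
  rw [mul_one_div] at this
  refine this.congr_fun fun i => ?_
  ring

lemma natCast_choose_two (i : ℕ) : ((i + 2).choose 2 : ℂ) = ((i : ℂ) + 1) * (i + 2) / 2 := by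
  rw [Nat.cast_choose_two]; push_cast; ring

lemma natCast_choose_three (i : ℕ) :
    ((i + 3).choose 3 : ℂ) = ((i : ℂ) + 1) * (i + 2) * (i + 3) / 6 := by
  have h := Nat.add_one_mul_choose_eq (i + 2) 2
  have h' : ((i : ℂ) + 2 + 1) * ((i + 2).choose 2 : ℂ) = ((i + 3).choose 3 : ℂ) * (2 + 1) := by
    exact_mod_cast h
  rw [natCast_choose_two] at h'
  linear_combination -(1 / 3) * h'

lemma hasSum_geometric_one {r : ℂ} (hr : ‖r‖ < 1) :
    HasSum (fun i : ℕ => ((i : ℂ) + 1) * r ^ (i + 1)) (r / (1 - r) ^ 2) := by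
  convert hasSum_choose_geometric 1 hr using 2 with i
  rw [Nat.choose_one_right]; push_cast; rfl

lemma hasSum_geometric_two {r : ℂ} (hr : ‖r‖ < 1) :
    HasSum (fun i : ℕ => ((i : ℂ) + 1) ^ 2 * r ^ (i + 1))
      (2 * (r / (1 - r) ^ 3) - r / (1 - r) ^ 2) := by
  refine (((hasSum_choose_geometric 2 hr).mul_left 2).sub (hasSum_geometric_one hr)).congr_fun ?_
  intro i
  rw [natCast_choose_two]; ring

lemma hasSum_geometric_three {r : ℂ} (hr : ‖r‖ < 1) :
    HasSum (fun i : ℕ => ((i : ℂ) + 1) ^ 3 * r ^ (i + 1))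
      (6 * (r / (1 - r) ^ 4) - 6 * (r / (1 - r) ^ 3) + r / (1 - r) ^ 2) := by
  refine ((((hasSum_choose_geometric 3 hr).mul_left 6).sub
    ((hasSum_choose_geometric 2 hr).mul_left 6)).add (hasSum_geometric_one hr)).congr_fun ?_
  intro i
  rw [natCast_choose_two, natCast_choose_three]; ring

lemma one_sub_ne_zero_of_norm_lt_one {r : ℂ} (hr : ‖r‖ < 1) : 1 - r ≠ 0 := fun h => by
  rw [← sub_eq_zero.mp h, norm_one] at hr
  exact lt_irrefl _ hr

/-- Interchanging the sums, the inner series `∑ n³ e^{-nw}` equals `(2 + cosh w) / (8 sinh⁴(w/2))`.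
So `f3` is one eighth of the static series of the closed Einstein universe. -/
lemma expansion_f3 : HasThermalExpansion f3 (6 * (Real.pi : ℂ) ^ 4 / 90) 0 (-1 / 240) := by
  have h := expansion_static.const_mul (1 / 8)
  have e1 : 1 / 8 * (48 * (Real.pi : ℂ) ^ 4 / 90) = 6 * (Real.pi : ℂ) ^ 4 / 90 := by ring
  have e2 : (1 / 8 : ℂ) * (-1 / 30) = -1 / 240 := by norm_num
  rw [e1, e2, mul_zero] at h
  refine h.congr fun z hz => ?_
  rw [f3, tsum_div_exp_sub_one (u := fun i => ((i : ℂ) + 1) ^ 3) (fun i => ?_) hz, ← tsum_mul_left]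
  · refine tsum_congr fun j => ?_
    have hre : 0 < (((j : ℂ) + 1) * z).re := by rw [natCast_add_one_mul_re]; positivity
    rw [(hasSum_geometric_three (norm_exp_neg_lt_one hre)).tsum_eq]
    have hd := one_sub_ne_zero_of_norm_lt_one (norm_exp_neg_lt_one hre)
    set w : ℂ := ((j : ℂ) + 1) * z / 2 with hw
    have e3 : ((j : ℂ) + 1) * z = 2 * w := by rw [hw]; ring
    rw [e3] at hd ⊢
    have e4 : Complex.exp (-(2 * w)) = Complex.exp (-w) ^ 2 := by
      rw [← Complex.exp_nat_mul]; congr 1; push_cast; ring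
    rw [e4] at hd ⊢
    rw [Complex.cosh_two_mul, Complex.cosh, Complex.sinh]
    have e5 : Complex.exp w = (Complex.exp (-w))⁻¹ := by rw [Complex.exp_neg, inv_inv]
    rw [e5]
    have e6 : Complex.exp (-w) ≠ 0 := Complex.exp_ne_zero _
    set y := Complex.exp (-w)
    have e7 : (y⁻¹ - y) / 2 = (1 - y ^ 2) / (2 * y) := by field_simp
    rw [e7]
    field_simp
    ring
  · rw [norm_pow]
    have : ((i : ℂ) + 1) = ((i + 1 : ℝ) : ℂ) := by push_cast; rfl
    rw [this, Complex.norm_real, Real.norm_of_nonneg (by positivity)]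

/-! ### Alternating trigonometric sums from the AdS boundary. -/

section Boundary

/-- If `cosh z` is real and `Re z > 0`, then `sin (Im z) = 0`, so `|cosh z| = cosh (Re z) > 1`. -/
lemma cosh_add_ne_zero {C : ℝ} (hC : |C| ≤ 1) {z : ℂ} (hz : 0 < z.re) :
    Complex.cosh z + C ≠ 0 := by
  intro h
  have h1 : Complex.cosh z = Complex.cosh (z.re + z.im * Complex.I) := by rw [Complex.re_add_im]
  rw [h1, Complex.cosh_add, Complex.cosh_mul_I, Complex.sinh_mul_I] at h
  have hre := congrArg Complex.re h
  have him := congrArg Complex.im h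
  simp [Complex.cosh_ofReal_re, Complex.sinh_ofReal_re, Complex.cos_ofReal_re,
    Complex.sin_ofReal_re] at hre him
  have hs : Real.sinh z.re ≠ 0 := (Real.sinh_pos_iff.mpr hz).ne'
  have hcosh : 1 < Real.cosh z.re := Real.one_lt_cosh.mpr hz.ne'
  have hsin : Real.sin z.im = 0 := by
    rcases him with h | h
    · exact absurd h hz.ne'
    · exact h
  have hcos : Real.cos z.im ^ 2 = 1 := by
    have := Real.sin_sq_add_cos_sq z.im
    rw [hsin] at this
    linarith
  have h2 : (Real.cosh z.re * Real.cos z.im) ^ 2 = C ^ 2 := by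
    have : Real.cosh z.re * Real.cos z.im = -C := by linarith
    rw [this, neg_sq]
  rw [mul_pow, hcos, mul_one] at h2
  have h3 : C ^ 2 ≤ 1 := (sq_le_one_iff_abs_le_one C).mpr hC
  nlinarith

lemma le_norm_cosh_add {C : ℝ} (hC : |C| ≤ 1) {z : ℂ} (hz : 2 ≤ z.re) :
    Real.exp z.re / 4 ≤ ‖Complex.cosh z + C‖ := by
  have h1 := le_norm_cosh z
  have h2 := norm_sub_norm_le (Complex.cosh z) (-(C : ℂ))
  rw [sub_neg_eq_add, norm_neg, Complex.norm_real, Real.norm_eq_abs] at h2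
  have h3 : (5 : ℝ) ≤ Real.exp z.re := by
    have := Real.quadratic_le_exp_of_nonneg (x := z.re) (by linarith)
    nlinarith
  have h4 : Real.exp (-z.re) ≤ 1 / 5 := by
    rw [Real.exp_neg, inv_eq_one_div]
    exact one_div_le_one_div_of_le (by norm_num) h3
  linarith

/-- Because `C > -1` the denominator does not vanish at `0`. There is no polar part, and the
constant term is the value at `0`. The degree in `cosh` drops by one, which gives the decay. -/
lemma isThermalTerm_cosh_add {C : ℝ} (hC : -1 < C) (hC1 : C ≤ 1) (n₀ n₁ n₂ : ℂ) :
    IsThermalTerm (fun z => (n₀ + n₁ * Complex.cosh z + n₂ * Complex.cosh z ^ 2)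
      / (Complex.cosh z + C) ^ 3) 0 0 ((n₀ + n₁ + n₂) / (1 + C) ^ 3) := by
  have habs : |C| ≤ 1 := abs_le.mpr ⟨hC.le, hC1⟩
  have hd : ∀ z : ℂ, Complex.cosh z + C ≠ 0 → DifferentiableAt ℂ
      (fun z => (n₀ + n₁ * Complex.cosh z + n₂ * Complex.cosh z ^ 2)
        / (Complex.cosh z + C) ^ 3) z := fun z hz =>
    DifferentiableAt.div (by fun_prop) (by fun_prop) (pow_ne_zero 3 hz)
  have h0 : Complex.cosh 0 + C ≠ 0 := by
    rw [Complex.cosh_zero]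
    exact_mod_cast (by linarith : (0 : ℝ) < 1 + C).ne'
  refine ⟨fun z => by simp only [Complex.cosh_neg], fun z hz => hd z (cosh_add_ne_zero habs hz),
    ?_, ?_, ?_⟩
  · have : ContinuousAt (fun z : ℂ => Complex.cosh z + C) 0 := by fun_prop
    exact ((this.eventually_ne h0).filter_mono nhdsWithin_le_nhds).mono hd
  · have := (hd 0 h0).continuousAt.tendsto.mono_left (nhdsWithin_le_nhds (s := {0}ᶜ))
    simpa using this
  · refine ⟨(‖n₀‖ + ‖n₁‖ + ‖n₂‖) * 64, 2, fun z hz => ?_⟩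
    have hz0 : 0 ≤ z.re := by linarith
    have hE1 : 1 ≤ Real.exp z.re := Real.one_le_exp hz0
    have hc := norm_cosh_le hz0
    have e1 : ‖n₀ + n₁ * Complex.cosh z + n₂ * Complex.cosh z ^ 2‖
        ≤ (‖n₀‖ + ‖n₁‖ + ‖n₂‖) * Real.exp z.re ^ 2 := by
      refine (norm_add₃_le).trans ?_
      rw [norm_mul, norm_mul, norm_pow, add_mul, add_mul]
      have h1 : 1 ≤ Real.exp z.re ^ 2 := one_le_pow₀ hE1
      have h2 : ‖Complex.cosh z‖ ≤ Real.exp z.re ^ 2 := hc.trans (by nlinarith)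
      have h3 : ‖Complex.cosh z‖ ^ 2 ≤ Real.exp z.re ^ 2 := pow_le_pow_left₀ (norm_nonneg _) hc 2
      refine add_le_add (add_le_add ?_ ?_) ?_
      · exact le_mul_of_one_le_right (norm_nonneg _) h1
      · exact mul_le_mul_of_nonneg_left h2 (norm_nonneg _)
      · exact mul_le_mul_of_nonneg_left h3 (norm_nonneg _)
    have e2 : (Real.exp z.re / 4) ^ 3 ≤ ‖Complex.cosh z + C‖ ^ 3 :=
      pow_le_pow_left₀ (by positivity) (le_norm_cosh_add habs hz) 3
    rw [norm_div, norm_pow]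
    refine (div_le_div₀ (by positivity) e1 (by positivity) e2).trans (le_of_eq ?_)
    rw [Real.exp_neg]
    have := Real.exp_ne_zero z.re
    field_simp
    norm_num

variable {q : ℝ}

lemma cos_two_arctan (q : ℝ) : Real.cos (2 * Real.arctan q) = (1 - q ^ 2) / (1 + q ^ 2) := by
  have : 0 < 1 + q ^ 2 := by positivity
  rw [Real.cos_two_mul, Real.cos_sq_arctan]
  field_simp
  ring

lemma sin_two_arctan (q : ℝ) : Real.sin (2 * Real.arctan q) = 2 * q / (1 + q ^ 2) := by
  have : 0 < 1 + q ^ 2 := by positivity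
  rw [Real.sin_two_mul, Real.sin_arctan, Real.cos_arctan, mul_assoc, div_mul_div_comm, mul_one,
    Real.mul_self_sqrt this.le]
  ring

/-- Once the Bose factor is expanded, only the closed form of the generating series of `u` at
`e^{-w}` matters, as a rational function of `cosh w`. -/
lemma hasThermalExpansion_of_boundary {u : ℕ → ℂ} {s : ℂ → ℂ} {C : ℝ} {n₀ n₁ n₂ c : ℂ}
    (hC : -1 < C) (hC1 : C ≤ 1) (hu : ∀ i, ‖u i‖ ≤ ((i : ℝ) + 1) ^ 3)
    (hs : ∀ z, s z = ∑' i : ℕ, u i / (Complex.exp (((i : ℂ) + 1) * z) - 1))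
    (hc : (n₀ + n₁ + n₂) / (1 + C) ^ 3 = c)
    (h : ∀ w : ℂ, 0 < w.re → HasSum (fun i : ℕ => u i * Complex.exp (-w) ^ (i + 1))
      ((n₀ + n₁ * Complex.cosh w + n₂ * Complex.cosh w ^ 2) / (Complex.cosh w + C) ^ 3)) :
    HasThermalExpansion s 0 0 (-c / 2) := by
  have h1 := (isThermalTerm_cosh_add hC hC1 n₀ n₁ n₂).hasThermalExpansion
  rw [hc, zero_mul, zero_div, zero_mul, zero_div] at h1
  refine h1.congr fun z hz => ?_
  rw [hs, tsum_div_exp_sub_one hu hz]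
  refine tsum_congr fun j => (h _ ?_).tsum_eq
  rw [natCast_add_one_mul_re]
  positivity

/-- With `E = e^{iφ}` the alternating trigonometric series become geometric-type series in `-E
e^{-w}` and `-E⁻¹ e^{-w}`. -/
lemma phase_facts (φ : ℝ) : ∃ E : ℂ, E ≠ 0 ∧ ‖E‖ = 1 ∧ ‖E⁻¹‖ = 1 ∧
    (∀ n : ℕ, (Real.cos (n * φ) : ℂ) = (E ^ n + E⁻¹ ^ n) / 2) ∧
    (∀ n : ℕ, (Real.sin (n * φ) : ℂ) = (E ^ n - E⁻¹ ^ n) / (2 * Complex.I)) := by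
  have h0 : ∀ n : ℕ, Complex.exp (φ * Complex.I) ^ n = Complex.exp (n * φ * Complex.I) :=
    fun n => by
      rw [← Complex.exp_nat_mul]; congr 1; ring
  have h1 : ∀ n : ℕ, (Complex.exp (φ * Complex.I))⁻¹ ^ n = Complex.exp (-(n * φ) * Complex.I) :=
    fun n => by
      rw [← Complex.exp_neg, ← Complex.exp_nat_mul]; congr 1; ring
  refine ⟨Complex.exp (φ * Complex.I), Complex.exp_ne_zero _, Complex.norm_exp_ofReal_mul_I φ,
    by rw [norm_inv, Complex.norm_exp_ofReal_mul_I, inv_one], fun n => ?_, fun n => ?_⟩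
  · rw [h0, h1]; push_cast; rw [Complex.cos]
  · rw [h0, h1]; push_cast; rw [Complex.sin]
    have := Complex.I_ne_zero
    field_simp
    rw [Complex.I_sq]
    ring

lemma hasSum_of_eq {f g : ℕ → ℂ} {a b : ℂ} (h : HasSum f a) (hab : b = a) (hfg : ∀ i, g i = f i) :
    HasSum g b := by
  rw [hab]
  exact h.congr_fun hfg

/-- The common summation for the boundary series. -/
lemma hasSum_boundary {f : ℕ → ℂ} {g : ℂ → ℂ}
    (hg : ∀ r : ℂ, ‖r‖ < 1 → HasSum (fun i => f i * r ^ (i + 1)) (g r)) {E : ℂ} (hE : ‖E‖ = 1)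
    (hE' : ‖E⁻¹‖ = 1) {w : ℂ} (hw : 0 < w.re) (ε : ℂ) :
    HasSum (fun i : ℕ => f i * (-1) ^ (i + 1) * (E ^ (i + 1) + ε * E⁻¹ ^ (i + 1))
      * Complex.exp (-w) ^ (i + 1)) (g (-(E * Complex.exp (-w)))
        + ε * g (-(E⁻¹ * Complex.exp (-w)))) := by
  have hy := norm_exp_neg_lt_one hw
  have h1 := hg (-(E * Complex.exp (-w))) (by rwa [norm_neg, norm_mul, hE, one_mul])
  have h2 := hg (-(E⁻¹ * Complex.exp (-w))) (by rwa [norm_neg, norm_mul, hE', one_mul])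
  refine (h1.add (h2.mul_left ε)).congr_fun fun i => ?_
  rw [neg_pow (E * _), mul_pow, neg_pow (E⁻¹ * _), mul_pow]
  ring

lemma norm_add_one_pow_mul_le {m : ℕ} (hm : m ≤ 3) (i : ℕ) {x : ℝ} (hx : |x| ≤ 1) :
    ‖((i : ℂ) + 1) ^ m * (-1) ^ (i + 1) * (x : ℂ)‖ ≤ ((i : ℝ) + 1) ^ 3 := by
  have : ((i : ℂ) + 1) = ((i + 1 : ℝ) : ℂ) := by push_cast; rfl
  rw [norm_mul, norm_mul, norm_pow, norm_pow, norm_neg, norm_one, one_pow, mul_one, this,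
    Complex.norm_real, Complex.norm_real, Real.norm_of_nonneg (by positivity), Real.norm_eq_abs]
  have h1 : ((i : ℝ) + 1) ^ m ≤ ((i : ℝ) + 1) ^ 3 :=
    pow_le_pow_right₀ (by linarith [Nat.cast_nonneg (α := ℝ) i]) hm
  exact (mul_le_of_le_one_right (by positivity) hx).trans h1

lemma serS_eq (m : ℕ) (q : ℝ) (z : ℂ) : serS m q z = ∑' i : ℕ, ((i : ℂ) + 1) ^ m * (-1) ^ (i + 1)
    * (Real.sin ((i + 1 : ℕ) * (2 * Real.arctan q)) : ℂ)
      / (Complex.exp (((i : ℂ) + 1) * z) - 1) := by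
  rw [serS]
  refine tsum_congr fun i => ?_
  have : 2 * ((i : ℝ) + 1) * Real.arctan q = (i + 1 : ℕ) * (2 * Real.arctan q) := by
    push_cast; ring
  rw [this]
  ring

lemma serC_eq (m : ℕ) (q : ℝ) (z : ℂ) : serC m q z = ∑' i : ℕ, ((i : ℂ) + 1) ^ m * (-1) ^ (i + 1)
    * (Real.cos ((i + 1 : ℕ) * (2 * Real.arctan q)) : ℂ)
      / (Complex.exp (((i : ℂ) + 1) * z) - 1) := by
  rw [serC]
  refine tsum_congr fun i => ?_
  have : 2 * ((i : ℝ) + 1) * Real.arctan q = (i + 1 : ℕ) * (2 * Real.arctan q) := by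
    push_cast; ring
  rw [this]
  ring

lemma neg_one_lt_cos_two_arctan (q : ℝ) : -1 < Real.cos (2 * Real.arctan q) := by
  have : 0 < 1 + q ^ 2 := by positivity
  rw [cos_two_arctan, lt_div_iff₀ this]
  linarith

lemma boundary_denominators {E y : ℂ} (hn : ‖E‖ = 1) (hy : ‖y‖ < 1) :
    1 + E * y ≠ 0 ∧ E + y ≠ 0 := by
  constructor
  · intro h
    have : ‖E * y‖ = 1 := by
      rw [show E * y = -1 by linear_combination h, norm_neg, norm_one]
    rw [norm_mul, hn, one_mul] at this
    linarith
  · intro h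
    have : ‖y‖ = 1 := by rw [show y = -E by linear_combination h, norm_neg, hn]
    linarith

/-- This factors `cosh w + cos φ` into the two geometric denominators. The exponents `1` keep the
form produced by `phase_facts` at `n = 1`. -/
lemma cosh_add_eq {E w : ℂ} (hE : E ≠ 0) : Complex.cosh w + (E ^ 1 + E⁻¹ ^ 1) / 2
    = (1 + E * Complex.exp (-w)) * (E + Complex.exp (-w)) / (2 * E * Complex.exp (-w)) := by
  have h1 : Complex.exp w = (Complex.exp (-w))⁻¹ := by rw [Complex.exp_neg, inv_inv]
  have h2 : Complex.exp (-w) ≠ 0 := Complex.exp_ne_zero _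
  rw [Complex.cosh, h1]
  field_simp
  ring

lemma cosh_eq_exp_neg (w : ℂ) :
    Complex.cosh w = (1 + Complex.exp (-w) ^ 2) / (2 * Complex.exp (-w)) := by
  have h1 : Complex.exp w = (Complex.exp (-w))⁻¹ := by rw [Complex.exp_neg, inv_inv]
  have h2 : Complex.exp (-w) ≠ 0 := Complex.exp_ne_zero _
  rw [Complex.cosh, h1]
  field_simp

lemma one_add_sq_ne_zero (q : ℝ) : (1 : ℂ) + q ^ 2 ≠ 0 := by
  exact_mod_cast (by positivity : 0 < 1 + q ^ 2).ne'

/-- The generating series is `-(s/2) / (cosh w + C)`, extended by `(cosh w + C)²` to fit the common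
cubic denominator. Its value at `0` is `-q/2`, since `s / (1 + C)` is the tangent of the half-angle,
namely `q`. -/
lemma expansion_serS_zero (q : ℝ) : HasThermalExpansion (serS 0 q) 0 0 (-(-q / 2) / 2) := by
  set C := Real.cos (2 * Real.arctan q) with hC
  set s := Real.sin (2 * Real.arctan q) with hs
  have hq := one_add_sq_ne_zero q
  refine hasThermalExpansion_of_boundary (C := C) (n₀ := -s * C ^ 2 / 2) (n₁ := -s * C)
    (n₂ := -s / 2) (neg_one_lt_cos_two_arctan q) (Real.cos_le_one _)
    (fun i => norm_add_one_pow_mul_le (by norm_num) i (Real.abs_sin_le_one _))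
    (serS_eq 0 q) ?_ fun w hw => ?_
  · rw [hC, hs, cos_two_arctan, sin_two_arctan]
    push_cast
    have : (1 : ℂ) + (1 - q ^ 2) / (1 + q ^ 2) = 2 / (1 + q ^ 2) := by field_simp; ring
    rw [this]
    field_simp
    ring
  · obtain ⟨E, hE0, hE, hE', hcos, hsin⟩ := phase_facts (2 * Real.arctan q)
    have hCE := hcos 1
    have hsE := hsin 1
    rw [Nat.cast_one, one_mul] at hCE hsE
    rw [← hC] at hCE
    rw [← hs] at hsE
    have h1 := (hasSum_boundary (f := fun _ => 1) (g := fun r => r / (1 - r))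
      (fun r hr => by simpa using hasSum_geometric_zero hr) hE hE' hw (-1)).mul_left
      (1 / (2 * Complex.I))
    obtain ⟨hd1, hd2⟩ := boundary_denominators hE (norm_exp_neg_lt_one hw)
    have hy : Complex.exp (-w) ≠ 0 := Complex.exp_ne_zero _
    have hI := Complex.I_ne_zero
    refine hasSum_of_eq h1 ?_ fun i => ?_
    · rw [hsE, hCE, cosh_add_eq hE0, cosh_eq_exp_neg]
      set y := Complex.exp (-w)
      have e1 : 1 - -(E⁻¹ * y) = (E + y) / E := by field_simp; ring
      have e2 : 1 - -(E * y) = 1 + E * y := by ring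
      rw [e1, e2]
      field_simp
      ring
    · rw [hsin]
      ring

/-- The generating series is `-(1 + C cosh w) / (2 (cosh w + C)²)`, extended by one more factor
`cosh w + C`. -/
lemma expansion_serC_one (q : ℝ) :
    HasThermalExpansion (serC 1 q) 0 0 (-(-(1 + q ^ 2) / 4) / 2) := by
  set C := Real.cos (2 * Real.arctan q) with hC
  have hq := one_add_sq_ne_zero q
  refine hasThermalExpansion_of_boundary (C := C) (n₀ := -C / 2) (n₁ := -(1 + C ^ 2) / 2)
    (n₂ := -C / 2) (neg_one_lt_cos_two_arctan q) (Real.cos_le_one _)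
    (fun i => norm_add_one_pow_mul_le (by norm_num) i (Real.abs_cos_le_one _))
    (serC_eq 1 q) ?_ fun w hw => ?_
  · rw [hC, cos_two_arctan]
    push_cast
    have : (1 : ℂ) + (1 - q ^ 2) / (1 + q ^ 2) = 2 / (1 + q ^ 2) := by field_simp; ring
    rw [this]
    field_simp
    ring
  · obtain ⟨E, hE0, hE, hE', hcos, hsin⟩ := phase_facts (2 * Real.arctan q)
    have hCE := hcos 1
    rw [Nat.cast_one, one_mul, ← hC] at hCE
    have h1 := (hasSum_boundary (f := fun i => (i : ℂ) + 1) (g := fun r => r / (1 - r) ^ 2)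
      (fun r hr => hasSum_geometric_one hr) hE hE' hw 1).mul_left (1 / 2)
    obtain ⟨hd1, hd2⟩ := boundary_denominators hE (norm_exp_neg_lt_one hw)
    have hy : Complex.exp (-w) ≠ 0 := Complex.exp_ne_zero _
    refine hasSum_of_eq h1 ?_ fun i => ?_
    · rw [hCE, cosh_add_eq hE0, cosh_eq_exp_neg]
      set y := Complex.exp (-w)
      have e1 : 1 - -(E⁻¹ * y) = (E + y) / E := by field_simp; ring
      have e2 : 1 - -(E * y) = 1 + E * y := by ring
      rw [e1, e2]
      field_simp
      ring
    · rw [hcos]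
      ring

lemma expansion_serS_two (q : ℝ) :
    HasThermalExpansion (serS 2 q) 0 0 (-(q * (1 + q ^ 2) / 4) / 2) := by
  set C := Real.cos (2 * Real.arctan q) with hC
  set s := Real.sin (2 * Real.arctan q) with hs
  have hq := one_add_sq_ne_zero q
  refine hasThermalExpansion_of_boundary (C := C) (n₀ := s) (n₁ := s * C / 2)
    (n₂ := -s / 2) (neg_one_lt_cos_two_arctan q) (Real.cos_le_one _)
    (fun i => norm_add_one_pow_mul_le (by norm_num) i (Real.abs_sin_le_one _))
    (serS_eq 2 q) ?_ fun w hw => ?_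
  · rw [hC, hs, cos_two_arctan, sin_two_arctan]
    push_cast
    have : (1 : ℂ) + (1 - q ^ 2) / (1 + q ^ 2) = 2 / (1 + q ^ 2) := by field_simp; ring
    rw [this]
    field_simp
    ring
  · obtain ⟨E, hE0, hE, hE', hcos, hsin⟩ := phase_facts (2 * Real.arctan q)
    have hCE := hcos 1
    have hsE := hsin 1
    rw [Nat.cast_one, one_mul] at hCE hsE
    rw [← hC] at hCE
    rw [← hs] at hsE
    have h1 := (hasSum_boundary (f := fun i => ((i : ℂ) + 1) ^ 2)
      (g := fun r => 2 * (r / (1 - r) ^ 3) - r / (1 - r) ^ 2)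
      (fun r hr => hasSum_geometric_two hr) hE hE' hw (-1)).mul_left (1 / (2 * Complex.I))
    obtain ⟨hd1, hd2⟩ := boundary_denominators hE (norm_exp_neg_lt_one hw)
    have hy : Complex.exp (-w) ≠ 0 := Complex.exp_ne_zero _
    have hI := Complex.I_ne_zero
    refine hasSum_of_eq h1 ?_ fun i => ?_
    · rw [hsE, hCE, cosh_add_eq hE0, cosh_eq_exp_neg]
      set y := Complex.exp (-w)
      have e1 : 1 - -(E⁻¹ * y) = (E + y) / E := by field_simp; ring
      have e2 : 1 - -(E * y) = 1 + E * y := by ring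
      rw [e1, e2]
      field_simp
      ring
    · rw [hsin]
      ring

end Boundary

/-! ### Distillates of the AdS and dS coefficients. -/

section Distilled

variable {q T₀ : ℝ}

/-- The boundary sums contribute only constants, `q/4`, `(1 + q²)/8` and `-q (1 + q²)/8`, and these
cancel in the combination. The result is that of the bulk term alone, for every `ε`; the same
happens for the coefficients of `u u` and `A A`. -/
lemma expansion_adsG (hq : 0 < q) (ε : ℂ) : HasThermalExpansion (fun z =>
    -(1 / (6 * (Real.pi : ℂ) ^ 2) * (1 / (1 + (q : ℂ) ^ 2)) ^ 2) * f3 z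
      + ε * (1 / (8 * (Real.pi : ℂ) ^ 2 * q)) *
        (1 / 6 * ((1 - (q : ℂ) ^ 2) / (q : ℂ) ^ 2) * serS 0 q z
      + -(1 / (3 * (q : ℂ))) * serC 1 q z
      + -(2 / 3 * (1 / (1 + (q : ℂ) ^ 2))) * serS 2 q z))
    (-((Real.pi : ℂ) ^ 2 / 90 * (1 / (1 + (q : ℂ) ^ 2)) ^ 2)) 0
    (1 / (1440 * (Real.pi : ℂ) ^ 2) * (1 / (1 + (q : ℂ) ^ 2)) ^ 2) := by
  have hπ : (Real.pi : ℂ) ≠ 0 := by exact_mod_cast Real.pi_ne_zero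
  have hq' : (q : ℂ) ≠ 0 := by exact_mod_cast hq.ne'
  have hq2 := one_add_sq_ne_zero q
  have h := (expansion_f3.const_mul
    (-(1 / (6 * (Real.pi : ℂ) ^ 2) * (1 / (1 + (q : ℂ) ^ 2)) ^ 2))).add
    (((((expansion_serS_zero q).const_mul (1 / 6 * ((1 - (q : ℂ) ^ 2) / (q : ℂ) ^ 2))).add
      ((expansion_serC_one q).const_mul (-(1 / (3 * (q : ℂ)))))).add
      ((expansion_serS_two q).const_mul (-(2 / 3 * (1 / (1 + (q : ℂ) ^ 2)))))).const_mul
      (ε * (1 / (8 * (Real.pi : ℂ) ^ 2 * q))))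
  convert h using 1
  · field_simp; ring
  · ring
  · field_simp; ring

lemma expansion_adsU (hq : 0 < q) (ε : ℂ) : HasThermalExpansion (fun z =>
    4 * (1 / (6 * (Real.pi : ℂ) ^ 2) * (1 / (1 + (q : ℂ) ^ 2)) ^ 2) * f3 z
      + ε * (1 / (8 * (Real.pi : ℂ) ^ 2 * q)) *
        (1 / 6 * (3 - 1 / (q : ℂ) ^ 2) * serS 0 q z
      + 1 / (q : ℂ) * (1 - 2 / 3 * (1 / (1 + (q : ℂ) ^ 2))) * serC 1 q z
      + 2 / (1 + (q : ℂ) ^ 2) * serS 2 q z))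
    (4 * ((Real.pi : ℂ) ^ 2 / 90 * (1 / (1 + (q : ℂ) ^ 2)) ^ 2)) 0
    (-4 * (1 / (1440 * (Real.pi : ℂ) ^ 2) * (1 / (1 + (q : ℂ) ^ 2)) ^ 2)) := by
  have hπ : (Real.pi : ℂ) ≠ 0 := by exact_mod_cast Real.pi_ne_zero
  have hq' : (q : ℂ) ≠ 0 := by exact_mod_cast hq.ne'
  have hq2 := one_add_sq_ne_zero q
  have h := (expansion_f3.const_mul
      (4 * (1 / (6 * (Real.pi : ℂ) ^ 2) * (1 / (1 + (q : ℂ) ^ 2)) ^ 2))).add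
    (((((expansion_serS_zero q).const_mul (1 / 6 * (3 - 1 / (q : ℂ) ^ 2))).add
      ((expansion_serC_one q).const_mul (1 / (q : ℂ) * (1 - 2 / 3 * (1 / (1 + (q : ℂ) ^ 2)))))).add
      ((expansion_serS_two q).const_mul (2 / (1 + (q : ℂ) ^ 2)))).const_mul
      (ε * (1 / (8 * (Real.pi : ℂ) ^ 2 * q))))
  convert h using 1
  · field_simp; ring
  · ring
  · field_simp; ring

lemma expansion_adsA (hq : 0 < q) (ε : ℂ) : HasThermalExpansion (fun z =>
    ε * (1 / (8 * (Real.pi : ℂ) ^ 2 * q)) *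
        (1 / 6 * (3 * ((1 + (q : ℂ) ^ 2) / (q : ℂ) ^ 2) - 4) * serS 0 q z
      + 1 / (q : ℂ) * (2 / 3 * ((q : ℂ) ^ 2 / (1 + (q : ℂ) ^ 2)) - 1) * serC 1 q z
      + -(2 / 3 * (1 / (1 + (q : ℂ) ^ 2))) * serS 2 q z)) 0 0 0 := by
  have hπ : (Real.pi : ℂ) ≠ 0 := by exact_mod_cast Real.pi_ne_zero
  have hq' : (q : ℂ) ≠ 0 := by exact_mod_cast hq.ne'
  have hq2 := one_add_sq_ne_zero q
  have h := ((((expansion_serS_zero q).const_mul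
        (1 / 6 * (3 * ((1 + (q : ℂ) ^ 2) / (q : ℂ) ^ 2) - 4))).add
      ((expansion_serC_one q).const_mul
        (1 / (q : ℂ) * (2 / 3 * ((q : ℂ) ^ 2 / (1 + (q : ℂ) ^ 2)) - 1)))).add
      ((expansion_serS_two q).const_mul (-(2 / 3 * (1 / (1 + (q : ℂ) ^ 2)))))).const_mul
      (ε * (1 / (8 * (Real.pi : ℂ) ^ 2 * q)))
  convert h using 1
  · ring
  · ring
  · field_simp; ring

lemma distilled_adsG (hq : 0 < q) (hT : 0 < T₀) (ε κ : ℝ) :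
    IsDistilledValue (fun k => -adsBulk (1 / T₀) q k + ε * adsBoundG (1 / T₀) q k) ((κ : ℂ) ^ 2)
      ((-((Real.pi ^ 2 / 90 * T₀ ^ 4 - κ ^ 4 / (1440 * Real.pi ^ 2))
        / (1 + q ^ 2) ^ 2) : ℝ) : ℂ) := by
  have hπ : (Real.pi : ℂ) ≠ 0 := by exact_mod_cast Real.pi_ne_zero
  have hT' : (T₀ : ℂ) ≠ 0 := by exact_mod_cast hT.ne'
  have hq2 := one_add_sq_ne_zero q
  convert (expansion_adsG hq ε).isDistilledValue_four (one_div_pos.mpr hT) 1 ((κ : ℂ) ^ 2) using 1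
  · funext k; rw [adsBulk, adsBoundG]; ring
  · push_cast; field_simp; ring

lemma distilled_adsU (hq : 0 < q) (hT : 0 < T₀) (ε κ : ℝ) :
    IsDistilledValue (fun k => 4 * adsBulk (1 / T₀) q k + ε * adsBoundU (1 / T₀) q k) ((κ : ℂ) ^ 2)
      ((4 * ((Real.pi ^ 2 / 90 * T₀ ^ 4 - κ ^ 4 / (1440 * Real.pi ^ 2)) / (1 + q ^ 2) ^ 2) : ℝ)
        : ℂ) := by
  have hπ : (Real.pi : ℂ) ≠ 0 := by exact_mod_cast Real.pi_ne_zero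
  have hT' : (T₀ : ℂ) ≠ 0 := by exact_mod_cast hT.ne'
  have hq2 := one_add_sq_ne_zero q
  convert (expansion_adsU hq ε).isDistilledValue_four (one_div_pos.mpr hT) 1 ((κ : ℂ) ^ 2) using 1
  · funext k; rw [adsBulk, adsBoundU]; ring
  · push_cast; field_simp; ring

lemma distilled_adsA (hq : 0 < q) (hT : 0 < T₀) (ε κ : ℝ) :
    IsDistilledValue (fun k => ε * adsBoundA (1 / T₀) q k) ((κ : ℂ) ^ 2) ((0 : ℝ) : ℂ) := by
  have hq' : (q : ℂ) ≠ 0 := by exact_mod_cast hq.ne'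
  convert (expansion_adsA hq ε).isDistilledValue_two (one_div_pos.mpr hT)
    ((1 + (q : ℂ) ^ 2) / (q : ℂ) ^ 2) ((κ : ℂ) ^ 2) using 1
  · funext k
    rw [adsBoundA]
    -- The coefficient contains `κ⁴ / κ²`; cancelling needs `κ ≠ 0`, and at `κ = 0` both sides
    -- vanish.
    rcases eq_or_ne k 0 with rfl | hk
    · simp
    · field_simp; ring
  · push_cast; ring

lemma distilled_dsPressure (q κ : ℝ) :
    IsDistilledValue (dsPressure T₀ q) ((κ : ℂ) ^ 2)
      (((Real.pi ^ 2 / 90 * T₀ ^ 4 - κ ^ 4 / (1440 * Real.pi ^ 2)) / (1 - q ^ 2) ^ 2 : ℝ) : ℂ) := by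
  have h := isDistilledValue_of_rays (f := dsPressure T₀ q)
    (e₀ := (Real.pi : ℂ) ^ 2 / 90 * T₀ ^ 4 * (1 / (1 - (q : ℂ) ^ 2)) ^ 2) (e₁ := 0)
    (e₂ := -1 / (1440 * (Real.pi : ℂ) ^ 2) * (1 / (1 - (q : ℂ) ^ 2)) ^ 2) (p := 1) (by decide)
    (fun θ _ => ⟨0, fun N => (isBigO_zero _ _).congr_left fun κ => by
      rw [dsPressure]; ring⟩) ((κ : ℂ) ^ 2)
  convert h using 1
  push_cast
  generalize (1 : ℂ) - (q : ℂ) ^ 2 = d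
  ring

end Distilled

/-! ### Curvature of static spherically symmetric metrics -/

/-- `f(r) dt² - h(r) dr² - m(r) (dθ² + sin²θ dφ²)`. -/
def warpedMetric (f h m : ℝ → ℝ) : Metric := fun x =>
  Matrix.diagonal ![f (x 1), -h (x 1), -m (x 1), -(m (x 1) * Real.sin (x 2) ^ 2)]

/-- Closed forms for Christoffel symbols and velocities hold only at regular points of the chart.
Differentiating them therefore uses agreement near the point. -/
lemma pd_congr {F G : Coord → ℝ} {x : Coord} (h : ∀ᶠ y in 𝓝 x, F y = G y) (i : Fin 4) :
    pd i F x = pd i G x := by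
  unfold pd
  refine EventuallyEq.deriv_eq ?_
  have hc : Continuous fun s : ℝ => Function.update x i s := by fun_prop
  have ht := hc.tendsto (x i)
  rw [Function.update_eq_self] at ht
  exact ht.eventually h

/-- Partial derivatives of a function of the coordinates `1` and `2`. -/
lemma pd_of_two {Φ : ℝ → ℝ → ℝ} {x : Coord} {p q : ℝ}
    (hp : HasDerivAt (fun s => Φ s (x 2)) p (x 1)) (hq : HasDerivAt (fun s => Φ (x 1) s) q (x 2))
    (i : Fin 4) : pd i (fun y => Φ (y 1) (y 2)) x = ![0, p, q, 0] i := by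
  unfold pd
  fin_cases i
  · simp
  · simpa using hp.deriv
  · simpa using hq.deriv
  · simp

lemma inv_diagonal_of_ne_zero {v : Fin 4 → ℝ} (hv : ∀ i, v i ≠ 0) :
    (Matrix.diagonal v)⁻¹ = Matrix.diagonal fun i => (v i)⁻¹ := by
  refine Matrix.inv_eq_right_inv ?_
  rw [Matrix.diagonal_mul_diagonal, ← Matrix.diagonal_one]
  congr 1
  funext i
  exact mul_inv_cancel₀ (hv i)

lemma pd_zero (i : Fin 4) (x : Coord) : pd i (fun _ => 0) x = 0 := by simp [pd]

lemma christoffel_diagonal {v : Coord → Fin 4 → ℝ} {x : Coord} (hv : ∀ i, v x i ≠ 0)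
    (μ ν ρ : Fin 4) : christoffel (fun y => Matrix.diagonal (v y)) x μ ν ρ
      = 1 / 2 * ((v x μ)⁻¹ * ((if μ = ρ then pd ν (fun y => v y μ) x else 0)
        + (if μ = ν then pd ρ (fun y => v y μ) x else 0)
        - if ν = ρ then pd μ (fun y => v y ν) x else 0)) := by
  have hpd : ∀ i j k : Fin 4, pd i (fun y => Matrix.diagonal (v y) j k) x
      = if j = k then pd i (fun y => v y j) x else 0 := fun i j k => by
    split_ifs with h
    · subst h; simp
    · simp [Matrix.diagonal_apply_ne _ h, pd_zero]
  rw [christoffel, inv_diagonal_of_ne_zero hv]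
  rw [Finset.sum_eq_single μ]
  · simp only [Matrix.diagonal_apply_eq, hpd]
  · intro σ _ hσ
    rw [Matrix.diagonal_apply_ne _ (Ne.symm hσ), zero_mul]
  · simp

/-- The Christoffel symbols of `warpedMetric`, in terms of
`a = f'/2f`, `b = f'/2h`, `c = h'/2h`, `d = -m'/2h`, `e = m'/2m`. -/
def warpedGamma (a b c d e θ : ℝ) : Fin 4 → Fin 4 → Fin 4 → ℝ
  | 0, 0, 1 => a
  | 0, 1, 0 => a
  | 1, 0, 0 => b
  | 1, 1, 1 => c
  | 1, 2, 2 => d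
  | 1, 3, 3 => d * Real.sin θ ^ 2
  | 2, 1, 2 => e
  | 2, 2, 1 => e
  | 2, 3, 3 => -(Real.sin θ * Real.cos θ)
  | 3, 1, 3 => e
  | 3, 3, 1 => e
  | 3, 2, 3 => Real.cos θ / Real.sin θ
  | 3, 3, 2 => Real.cos θ / Real.sin θ
  | _, _, _ => 0

lemma christoffel_warped {f h m : ℝ → ℝ} {f' h' m' : ℝ} {x : Coord}
    (hf : HasDerivAt f f' (x 1)) (hh : HasDerivAt h h' (x 1)) (hm : HasDerivAt m m' (x 1))
    (hf0 : f (x 1) ≠ 0) (hh0 : h (x 1) ≠ 0) (hm0 : m (x 1) ≠ 0) (hs : Real.sin (x 2) ≠ 0)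
    (μ ν ρ : Fin 4) : christoffel (warpedMetric f h m) x μ ν ρ
      = warpedGamma (f' / (2 * f (x 1))) (f' / (2 * h (x 1))) (h' / (2 * h (x 1)))
        (-m' / (2 * h (x 1))) (m' / (2 * m (x 1))) (x 2) μ ν ρ := by
  have h0 : ∀ i, pd i (fun y : Coord => f (y 1)) x = ![0, f', 0, 0] i :=
    pd_of_two (Φ := fun r _ => f r) hf (hasDerivAt_const _ _)
  have h1 : ∀ i, pd i (fun y : Coord => -h (y 1)) x = ![0, -h', 0, 0] i :=
    pd_of_two (Φ := fun r _ => -h r) hh.neg (hasDerivAt_const _ _)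
  have h2 : ∀ i, pd i (fun y : Coord => -m (y 1)) x = ![0, -m', 0, 0] i :=
    pd_of_two (Φ := fun r _ => -m r) hm.neg (hasDerivAt_const _ _)
  have h3 : ∀ i, pd i (fun y : Coord => -(m (y 1) * Real.sin (y 2) ^ 2)) x
      = ![0, -(m' * Real.sin (x 2) ^ 2),
        -(m (x 1) * (2 * Real.sin (x 2) * Real.cos (x 2))), 0] i := by
    refine pd_of_two (Φ := fun r θ => -(m r * Real.sin θ ^ 2)) (hm.mul_const _).neg ?_
    refine ((((Real.hasDerivAt_sin (x 2)).fun_pow 2).const_mul (m (x 1))).fun_neg).congr_deriv ?_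
    push_cast
    ring
  have hv : ∀ i, ![f (x 1), -h (x 1), -m (x 1), -(m (x 1) * Real.sin (x 2) ^ 2)] i ≠ 0 := by
    intro i
    fin_cases i
    · exact hf0
    · exact neg_ne_zero.mpr hh0
    · exact neg_ne_zero.mpr hm0
    · exact neg_ne_zero.mpr (mul_ne_zero hm0 (pow_ne_zero 2 hs))
  unfold warpedMetric
  rw [christoffel_diagonal hv]
  fin_cases μ <;> fin_cases ν <;> fin_cases ρ <;>
    simp [warpedGamma, h0, h1, h2, h3] <;> field_simp

/-- The components `R^μ_{νμν}` in terms of `warpedGamma` and derivatives. -/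
def warpedQ (a b c d e a' b' d' e' θ : ℝ) : Fin 4 → Fin 4 → ℝ
  | 0, 1 => a' + a ^ 2 - a * c
  | 0, 2 => -(a * d)
  | 0, 3 => -(a * d) * Real.sin θ ^ 2
  | 1, 0 => -b' + a * b - c * b
  | 1, 2 => -d' + d * e - c * d
  | 1, 3 => (-d' + d * e - c * d) * Real.sin θ ^ 2
  | 2, 0 => -(e * b)
  | 2, 1 => e' + e ^ 2 - e * c
  | 2, 3 => -(1 + e * d) * Real.sin θ ^ 2
  | 3, 0 => -(e * b)
  | 3, 1 => e' + e ^ 2 - e * c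
  | 3, 2 => -(1 + e * d)
  | _, _ => 0

/-- The coordinate derivatives of `warpedGamma`. -/
def warpedGammaDeriv (d a' b' c' d' e' θ : ℝ) : Fin 4 → Fin 4 → Fin 4 → Fin 4 → ℝ
  | 1, 0, 0, 1 => a'
  | 1, 0, 1, 0 => a'
  | 1, 1, 0, 0 => b'
  | 1, 1, 1, 1 => c'
  | 1, 1, 2, 2 => d'
  | 1, 1, 3, 3 => d' * Real.sin θ ^ 2
  | 2, 1, 3, 3 => d * (2 * Real.sin θ * Real.cos θ)
  | 1, 2, 1, 2 => e'
  | 1, 2, 2, 1 => e'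
  | 2, 2, 3, 3 => -(Real.cos θ ^ 2 - Real.sin θ ^ 2)
  | 1, 3, 1, 3 => e'
  | 1, 3, 3, 1 => e'
  | 2, 3, 2, 3 => -(1 / Real.sin θ ^ 2)
  | 2, 3, 3, 2 => -(1 / Real.sin θ ^ 2)
  | _, _, _, _ => 0

section

variable {a b c d e : ℝ → ℝ} {a' b' c' d' e' : ℝ} {x : Coord}

lemma pd_warpedGamma (ha : HasDerivAt a a' (x 1)) (hb : HasDerivAt b b' (x 1))
    (hc : HasDerivAt c c' (x 1)) (hd : HasDerivAt d d' (x 1)) (he : HasDerivAt e e' (x 1))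
    (hs : Real.sin (x 2) ≠ 0) (i μ ν ρ : Fin 4) :
    pd i (fun y => warpedGamma (a (y 1)) (b (y 1)) (c (y 1)) (d (y 1)) (e (y 1)) (y 2) μ ν ρ) x
      = warpedGammaDeriv (d (x 1)) a' b' c' d' e' (x 2) i μ ν ρ := by
  have ha2 := pd_of_two (Φ := fun r _ => a r) (x := x) ha (hasDerivAt_const _ _) i
  have hb2 := pd_of_two (Φ := fun r _ => b r) (x := x) hb (hasDerivAt_const _ _) i
  have hc2 := pd_of_two (Φ := fun r _ => c r) (x := x) hc (hasDerivAt_const _ _) i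
  have hd2 := pd_of_two (Φ := fun r _ => d r) (x := x) hd (hasDerivAt_const _ _) i
  have he2 := pd_of_two (Φ := fun r _ => e r) (x := x) he (hasDerivAt_const _ _) i
  have hds : pd i (fun y : Coord => d (y 1) * Real.sin (y 2) ^ 2) x
      = ![0, d' * Real.sin (x 2) ^ 2, d (x 1) * (2 * Real.sin (x 2) * Real.cos (x 2)), 0] i := by
    refine pd_of_two (Φ := fun r θ => d r * Real.sin θ ^ 2) (hd.mul_const _) ?_ i
    have := ((Real.hasDerivAt_sin (x 2)).pow 2).const_mul (d (x 1))
    simpa using this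
  have hsc : pd i (fun y : Coord => -(Real.sin (y 2) * Real.cos (y 2))) x
      = ![0, 0, -(Real.cos (x 2) ^ 2 - Real.sin (x 2) ^ 2), 0] i := by
    refine pd_of_two (Φ := fun _ θ => -(Real.sin θ * Real.cos θ)) (hasDerivAt_const _ _) ?_ i
    refine ((Real.hasDerivAt_sin (x 2)).fun_mul (Real.hasDerivAt_cos (x 2))).fun_neg.congr_deriv ?_
    ring
  have hcot : pd i (fun y : Coord => Real.cos (y 2) / Real.sin (y 2)) x
      = ![0, 0, -(1 / Real.sin (x 2) ^ 2), 0] i := by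
    refine pd_of_two (Φ := fun _ θ => Real.cos θ / Real.sin θ) (hasDerivAt_const _ _) ?_ i
    refine ((Real.hasDerivAt_cos (x 2)).fun_div (Real.hasDerivAt_sin (x 2)) hs).congr_deriv ?_
    have := Real.sin_sq_add_cos_sq (x 2)
    field_simp
    linarith
  fin_cases μ <;> fin_cases ν <;> fin_cases ρ <;>
    simp only [warpedGamma, Fin.zero_eta, Fin.mk_one, Fin.reduceFinMk, ha2, hb2, hc2, hd2, he2,
      hds, hsc, hcot, pd_zero] <;> fin_cases i <;> rfl

end

-- The curvature of a warped metric has only the components `R^μ_{νμν} = -R^μ_{ννμ}`. The table is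
-- an algebraic identity in which `a`, …, `e` and their derivatives are independent numbers. Pairs
-- with `ρ < σ` suffice by antisymmetry.
set_option maxHeartbeats 4000000 in
lemma warped_table (a b c d e a' b' c' d' e' : ℝ) {θ : ℝ} (hs : Real.sin θ ≠ 0)
    {ρ σ : Fin 4} (h : ρ < σ) (μ ν : Fin 4) :
    warpedGammaDeriv d a' b' c' d' e' θ σ μ ν ρ - warpedGammaDeriv d a' b' c' d' e' θ ρ μ ν σ
      + ∑ α, (warpedGamma a b c d e θ μ σ α * warpedGamma a b c d e θ α ν ρ
        - warpedGamma a b c d e θ μ ρ α * warpedGamma a b c d e θ α ν σ)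
      = ((if μ = ρ ∧ ν = σ then 1 else 0) - if μ = σ ∧ ν = ρ then 1 else 0)
        * warpedQ a b c d e a' b' d' e' θ μ ν := by
  have t := Real.cos_sq_add_sin_sq θ
  rw [Fin.sum_univ_four]
  fin_cases ρ <;> fin_cases σ <;> first | exact absurd h (by decide) | skip
  all_goals
    fin_cases μ <;> fin_cases ν <;>
    dsimp only [warpedGamma, warpedGammaDeriv, warpedQ, Fin.zero_eta, Fin.mk_one,
      Fin.reduceFinMk] <;>
    simp only [Fin.reduceEq, and_self, and_false, false_and, if_true, if_false, mul_zero,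
      zero_mul, sub_zero, zero_sub, add_zero, zero_add, sub_self, one_mul, neg_mul] <;>
    try first | ring1 | (field_simp; grind)

section

variable {a b c d e : ℝ → ℝ} {a' b' c' d' e' : ℝ} {x : Coord}

lemma riemann_antisymm (g : Metric) (x : Coord) (μ ν ρ σ : Fin 4) :
    riemann g x μ ν σ ρ = -riemann g x μ ν ρ σ := by
  unfold riemann
  rw [neg_add, ← Finset.sum_neg_distrib]
  simp only [neg_sub]

lemma riemann_warped {g : Metric} (hg : ∀ᶠ y in 𝓝 x, ∀ μ ν ρ, christoffel g y μ ν ρ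
      = warpedGamma (a (y 1)) (b (y 1)) (c (y 1)) (d (y 1)) (e (y 1)) (y 2) μ ν ρ)
    (ha : HasDerivAt a a' (x 1)) (hb : HasDerivAt b b' (x 1))
    (hc : HasDerivAt c c' (x 1)) (hd : HasDerivAt d d' (x 1)) (he : HasDerivAt e e' (x 1))
    (hs : Real.sin (x 2) ≠ 0) (μ ν ρ σ : Fin 4) :
    riemann g x μ ν ρ σ = ((if μ = ρ ∧ ν = σ then 1 else 0) - if μ = σ ∧ ν = ρ then 1 else 0)
      * warpedQ (a (x 1)) (b (x 1)) (c (x 1)) (d (x 1)) (e (x 1)) a' b' d' e' (x 2) μ ν := by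
  have hpd : ∀ i μ ν ρ, pd i (fun y => christoffel g y μ ν ρ) x
      = warpedGammaDeriv (d (x 1)) a' b' c' d' e' (x 2) i μ ν ρ := fun i μ ν ρ => by
    rw [← pd_warpedGamma ha hb hc hd he hs]
    exact pd_congr (hg.mono fun y hy => hy μ ν ρ) i
  have hx := hg.self_of_nhds
  have key : ∀ ρ σ : Fin 4, ρ < σ → riemann g x μ ν ρ σ
      = ((if μ = ρ ∧ ν = σ then 1 else 0) - if μ = σ ∧ ν = ρ then 1 else 0)
      * warpedQ (a (x 1)) (b (x 1)) (c (x 1)) (d (x 1)) (e (x 1)) a' b' d' e' (x 2) μ ν := by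
    intro ρ σ h
    unfold riemann
    simp only [hpd, hx]
    exact warped_table _ _ _ _ _ _ _ _ _ _ hs h μ ν
  rcases lt_trichotomy ρ σ with h | h | h
  · exact key ρ σ h
  · subst h
    have := riemann_antisymm g x μ ν ρ ρ
    rw [sub_self, zero_mul]
    linarith
  · rw [riemann_antisymm, key σ ρ h]
    ring

end

/-! ### Metrics of constant curvature and the closed Einstein universe -/

lemma dot_diagonal {g : Metric} {x : Coord} {v : Fin 4 → ℝ} (hg : g x = Matrix.diagonal v)
    (hv : ∀ i, v i ≠ 0) (a b : Fin 4 → ℝ) : dot g x a b = ∑ i, a i * b i / v i := by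
  unfold dot
  rw [hg, inv_diagonal_of_ne_zero hv]
  refine Finset.sum_congr rfl fun μ _ => ?_
  rw [Finset.sum_eq_single μ]
  · rw [Matrix.diagonal_apply_eq]
    field_simp
  · intro ν _ h
    rw [Matrix.diagonal_apply_ne _ h.symm, zero_mul, zero_mul]
  · simp

lemma lower_diagonal {g : Metric} {x : Coord} {v : Fin 4 → ℝ} (hg : g x = Matrix.diagonal v)
    (w : Fin 4 → ℝ) (i : Fin 4) : lower g x w i = v i * w i := by
  unfold lower
  rw [hg, Finset.sum_eq_single i]
  · rw [Matrix.diagonal_apply_eq]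
  · intro ν _ h
    rw [Matrix.diagonal_apply_ne _ h.symm, zero_mul]
  · simp

lemma raise_diagonal {g : Metric} {x : Coord} {v : Fin 4 → ℝ} (hg : g x = Matrix.diagonal v)
    (hv : ∀ i, v i ≠ 0) (w : Fin 4 → ℝ) (i : Fin 4) : raise g x w i = w i / v i := by
  unfold raise
  rw [hg, inv_diagonal_of_ne_zero hv, Finset.sum_eq_single i]
  · rw [Matrix.diagonal_apply_eq]
    field_simp
  · intro ν _ h
    rw [Matrix.diagonal_apply_ne _ h.symm, zero_mul]
  · simp

section

variable {g : Metric} {x : Coord} {v : Fin 4 → ℝ} {q : Fin 4 → Fin 4 → ℝ}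

/-- With curvature supported on `R^μ_{νμν}` the Ricci tensor is diagonal; the term `q μ μ` is
removed because its two contributions cancel. -/
lemma ricci_of_riemann
    (hR : ∀ μ ν ρ σ, riemann g x μ ν ρ σ
      = ((if μ = ρ ∧ ν = σ then 1 else 0) - if μ = σ ∧ ν = ρ then 1 else 0) * q μ ν)
    (μ ν : Fin 4) : ricci g x μ ν = if μ = ν then (∑ α, q α μ) - q μ μ else 0 := by
  unfold ricci
  simp only [hR]
  by_cases h : μ = ν
  · subst h
    rw [if_pos rfl, eq_sub_iff_add_eq, ← Finset.sum_erase_add _ _ (Finset.mem_univ μ),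
      ← Finset.sum_erase_add Finset.univ (fun α => q α μ) (Finset.mem_univ μ)]
    simp only [and_self, sub_self, zero_mul, add_zero]
    congr 1
    refine Finset.sum_congr rfl fun α hα => ?_
    simp [Finset.ne_of_mem_erase hα]
  · rw [if_neg h]
    refine Finset.sum_eq_zero fun α _ => ?_
    have h1 : ¬(α = ν ∧ μ = α) := fun h2 => h (h2.2.trans h2.1)
    simp only [h, h1, and_false, if_false, sub_self, zero_mul]

lemma ricciApply_diagonal {r : Fin 4 → ℝ} (hg : g x = Matrix.diagonal v) (hv : ∀ i, v i ≠ 0)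
    (hr : ∀ μ ν, ricci g x μ ν = if μ = ν then r μ * v μ else 0) (w : Fin 4 → ℝ) (i : Fin 4) :
    ricciApply g x w i = r i * w i := by
  unfold ricciApply
  simp only [hr, raise_diagonal hg hv]
  rw [Finset.sum_eq_single i]
  · have := hv i
    rw [if_pos rfl]
    field_simp
  · intro ν _ h
    rw [if_neg h.symm, zero_mul]
  · simp

lemma scalarCurv_diagonal {r : Fin 4 → ℝ} (hg : g x = Matrix.diagonal v) (hv : ∀ i, v i ≠ 0)
    (hr : ∀ μ ν, ricci g x μ ν = if μ = ν then r μ * v μ else 0) :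
    scalarCurv g x = ∑ i, r i := by
  unfold scalarCurv
  rw [hg, inv_diagonal_of_ne_zero hv]
  refine Finset.sum_congr rfl fun i _ => ?_
  rw [Finset.sum_eq_single i]
  · have := hv i
    rw [Matrix.diagonal_apply_eq, hr, if_pos rfl]
    field_simp
  · intro ν _ h
    rw [Matrix.diagonal_apply_ne _ h.symm, zero_mul]
  · simp

lemma ricciDot_diagonal {r : Fin 4 → ℝ} (hg : g x = Matrix.diagonal v) (hv : ∀ i, v i ≠ 0)
    (hr : ∀ μ ν, ricci g x μ ν = if μ = ν then r μ * v μ else 0) (μ ν : Fin 4) :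
    dot g x (ricci g x μ) (ricci g x ν) = if μ = ν then r μ ^ 2 * v μ else 0 := by
  rw [dot_diagonal hg hv, Finset.sum_eq_single μ]
  · have := hv μ
    simp only [hr]
    by_cases h : μ = ν
    · subst h
      simp only [if_true]
      field_simp
    · simp [h, Ne.symm h]
  · intro i _ h
    rw [hr, if_neg h.symm, zero_mul, zero_div]
  · simp

lemma ricciSq_diagonal {r : Fin 4 → ℝ} (hg : g x = Matrix.diagonal v) (hv : ∀ i, v i ≠ 0)
    (hr : ∀ μ ν, ricci g x μ ν = if μ = ν then r μ * v μ else 0) :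
    ∑ α, dot g x (fun τ => ricci g x τ α) (fun τ => ∑ γ, (g x)⁻¹ α γ * ricci g x τ γ)
      = ∑ i, r i ^ 2 := by
  refine Finset.sum_congr rfl fun α _ => ?_
  have h1 : ∀ τ, ∑ γ, (g x)⁻¹ α γ * ricci g x τ γ = if τ = α then r α else 0 := by
    intro τ
    rw [hg, inv_diagonal_of_ne_zero hv, Finset.sum_eq_single α]
    · rw [Matrix.diagonal_apply_eq, hr]
      split_ifs with h
      · have := hv α
        subst h
        field_simp
      · simp
    · intro ν _ h
      rw [Matrix.diagonal_apply_ne _ h.symm, zero_mul]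
    · simp
  simp only [h1]
  rw [dot_diagonal hg hv, Finset.sum_eq_single α]
  · have := hv α
    rw [hr, if_pos rfl, if_pos rfl]
    field_simp
  · intro i _ h
    rw [if_neg h, mul_zero, zero_div]
  · simp

lemma lowered_riemann_diagonal (hg : g x = Matrix.diagonal v)
    (hR : ∀ μ ν ρ σ, riemann g x μ ν ρ σ
      = ((if μ = ρ ∧ ν = σ then 1 else 0) - if μ = σ ∧ ν = ρ then 1 else 0) * q μ ν)
    (μ ν ρ σ : Fin 4) : ∑ α, g x μ α * riemann g x α ν ρ σ
      = ((if μ = ρ then 1 else 0) * (if ν = σ then 1 else 0)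
        - (if μ = σ then 1 else 0) * if ν = ρ then 1 else 0) * (v μ * q μ ν) := by
  rw [hg, Finset.sum_eq_single μ]
  · rw [Matrix.diagonal_apply_eq, hR, ite_and, ite_and]
    simp only [ite_mul, one_mul, zero_mul]
    ring
  · intro ν _ h
    rw [Matrix.diagonal_apply_ne _ h.symm, zero_mul]
  · simp

/-- The Weyl tensor of a diagonal metric, at a point where `R^μ_{νμν} = K t_μ t_ν g_{νν}` and
`R_{μμ} = r_μ g_{μμ}`. -/
lemma weyl_diagonal {r t : Fin 4 → ℝ} {K : ℝ} (hg : g x = Matrix.diagonal v)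
    (hv : ∀ i, v i ≠ 0)
    (hR : ∀ μ ν ρ σ, riemann g x μ ν ρ σ
      = ((if μ = ρ ∧ ν = σ then 1 else 0) - if μ = σ ∧ ν = ρ then 1 else 0)
        * (K * t μ * t ν * v ν))
    (hr : ∀ μ ν, ricci g x μ ν = if μ = ν then r μ * v μ else 0)
    (ht : ∀ μ ν, μ ≠ ν → K * t μ * t ν - (r μ + r ν) / 2 + (∑ i, r i) / 6 = 0)
    (μ ν ρ σ : Fin 4) : weyl g x μ ν ρ σ = 0 := by
  have h2 : ∀ i j, g x i j = (if i = j then 1 else 0) * v i := fun i j => by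
    rw [hg, Matrix.diagonal_apply]; simp
  have h3 : ∀ i j, ricci g x i j = (if i = j then 1 else 0) * (r i * v i) := fun i j => by
    rw [hr]; simp
  unfold weyl
  rw [lowered_riemann_diagonal hg (q := fun μ ν => K * t μ * t ν * v ν) hR,
    scalarCurv_diagonal hg hv hr]
  simp only [h2, h3]
  by_cases h : μ = ν
  · subst h
    ring
  · linear_combination (((if μ = ρ then 1 else 0) * (if ν = σ then 1 else 0)
        - (if μ = σ then 1 else 0) * if ν = ρ then 1 else 0) * (v μ * v ν)) * ht μ ν h

end

/-- The static metric with `f = 1 + K r²` of constant curvature. -/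
def spaceForm (K : ℝ) : Metric :=
  warpedMetric (fun r => 1 + K * r ^ 2) (fun r => (1 + K * r ^ 2)⁻¹) fun r => r ^ 2

/-- AdS and dS are the two signs of `K` in a single family, so curvature and kinematics are computed
once. -/
lemma adsMetric_eq (κ : ℝ) : adsMetric κ = spaceForm (κ ^ 2) := rfl

lemma dsMetric_eq (κ : ℝ) : dsMetric κ = spaceForm (-κ ^ 2) := by
  unfold dsMetric spaceForm warpedMetric
  funext x
  simp only [neg_mul, ← sub_eq_add_neg]

lemma ceuMetric_eq (κ : ℝ) : ceuMetric κ
    = warpedMetric (fun _ => 1) (fun _ => 1 / κ ^ 2) fun r => 1 / κ ^ 2 * Real.sin r ^ 2 := rfl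

/-- The regular points of the chart of `spaceForm K`. -/
structure SpaceFormRegular (K : ℝ) (x : Coord) : Prop where
  f_pos : 0 < 1 + K * x 1 ^ 2
  r_pos : 0 < x 1
  sin_pos : 0 < Real.sin (x 2)

section

variable {K : ℝ} {x : Coord}

lemma SpaceFormRegular.eventually (h : SpaceFormRegular K x) :
    ∀ᶠ y in 𝓝 x, SpaceFormRegular K y := by
  have h1 : ∀ᶠ y : Coord in 𝓝 x, 0 < 1 + K * y 1 ^ 2 :=
    (by fun_prop : Continuous fun y : Coord => 1 + K * y 1 ^ 2).continuousAt.eventually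
      (lt_mem_nhds h.f_pos)
  have h2 : ∀ᶠ y : Coord in 𝓝 x, 0 < y 1 :=
    (by fun_prop : Continuous fun y : Coord => y 1).continuousAt.eventually (lt_mem_nhds h.r_pos)
  have h3 : ∀ᶠ y : Coord in 𝓝 x, 0 < Real.sin (y 2) :=
    (by fun_prop : Continuous fun y : Coord => Real.sin (y 2)).continuousAt.eventually
      (lt_mem_nhds h.sin_pos)
  filter_upwards [h1, h2, h3] with y a b c using ⟨a, b, c⟩

lemma hasDerivAt_spaceForm (K r : ℝ) : HasDerivAt (fun r => 1 + K * r ^ 2) (2 * K * r) r := by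
  refine (((hasDerivAt_id r).fun_pow 2).const_mul K).const_add 1 |>.congr_deriv ?_
  simp
  ring

lemma christoffel_spaceForm (h : SpaceFormRegular K x) (μ ν ρ : Fin 4) :
    christoffel (spaceForm K) x μ ν ρ
      = warpedGamma (K * x 1 / (1 + K * x 1 ^ 2)) (K * x 1 * (1 + K * x 1 ^ 2))
        (-(K * x 1 / (1 + K * x 1 ^ 2))) (-(x 1 * (1 + K * x 1 ^ 2))) (1 / x 1) (x 2) μ ν ρ := by
  have hf := h.f_pos.ne'
  have hr := h.r_pos.ne'
  have := christoffel_warped (x := x) (hasDerivAt_spaceForm K (x 1))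
    ((hasDerivAt_spaceForm K (x 1)).fun_inv hf) (hasDerivAt_pow 2 (x 1)) hf (inv_ne_zero hf)
    (pow_ne_zero 2 hr) h.sin_pos.ne' μ ν ρ
  unfold spaceForm
  rw [this]
  congr 1 <;> field_simp <;> push_cast <;> ring

/-- The diagonal components of `spaceForm K`. -/
def spaceFormDiag (K : ℝ) (x : Coord) : Fin 4 → ℝ :=
  ![1 + K * x 1 ^ 2, -(1 + K * x 1 ^ 2)⁻¹, -(x 1 ^ 2), -(x 1 ^ 2 * Real.sin (x 2) ^ 2)]

lemma spaceForm_apply (K : ℝ) (x : Coord) :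
    spaceForm K x = Matrix.diagonal (spaceFormDiag K x) := rfl

lemma SpaceFormRegular.diag_ne_zero (h : SpaceFormRegular K x) (i : Fin 4) :
    spaceFormDiag K x i ≠ 0 := by
  have hf := h.f_pos.ne'
  have hr := h.r_pos.ne'
  have hs := h.sin_pos.ne'
  fin_cases i
  · exact hf
  · exact neg_ne_zero.mpr (inv_ne_zero hf)
  · exact neg_ne_zero.mpr (pow_ne_zero 2 hr)
  · exact neg_ne_zero.mpr (mul_ne_zero (pow_ne_zero 2 hr) (pow_ne_zero 2 hs))

/-- The factors `1 * 1` give the shape `K t_μ t_ν g_{νν}` expected by `weyl_diagonal`, with `t = 1`.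
-/
lemma riemann_spaceForm (h : SpaceFormRegular K x) (μ ν ρ σ : Fin 4) :
    riemann (spaceForm K) x μ ν ρ σ
      = ((if μ = ρ ∧ ν = σ then 1 else 0) - if μ = σ ∧ ν = ρ then 1 else 0)
        * (-K * 1 * 1 * spaceFormDiag K x ν) := by
  have hf := h.f_pos.ne'
  have hr := h.r_pos.ne'
  have hs := h.sin_pos.ne'
  have d1 := hasDerivAt_spaceForm K (x 1)
  have d2 : HasDerivAt (fun r => K * r) K (x 1) := by
    simpa using (hasDerivAt_id (x 1)).const_mul K
  have := riemann_warped (x := x) (g := spaceForm K)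
    (a := fun r => K * r / (1 + K * r ^ 2)) (b := fun r => K * r * (1 + K * r ^ 2))
    (c := fun r => -(K * r / (1 + K * r ^ 2))) (d := fun r => -(r * (1 + K * r ^ 2)))
    (e := fun r => 1 / r)
    (h.eventually.mono fun y hy => christoffel_spaceForm hy)
    (d2.fun_div d1 hf) (d2.fun_mul d1) (d2.fun_div d1 hf).fun_neg
    ((hasDerivAt_id _).fun_mul d1).fun_neg
    ((hasDerivAt_const _ 1).fun_div (hasDerivAt_id (x 1)) hr) hs μ ν ρ σ
  rw [this]
  by_cases hμν : μ = ν
  · subst hμν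
    have : ((if μ = ρ ∧ μ = σ then (1 : ℝ) else 0) - if μ = σ ∧ μ = ρ then 1 else 0) = 0 := by
      simp only [and_comm (a := μ = ρ), sub_self]
    rw [this, zero_mul, zero_mul]
  · congr 1
    fin_cases μ <;> fin_cases ν <;> first | exact absurd rfl hμν | skip
    all_goals
      simp [warpedQ, spaceFormDiag]
      field_simp
      try ring

lemma ricci_spaceForm (h : SpaceFormRegular K x) (μ ν : Fin 4) :
    ricci (spaceForm K) x μ ν = if μ = ν then (-3 * K) * spaceFormDiag K x μ else 0 := by
  rw [ricci_of_riemann (riemann_spaceForm h)]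
  congr 1
  simp
  ring

lemma weyl_spaceForm (h : SpaceFormRegular K x) (μ ν ρ σ : Fin 4) :
    weyl (spaceForm K) x μ ν ρ σ = 0 := by
  refine weyl_diagonal (spaceForm_apply K x) h.diag_ne_zero (t := fun _ => 1) (r := fun _ => -3 * K)
    (riemann_spaceForm h) (ricci_spaceForm h) (fun μ ν _ => ?_) μ ν ρ σ
  simp
  ring

end

/-- The regular points of the chart of the closed Einstein universe. -/
structure CEURegular (x : Coord) : Prop where
  sin_pos' : 0 < Real.sin (x 1)
  sin_pos : 0 < Real.sin (x 2)

section

variable {κ : ℝ} {x : Coord}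

lemma CEURegular.eventually (h : CEURegular x) : ∀ᶠ y in 𝓝 x, CEURegular y := by
  have h2 : ∀ᶠ y : Coord in 𝓝 x, 0 < Real.sin (y 1) :=
    (by fun_prop : Continuous fun y : Coord => Real.sin (y 1)).continuousAt.eventually
      (lt_mem_nhds h.sin_pos')
  have h3 : ∀ᶠ y : Coord in 𝓝 x, 0 < Real.sin (y 2) :=
    (by fun_prop : Continuous fun y : Coord => Real.sin (y 2)).continuousAt.eventually
      (lt_mem_nhds h.sin_pos)
  filter_upwards [h2, h3] with y b c using ⟨b, c⟩

lemma christoffel_ceu (hκ : 0 < κ) (h : CEURegular x) (μ ν ρ : Fin 4) :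
    christoffel (ceuMetric κ) x μ ν ρ
      = warpedGamma 0 0 0 (-(Real.sin (x 1) * Real.cos (x 1))) (Real.cos (x 1) / Real.sin (x 1))
        (x 2) μ ν ρ := by
  have hr := h.sin_pos'.ne'
  have hm : HasDerivAt (fun r => 1 / κ ^ 2 * Real.sin r ^ 2)
      (1 / κ ^ 2 * (2 * Real.sin (x 1) * Real.cos (x 1))) (x 1) := by
    refine (((Real.hasDerivAt_sin (x 1)).fun_pow 2).const_mul _).congr_deriv ?_
    simp
  have := christoffel_warped (x := x) (hasDerivAt_const (x 1) 1)
    (hasDerivAt_const (x 1) (1 / κ ^ 2)) hm one_ne_zero (by positivity) (by positivity)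
    h.sin_pos.ne' μ ν ρ
  rw [ceuMetric_eq, this]
  congr 1
  · simp
  · simp
  · simp
  · field_simp
  · field_simp

/-- The diagonal components of the metric of the closed Einstein universe. -/
def ceuDiag (κ : ℝ) (x : Coord) : Fin 4 → ℝ :=
  ![1, -(1 / κ ^ 2), -(1 / κ ^ 2 * Real.sin (x 1) ^ 2),
    -(1 / κ ^ 2 * Real.sin (x 1) ^ 2 * Real.sin (x 2) ^ 2)]

lemma ceuMetric_apply (κ : ℝ) (x : Coord) :
    ceuMetric κ x = Matrix.diagonal (ceuDiag κ x) := rfl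

lemma CEURegular.diag_ne_zero (hκ : 0 < κ) (h : CEURegular x) (i : Fin 4) :
    ceuDiag κ x i ≠ 0 := by
  have h1 := h.sin_pos'
  have h2 := h.sin_pos
  fin_cases i
  · exact one_ne_zero
  · exact neg_ne_zero.mpr (by positivity)
  · exact neg_ne_zero.mpr (by positivity)
  · exact neg_ne_zero.mpr (by positivity)

/-- `1` for the spatial indices, `0` for the time index. -/
def spatial : Fin 4 → ℝ := ![0, 1, 1, 1]

lemma riemann_ceu (hκ : 0 < κ) (h : CEURegular x) (μ ν ρ σ : Fin 4) :
    riemann (ceuMetric κ) x μ ν ρ σ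
      = ((if μ = ρ ∧ ν = σ then 1 else 0) - if μ = σ ∧ ν = ρ then 1 else 0)
        * (κ ^ 2 * spatial μ * spatial ν * ceuDiag κ x ν) := by
  have hr := h.sin_pos'.ne'
  have hs := h.sin_pos.ne'
  have t := Real.sin_sq_add_cos_sq (x 1)
  have := riemann_warped (x := x) (g := ceuMetric κ)
    (a := fun _ => 0) (b := fun _ => 0) (c := fun _ => 0)
    (d := fun r => -(Real.sin r * Real.cos r)) (e := fun r => Real.cos r / Real.sin r)
    (h.eventually.mono fun y hy => christoffel_ceu hκ hy)
    (hasDerivAt_const _ _) (hasDerivAt_const _ _) (hasDerivAt_const _ _)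
    ((Real.hasDerivAt_sin (x 1)).fun_mul (Real.hasDerivAt_cos (x 1))).fun_neg
    ((Real.hasDerivAt_cos (x 1)).fun_div (Real.hasDerivAt_sin (x 1)) hr) hs μ ν ρ σ
  rw [this]
  by_cases hμν : μ = ν
  · subst hμν
    have : ((if μ = ρ ∧ μ = σ then (1 : ℝ) else 0) - if μ = σ ∧ μ = ρ then 1 else 0) = 0 := by
      simp only [and_comm (a := μ = ρ), sub_self]
    rw [this, zero_mul, zero_mul]
  · congr 1
    fin_cases μ <;> fin_cases ν <;> first | exact absurd rfl hμν | skip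
    all_goals
      simp [warpedQ, ceuDiag, spatial]
      try field_simp
      try grind

lemma ricci_ceu (hκ : 0 < κ) (h : CEURegular x) (μ ν : Fin 4) :
    ricci (ceuMetric κ) x μ ν = if μ = ν then (2 * κ ^ 2 * spatial μ) * ceuDiag κ x μ else 0 := by
  rw [ricci_of_riemann (riemann_ceu hκ h)]
  congr 1
  rw [Fin.sum_univ_four]
  fin_cases μ <;> simp [spatial] <;> ring

lemma weyl_ceu (hκ : 0 < κ) (h : CEURegular x) (μ ν ρ σ : Fin 4) :
    weyl (ceuMetric κ) x μ ν ρ σ = 0 := by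
  refine weyl_diagonal (ceuMetric_apply κ x) (h.diag_ne_zero hκ) (t := spatial)
    (r := fun μ => 2 * κ ^ 2 * spatial μ)
    (riemann_ceu hκ h) (ricci_ceu hκ h) (fun μ ν hμν => ?_) μ ν ρ σ
  rw [Fin.sum_univ_four]
  fin_cases μ <;> fin_cases ν <;> first | exact absurd rfl hμν | skip
  all_goals
    simp [spatial]
    try ring

end

/-! ### Rescaling of the four-temperature -/

/-- For each first index only the six permutations of the other three survive, so vorticity and `l`
reduce to short sums. -/
lemma sum_levi (F : Fin 4 → Fin 4 → Fin 4 → ℝ) (μ : Fin 4) :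
    ∑ ν, ∑ ρ, ∑ σ, (levi μ ν ρ σ : ℝ) * F ν ρ σ
      = ![F 1 2 3 - F 1 3 2 + F 2 3 1 - F 2 1 3 + F 3 1 2 - F 3 2 1,
          -(F 0 2 3 - F 0 3 2 + F 2 3 0 - F 2 0 3 + F 3 0 2 - F 3 2 0),
          F 0 1 3 - F 0 3 1 + F 1 3 0 - F 1 0 3 + F 3 0 1 - F 3 1 0,
          -(F 0 1 2 - F 0 2 1 + F 1 2 0 - F 1 0 2 + F 2 0 1 - F 2 1 0)] μ := by
  have h2 : Int.sign 2 = 1 := rfl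
  have h3 : Int.sign 3 = 1 := rfl
  fin_cases μ <;> simp [Fin.sum_univ_four, levi, h2, h3] <;> ring

section

variable {g : Metric} {β β' : VField} {x : Coord} {T0 : ℝ}

lemma betaSq_div (hβ : ∀ y μ, β' y μ = β y μ / T0) (y : Coord) :
    betaSq g β' y = betaSq g β y / T0 ^ 2 := by
  unfold betaSq
  simp only [hβ, Finset.sum_div]
  refine Finset.sum_congr rfl fun _ _ => Finset.sum_congr rfl fun _ _ => ?_
  rw [pow_two, ← div_div]
  ring

lemma sqrt_betaSq_div (hT : 0 < T0) (hβ : ∀ y μ, β' y μ = β y μ / T0) (y : Coord) :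
    Real.sqrt (betaSq g β' y) = Real.sqrt (betaSq g β y) / T0 := by
  rw [betaSq_div hβ, Real.sqrt_div' _ (sq_nonneg T0), Real.sqrt_sq hT.le]

lemma temp_div (hT : 0 < T0) (hβ : ∀ y μ, β' y μ = β y μ / T0) (y : Coord) :
    temp g β' y = T0 * temp g β y := by
  unfold temp
  rw [sqrt_betaSq_div hT hβ, one_div_div, mul_one_div]

lemma velUp_div (hT : 0 < T0) (hβ : ∀ y μ, β' y μ = β y μ / T0) : velUp g β' = velUp g β := by
  funext y μ
  unfold velUp
  rw [sqrt_betaSq_div hT hβ, hβ, div_div_div_cancel_right₀ hT.ne']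

lemma vel_congr (h : velUp g β' = velUp g β) : vel g β' = vel g β := by
  unfold vel; rw [h]

lemma gradVel_congr (h : velUp g β' = velUp g β) : gradVel g β' = gradVel g β := by
  unfold gradVel; rw [vel_congr h]

lemma acc_congr (h : velUp g β' = velUp g β) : acc g β' = acc g β := by
  unfold acc; rw [h, gradVel_congr h]

lemma vort_congr (h : velUp g β' = velUp g β) : vort g β' = vort g β := by
  unfold vort gradVelUp; rw [h, gradVel_congr h]

lemma lvec_congr (h : velUp g β' = velUp g β) : lvec g β' = lvec g β := by
  unfold lvec lvecUp; rw [vort_congr h, acc_congr h, vel_congr h]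

lemma proj_congr (h : velUp g β' = velUp g β) : proj g β' = proj g β := by
  unfold proj; rw [vel_congr h]

/-- Rescaling `β` leaves `u`, hence `A`, `ω`, `l`, unchanged and multiplies `T` by `T₀`. All later
computations may take `T₀ = 1`. -/
lemma secondOrder_div (hT : 0 < T0) (hβ : ∀ y μ, β' y μ = β y μ / T0) (k : SecondCoeffs)
    (μ ν : Fin 4) : secondOrder k g β' x μ ν = T0 ^ 2 * secondOrder k g β x μ ν := by
  have h := velUp_div (g := g) hT hβ
  unfold secondOrder accSq vortSq ricciUU ricciVel weylUU
  rw [temp_div hT hβ, proj_congr h, lvec_congr h, vort_congr h, acc_congr h, vel_congr h, h]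
  ring

lemma fourthOrder_div (hT : 0 < T0) (hβ : ∀ y μ, β' y μ = β y μ / T0) (k : FourthCoeffs)
    (μ ν : Fin 4) : fourthOrder k g β' x μ ν = fourthOrder k g β x μ ν := by
  have h := velUp_div (g := g) hT hβ
  unfold fourthOrder accSq vortSq accVort ricciUU ricciVel
  rw [proj_congr h, lvec_congr h, vort_congr h, acc_congr h, vel_congr h]

end

lemma staticKilling_div (T0 : ℝ) (y : Coord) (μ : Fin 4) :
    staticKilling T0 y μ = staticKilling 1 y μ / T0 := by
  fin_cases μ <;> simp [staticKilling]

lemma ceuKilling_div (κ w T0 : ℝ) (y : Coord) (μ : Fin 4) :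
    ceuKilling κ w T0 y μ = ceuKilling κ w 1 y μ / T0 := by
  fin_cases μ <;> simp [ceuKilling]

lemma ceuKilling_zero (κ T0 : ℝ) : ceuKilling κ 0 T0 = staticKilling T0 := by
  unfold ceuKilling staticKilling
  simp

lemma minkKilling_div (b : Fin 4 → ℝ) (ϖ : Matrix (Fin 4) (Fin 4) ℝ) (T0 : ℝ) (y : Coord)
    (μ : Fin 4) : minkKilling b ϖ T0 y μ = minkKilling b ϖ 1 y μ / T0 := by
  simp only [minkKilling, raise, div_one, Finset.sum_div, mul_div_assoc]

lemma betaSq_diagonal {g : Metric} {x : Coord} {v : Fin 4 → ℝ} (hg : g x = Matrix.diagonal v)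
    (β : VField) : betaSq g β x = ∑ i, v i * β x i ^ 2 := by
  unfold betaSq
  refine Finset.sum_congr rfl fun μ _ => ?_
  rw [hg, Finset.sum_eq_single μ]
  · rw [Matrix.diagonal_apply_eq]; ring
  · intro ν _ h
    rw [Matrix.diagonal_apply_ne _ h.symm, zero_mul, zero_mul]
  · simp

lemma gradVelUp_diagonal {g : Metric} {x : Coord} {v : Fin 4 → ℝ} (hg : g x = Matrix.diagonal v)
    (hv : ∀ i, v i ≠ 0) (β : VField) (ρ σ : Fin 4) :
    gradVelUp g β x ρ σ = gradVel g β x ρ σ / (v ρ * v σ) := by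
  unfold gradVelUp
  rw [hg, inv_diagonal_of_ne_zero hv, Finset.sum_eq_single ρ, Finset.sum_eq_single σ]
  · have h1 := hv ρ
    have h2 := hv σ
    simp only [Matrix.diagonal_apply_eq]
    field_simp
  · intro ν _ h
    rw [Matrix.diagonal_apply_ne _ h.symm, mul_zero, zero_mul]
  · simp
  · intro ν _ h
    simp only [Matrix.diagonal_apply_ne _ h.symm, zero_mul, Finset.sum_const_zero]
  · simp

lemma vort_eq_sum (g : Metric) (β : VField) (x : Coord) (μ : Fin 4) :
    vort g β x μ = -(Real.sqrt (-(g x).det) / 2)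
      * ∑ ν, ∑ ρ, ∑ σ, (levi μ ν ρ σ : ℝ) * (velUp g β x ν * gradVelUp g β x ρ σ) := by
  unfold vort leviDown
  simp only [Finset.mul_sum]
  refine Finset.sum_congr rfl fun _ _ => Finset.sum_congr rfl fun _ _ =>
    Finset.sum_congr rfl fun _ _ => ?_
  ring

lemma lvecUp_eq_sum (g : Metric) (β : VField) (x : Coord) (μ : Fin 4) :
    lvecUp g β x μ = (1 / Real.sqrt (-(g x).det))
      * ∑ ν, ∑ ρ, ∑ σ, (levi μ ν ρ σ : ℝ) * (vort g β x ν * acc g β x ρ * vel g β x σ) := by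
  unfold lvecUp leviUp
  simp only [Finset.mul_sum]
  refine Finset.sum_congr rfl fun _ _ => Finset.sum_congr rfl fun _ _ =>
    Finset.sum_congr rfl fun _ _ => ?_
  ring

/-! ### The static observers of `spaceForm K` -/

section

variable {K : ℝ} {x : Coord}

lemma betaSq_spaceForm (K : ℝ) (x : Coord) :
    betaSq (spaceForm K) (staticKilling 1) x = 1 + K * x 1 ^ 2 := by
  rw [betaSq_diagonal (spaceForm_apply K x), Fin.sum_univ_four]
  simp [staticKilling, spaceFormDiag]

lemma temp_spaceForm (h : SpaceFormRegular K x) :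
    temp (spaceForm K) (staticKilling 1) x ^ 2 = 1 / (1 + K * x 1 ^ 2) := by
  unfold temp
  rw [betaSq_spaceForm, div_pow, one_pow, Real.sq_sqrt h.f_pos.le]

lemma velUp_spaceForm (K : ℝ) (x : Coord) :
    velUp (spaceForm K) (staticKilling 1) x = ![1 / Real.sqrt (1 + K * x 1 ^ 2), 0, 0, 0] := by
  funext μ
  unfold velUp
  rw [betaSq_spaceForm]
  fin_cases μ <;> simp [staticKilling]

lemma vel_spaceForm (h : SpaceFormRegular K x) :
    vel (spaceForm K) (staticKilling 1) x = ![Real.sqrt (1 + K * x 1 ^ 2), 0, 0, 0] := by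
  funext μ
  unfold vel
  rw [lower_diagonal (spaceForm_apply K x), velUp_spaceForm]
  fin_cases μ
  · have := Real.sqrt_pos.mpr h.f_pos
    have h2 := Real.sq_sqrt h.f_pos.le
    simp only [spaceFormDiag, Fin.zero_eta, Matrix.cons_val_zero]
    field_simp
    linarith
  all_goals simp

/-- Only `u_t` is nonzero. Its radial derivative cancels against `Γ^t_{rt} u_t`, while `Γ^t_{tr}
u_t` has nothing to cancel it. -/
lemma gradVel_spaceForm (h : SpaceFormRegular K x) (ν μ : Fin 4) :
    gradVel (spaceForm K) (staticKilling 1) x ν μ = if ν = 0 ∧ μ = 1 then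
      -(K * x 1 / Real.sqrt (1 + K * x 1 ^ 2)) else 0 := by
  have hf := Real.sqrt_pos.mpr h.f_pos
  have h2 := Real.sq_sqrt h.f_pos.le
  have h1 : ∀ i, pd i (fun y => vel (spaceForm K) (staticKilling 1) y 0) x
      = ![0, K * x 1 / Real.sqrt (1 + K * x 1 ^ 2), 0, 0] i := fun i => by
    rw [pd_congr (G := fun y => Real.sqrt (1 + K * y 1 ^ 2))
      (h.eventually.mono fun y hy => by rw [vel_spaceForm hy]; rfl)]
    refine pd_of_two (Φ := fun r _ => Real.sqrt (1 + K * r ^ 2)) ?_ (hasDerivAt_const _ _) i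
    refine ((hasDerivAt_spaceForm K (x 1)).sqrt h.f_pos.ne').congr_deriv ?_
    field_simp
  have h3 : ∀ i j, j ≠ 0 → pd i (fun y => vel (spaceForm K) (staticKilling 1) y j) x = 0 :=
    fun i j hj => by
      rw [pd_congr (G := fun _ => 0) (h.eventually.mono fun y hy => ?_), pd_zero]
      rw [vel_spaceForm hy]
      fin_cases j
      · exact absurd rfl hj
      all_goals rfl
  have hp := h.f_pos.ne'
  have key : K * x 1 / (1 + K * x 1 ^ 2) * Real.sqrt (1 + K * x 1 ^ 2)
      = K * x 1 / Real.sqrt (1 + K * x 1 ^ 2) := by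
    rw [div_mul_eq_mul_div, div_eq_div_iff hp hf.ne', mul_assoc, ← pow_two, h2]
  unfold gradVel
  rw [Finset.sum_eq_single (0 : Fin 4)]
  · simp only [christoffel_spaceForm h, vel_spaceForm h, Matrix.cons_val_zero]
    rw [← key]
    fin_cases ν <;> fin_cases μ <;> simp [h1, h3, warpedGamma, key]
  · intro i _ hi
    rw [vel_spaceForm h]
    fin_cases i
    · exact absurd rfl hi
    all_goals simp
  · simp

lemma acc_spaceForm (h : SpaceFormRegular K x) :
    acc (spaceForm K) (staticKilling 1) x = ![0, -(K * x 1 / (1 + K * x 1 ^ 2)), 0, 0] := by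
  have hf := Real.sqrt_pos.mpr h.f_pos
  have h2 := Real.sq_sqrt h.f_pos.le
  have hp := h.f_pos.ne'
  funext μ
  unfold acc
  rw [Fin.sum_univ_four]
  simp only [velUp_spaceForm, gradVel_spaceForm h]
  fin_cases μ <;> simp
  rw [← div_eq_inv_mul, div_div, ← pow_two, h2]

/-- The only nonzero gradient component carries a time index, and so does `u`; antisymmetrization
kills the product. -/
lemma vort_spaceForm (h : SpaceFormRegular K x) :
    vort (spaceForm K) (staticKilling 1) x = 0 := by
  funext μ
  rw [vort_eq_sum, sum_levi]
  simp only [velUp_spaceForm, gradVelUp_diagonal (spaceForm_apply K x) h.diag_ne_zero,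
    gradVel_spaceForm h]
  fin_cases μ <;> simp

lemma lvec_spaceForm (h : SpaceFormRegular K x) :
    lvec (spaceForm K) (staticKilling 1) x = 0 := by
  funext μ
  unfold lvec
  rw [lower_diagonal (spaceForm_apply K x), lvecUp_eq_sum, vort_spaceForm h]
  simp

end

/-! ### The rotating observers of the closed Einstein universe -/

/-- `1 - S w²`. -/
def ceuLapse (w : ℝ) (x : Coord) : ℝ := 1 - ceuS x * w ^ 2

section

variable {κ w : ℝ} {x : Coord}

lemma CEURegular.ceuS_pos (h : CEURegular x) : 0 < ceuS x := by
  have h1 := h.sin_pos'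
  have h2 := h.sin_pos
  unfold ceuS
  positivity

lemma ceuS_le_one (x : Coord) : ceuS x ≤ 1 := by
  unfold ceuS
  exact mul_le_one₀ (Real.sin_sq_le_one _) (sq_nonneg _) (Real.sin_sq_le_one _)

lemma ceuLapse_pos (hw : 0 ≤ w) (hw1 : w < 1) (x : Coord) : 0 < ceuLapse w x := by
  have h1 := ceuS_le_one x
  have h2 : w ^ 2 < 1 := by nlinarith
  unfold ceuLapse
  nlinarith [sq_nonneg w]

lemma betaSq_ceu (hκ : 0 < κ) (w : ℝ) (x : Coord) :
    betaSq (ceuMetric κ) (ceuKilling κ w 1) x = ceuLapse w x := by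
  rw [betaSq_diagonal (ceuMetric_apply κ x), Fin.sum_univ_four]
  simp [ceuKilling, ceuDiag, ceuLapse, ceuS]
  field_simp
  ring

lemma temp_ceu (hκ : 0 < κ) (hw : 0 ≤ w) (hw1 : w < 1) :
    temp (ceuMetric κ) (ceuKilling κ w 1) x ^ 2 = 1 / ceuLapse w x := by
  unfold temp
  rw [betaSq_ceu hκ, div_pow, one_pow, Real.sq_sqrt (ceuLapse_pos hw hw1 x).le]

/-- The Lorentz factor `γ = 1 / √(1 - S w²)`. -/
def ceuGamma (w : ℝ) (x : Coord) : ℝ := 1 / Real.sqrt (ceuLapse w x)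

lemma ceuGamma_sq (hw : 0 ≤ w) (hw1 : w < 1) (x : Coord) :
    ceuGamma w x ^ 2 * ceuLapse w x = 1 := by
  have := ceuLapse_pos hw hw1 x
  unfold ceuGamma
  rw [div_pow, one_pow, Real.sq_sqrt this.le, one_div_mul_cancel this.ne']

lemma velUp_ceu (hκ : 0 < κ) (w : ℝ) (x : Coord) :
    velUp (ceuMetric κ) (ceuKilling κ w 1) x = ![ceuGamma w x, 0, 0, κ * w * ceuGamma w x] := by
  funext μ
  unfold velUp ceuGamma
  rw [betaSq_ceu hκ]
  fin_cases μ <;> simp [ceuKilling, div_eq_mul_inv]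

lemma vel_ceu (hκ : 0 < κ) (w : ℝ) (x : Coord) :
    vel (ceuMetric κ) (ceuKilling κ w 1) x
      = ![ceuGamma w x, 0, 0, -(w / κ * (ceuS x * ceuGamma w x))] := by
  funext μ
  unfold vel
  rw [lower_diagonal (ceuMetric_apply κ x), velUp_ceu hκ]
  fin_cases μ
  · simp [ceuDiag]
  · simp
  · simp
  · simp [ceuDiag, ceuS]
    field_simp

lemma pd_ceuS (x : Coord) (i : Fin 4) : pd i ceuS x
    = 2 * ![0, Real.sin (x 1) * Real.cos (x 1) * Real.sin (x 2) ^ 2,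
      Real.sin (x 1) ^ 2 * (Real.sin (x 2) * Real.cos (x 2)), 0] i := by
  have := pd_of_two (Φ := fun a b => Real.sin a ^ 2 * Real.sin b ^ 2) (x := x)
    (((Real.hasDerivAt_sin (x 1)).fun_pow 2).mul_const _)
    (((Real.hasDerivAt_sin (x 2)).fun_pow 2).const_mul _) i
  unfold ceuS
  rw [this]
  fin_cases i <;> simp <;> ring

/-- The rotating velocity depends on the position only through `S`, so this chain rule yields all
its derivatives. -/
lemma pd_comp {F : ℝ → ℝ} {F' : ℝ} {G : Coord → ℝ} {i : Fin 4} (hF : HasDerivAt F F' (G x))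
    (hG : DifferentiableAt ℝ G x) : pd i (fun y => F (G y)) x = F' * pd i G x := by
  unfold pd
  have hu : HasDerivAt (fun s : ℝ => Function.update x i s) (Pi.single i 1) (x i) :=
    hasDerivAt_update x i (x i)
  have hG' : DifferentiableAt ℝ (fun s : ℝ => G (Function.update x i s)) (x i) := by
    refine DifferentiableAt.comp (x i) ?_ hu.differentiableAt
    rwa [Function.update_eq_self]
  have h1 := hG'.hasDerivAt
  have h2 : HasDerivAt F F' ((fun s : ℝ => G (Function.update x i s)) (x i)) := by
    simpa using hF
  exact (h2.comp (x i) h1).deriv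

lemma hasDerivAt_gamma {S : ℝ} (h : 0 < 1 - S * w ^ 2) :
    HasDerivAt (fun S => 1 / Real.sqrt (1 - S * w ^ 2))
      ((1 / Real.sqrt (1 - S * w ^ 2)) ^ 3 * w ^ 2 / 2) S := by
  have h0 := Real.sqrt_pos.mpr h
  have h1 : HasDerivAt (fun S => 1 - S * w ^ 2) (-w ^ 2) S := by
    simpa using ((hasDerivAt_id S).mul_const (w ^ 2)).const_sub 1
  refine ((hasDerivAt_const S 1).fun_div (h1.sqrt h.ne') h0.ne').congr_deriv ?_
  field_simp
  ring

lemma differentiable_ceuS : Differentiable ℝ ceuS := by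
  unfold ceuS
  fun_prop

lemma pd_ceuGamma (hw : 0 ≤ w) (hw1 : w < 1) (i : Fin 4) :
    pd i (ceuGamma w) x = ceuGamma w x ^ 3 * w ^ 2 / 2 * pd i ceuS x :=
  pd_comp (hasDerivAt_gamma (ceuLapse_pos hw hw1 x)) (differentiable_ceuS x)

lemma pd_vel_ceu_three (hκ : 0 < κ) (hw : 0 ≤ w) (hw1 : w < 1) (i : Fin 4) :
    pd i (fun y => vel (ceuMetric κ) (ceuKilling κ w 1) y 3) x
      = -(w / κ * (ceuGamma w x + ceuS x * (ceuGamma w x ^ 3 * w ^ 2 / 2))) * pd i ceuS x := by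
  have h1 : (fun y => vel (ceuMetric κ) (ceuKilling κ w 1) y 3)
      = fun y => -(w / κ * (ceuS y * (1 / Real.sqrt (1 - ceuS y * w ^ 2)))) := by
    funext y
    rw [vel_ceu hκ]
    rfl
  rw [h1]
  refine pd_comp (F := fun S => -(w / κ * (S * (1 / Real.sqrt (1 - S * w ^ 2))))) ?_
    (differentiable_ceuS x)
  refine (((hasDerivAt_id _).fun_mul
    (hasDerivAt_gamma (ceuLapse_pos hw hw1 x))).const_mul (w / κ)).fun_neg.congr_deriv ?_
  simp only [ceuGamma, ceuLapse, id]
  ring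

/-- `∇_ν u_μ` of the rotating observers, with `S₁ = ∂_χ S / 2` and `S₂ = ∂_θ S / 2`. -/
def ceuGradVel (κ w γ S₁ S₂ : ℝ) : Fin 4 → Fin 4 → ℝ :=
  ![![0, 0, 0, 0], ![γ ^ 3 * w ^ 2 * S₁, 0, 0, -(w / κ * (γ ^ 3 * S₁))],
    ![γ ^ 3 * w ^ 2 * S₂, 0, 0, -(w / κ * (γ ^ 3 * S₂))],
    ![0, w / κ * (γ * S₁), w / κ * (γ * S₂), 0]]

/-- The components simplify through the relation `γ² (1 - S w²) = 1`; `γ` is generalized so that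
only this relation is used. -/
lemma gradVel_ceu (hκ : 0 < κ) (hw : 0 ≤ w) (hw1 : w < 1) (h : CEURegular x) (ν μ : Fin 4) :
    gradVel (ceuMetric κ) (ceuKilling κ w 1) x ν μ
      = ceuGradVel κ w (ceuGamma w x) (Real.sin (x 1) * Real.cos (x 1) * Real.sin (x 2) ^ 2)
        (Real.sin (x 1) ^ 2 * (Real.sin (x 2) * Real.cos (x 2))) ν μ := by
  have h0 : ∀ i, pd i (fun y => vel (ceuMetric κ) (ceuKilling κ w 1) y 0) x
      = ceuGamma w x ^ 3 * w ^ 2 / 2 * pd i ceuS x := fun i => by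
    rw [← pd_ceuGamma hw hw1]
    congr 1
    funext y
    rw [vel_ceu hκ]
    rfl
  have h1 : ∀ i, pd i (fun y => vel (ceuMetric κ) (ceuKilling κ w 1) y 1) x = 0 := fun i => by
    simp only [vel_ceu hκ]
    exact pd_zero i x
  have h2 : ∀ i, pd i (fun y => vel (ceuMetric κ) (ceuKilling κ w 1) y 2) x = 0 := fun i => by
    simp only [vel_ceu hκ]
    exact pd_zero i x
  have h3 := fun i => pd_vel_ceu_three (x := x) hκ hw hw1 i
  have hr := h.sin_pos'.ne'
  have hs := h.sin_pos.ne'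
  have hγ := ceuGamma_sq hw hw1 x
  have hS : ceuS x = Real.sin (x 1) ^ 2 * Real.sin (x 2) ^ 2 := rfl
  unfold ceuLapse at hγ
  unfold gradVel
  rw [Fin.sum_univ_four]
  have hv := vel_ceu hκ w x
  simp only [christoffel_ceu hκ h, hv]
  generalize ceuGamma w x = γ at *
  fin_cases ν <;> fin_cases μ <;>
    simp [h0, h1, h2, h3, warpedGamma, ceuGradVel, pd_ceuS] <;> field_simp <;> grind

end

section

variable {κ w : ℝ} {x : Coord}

lemma acc_ceu (hκ : 0 < κ) (hw : 0 ≤ w) (hw1 : w < 1) (h : CEURegular x) :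
    acc (ceuMetric κ) (ceuKilling κ w 1) x = ![0, ceuGamma w x ^ 2 * w ^ 2
        * (Real.sin (x 1) * Real.cos (x 1) * Real.sin (x 2) ^ 2),
      ceuGamma w x ^ 2 * w ^ 2 * (Real.sin (x 1) ^ 2 * (Real.sin (x 2) * Real.cos (x 2))), 0] := by
  funext μ
  unfold acc
  rw [Fin.sum_univ_four]
  simp only [velUp_ceu hκ, gradVel_ceu hκ hw hw1 h]
  fin_cases μ <;> simp [ceuGradVel] <;> field_simp

lemma sqrt_det_ceu (hκ : 0 < κ) (h : CEURegular x) : Real.sqrt (-(ceuMetric κ x).det)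
    = Real.sin (x 1) ^ 2 * Real.sin (x 2) / κ ^ 3 := by
  have h1 := h.sin_pos'
  have h2 := h.sin_pos
  have : -(ceuMetric κ x).det = (Real.sin (x 1) ^ 2 * Real.sin (x 2) / κ ^ 3) ^ 2 := by
    rw [ceuMetric_apply, Matrix.det_diagonal, Fin.prod_univ_four]
    simp [ceuDiag]
    field_simp
  rw [this, Real.sqrt_sq (by positivity)]

lemma vort_ceu (hκ : 0 < κ) (hw : 0 ≤ w) (hw1 : w < 1) (h : CEURegular x) :
    vort (ceuMetric κ) (ceuKilling κ w 1) x = ![0, -(ceuGamma w x ^ 2 * w * Real.cos (x 2)),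
      ceuGamma w x ^ 2 * w * (Real.sin (x 1) * Real.cos (x 1) * Real.sin (x 2)), 0] := by
  have h1 := h.sin_pos'.ne'
  have h2 := h.sin_pos.ne'
  have hγ := ceuGamma_sq hw hw1 x
  have hS : ceuS x = Real.sin (x 1) ^ 2 * Real.sin (x 2) ^ 2 := rfl
  unfold ceuLapse at hγ
  funext μ
  rw [vort_eq_sum, sum_levi, sqrt_det_ceu hκ h]
  simp only [velUp_ceu hκ, gradVelUp_diagonal (ceuMetric_apply κ x) (h.diag_ne_zero hκ),
    gradVel_ceu hκ hw hw1 h]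
  generalize ceuGamma w x = γ at *
  fin_cases μ <;> simp [ceuGradVel, ceuDiag]
  all_goals
    field_simp
    try grind

/-- The product `S (1 - S)` arises because `A` and `ω` are orthogonal in the `(χ, θ)` plane with
squares proportional to `S (1 - S)` and `1 - S`. The lower component `l_φ` is negative, so `l^φ`
points along the rotation. -/
lemma lvec_ceu (hκ : 0 < κ) (hw : 0 ≤ w) (hw1 : w < 1) (h : CEURegular x) :
    lvec (ceuMetric κ) (ceuKilling κ w 1) x
      = ![κ ^ 2 * ceuGamma w x ^ 5 * w ^ 4 * (ceuS x * (1 - ceuS x)), 0, 0,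
        -(κ * ceuGamma w x ^ 5 * w ^ 3 * (ceuS x * (1 - ceuS x)))] := by
  have h1 := h.sin_pos'.ne'
  have h2 := h.sin_pos.ne'
  have hS : ceuS x = Real.sin (x 1) ^ 2 * Real.sin (x 2) ^ 2 := rfl
  have t1 := Real.cos_sq' (x 1)
  have t2 := Real.cos_sq' (x 2)
  funext μ
  unfold lvec
  rw [lower_diagonal (ceuMetric_apply κ x), lvecUp_eq_sum, sum_levi, sqrt_det_ceu hκ h]
  simp only [vel_ceu hκ, vort_ceu hκ hw hw1 h, acc_ceu hκ hw hw1 h]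
  generalize ceuGamma w x = γ at *
  fin_cases μ <;> simp [ceuDiag]
  all_goals
    field_simp
    try grind

end

/-! ### Expansion of the general forms in an adapted frame -/

section

variable {g : Metric} {β : VField} {x : Coord}

lemma dot_add_left (v v' w : Fin 4 → ℝ) :
    dot g x (v + v') w = dot g x v w + dot g x v' w := by
  unfold dot
  simp only [← Finset.sum_add_distrib, Pi.add_apply]
  exact Finset.sum_congr rfl fun _ _ => Finset.sum_congr rfl fun _ _ => by ring

lemma dot_smul_left (c : ℝ) (v w : Fin 4 → ℝ) : dot g x (c • v) w = c * dot g x v w := by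
  unfold dot
  simp only [Finset.mul_sum, Pi.smul_apply, smul_eq_mul]
  exact Finset.sum_congr rfl fun _ _ => Finset.sum_congr rfl fun _ _ => by ring

lemma dot_add_right (v w w' : Fin 4 → ℝ) :
    dot g x v (w + w') = dot g x v w + dot g x v w' := by
  unfold dot
  simp only [← Finset.sum_add_distrib, Pi.add_apply]
  exact Finset.sum_congr rfl fun _ _ => Finset.sum_congr rfl fun _ _ => by ring

lemma dot_smul_right (c : ℝ) (v w : Fin 4 → ℝ) : dot g x v (c • w) = c * dot g x v w := by
  unfold dot
  simp only [Finset.mul_sum, Pi.smul_apply, smul_eq_mul]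
  exact Finset.sum_congr rfl fun _ _ => Finset.sum_congr rfl fun _ _ => by ring

lemma dot_zero_left (w : Fin 4 → ℝ) : dot g x 0 w = 0 := by simp [dot]

lemma dot_zero_right (w : Fin 4 → ℝ) : dot g x w 0 = 0 := by simp [dot]

lemma ricciApply_zero : ricciApply g x 0 = 0 := by
  funext i
  simp [ricciApply, raise]

/-- A static observer in a space-time with `R_{μν} = a Δ_{μν} + r u_μ u_ν`. -/
structure StaticFrame (g : Metric) (β : VField) (x : Coord) (a r α : ℝ) : Prop where
  vort_eq : vort g β x = 0
  lvec_eq : lvec g β x = 0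
  vel_vel : dot g x (vel g β x) (vel g β x) = 1
  acc_acc : dot g x (acc g β x) (acc g β x) = α
  ricci_eq : ∀ μ ν, ricci g x μ ν = a * proj g β x μ ν + r * (vel g β x μ * vel g β x ν)
  scalar_eq : scalarCurv g x = 3 * a + r
  ricciVel_eq : ricciVel g β x = r • vel g β x
  ricciAcc_eq : ricciApply g x (acc g β x) = a • acc g β x
  ricciSq_eq : ∑ α, dot g x (fun τ => ricci g x τ α) (fun τ => ∑ γ, (g x)⁻¹ α γ * ricci g x τ γ)
    = 3 * a ^ 2 + r ^ 2
  ricciDot_eq : ∀ μ ν, dot g x (ricci g x μ) (ricci g x ν)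
    = a ^ 2 * proj g β x μ ν + r ^ 2 * (vel g β x μ * vel g β x ν)
  weyl_eq : ∀ μ ν, weylUU g β x μ ν = 0

variable {a r α : ℝ}

lemma StaticFrame.ricciUU_eq (h : StaticFrame g β x a r α) : ricciUU g β x = r := by
  rw [ricciUU, h.ricciVel_eq, dot_smul_left, h.vel_vel, mul_one]

/-- Without rotation every curvature term is absorbed into `u u` and `Δ`, so static states see only
a few combinations of the coefficients. -/
lemma StaticFrame.secondOrder_eq (h : StaticFrame g β x a r α) (k : SecondCoeffs) (μ ν : Fin 4) :
    secondOrder k g β x μ ν = temp g β x ^ 2 *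
      ((k.b1 * α + k.b3 * (3 * a + r) + k.b4 * r + k.d4 * r + 2 * k.d5 * r)
          * (vel g β x μ * vel g β x ν)
        - (k.c1 * α + k.c3 * (3 * a + r) + k.c4 * r - k.d4 * a) * proj g β x μ ν
        + k.d1 * (acc g β x μ * acc g β x ν)) := by
  unfold secondOrder accSq vortSq sym
  simp only [h.vort_eq, h.lvec_eq, h.acc_acc, h.ricci_eq, h.scalar_eq, h.ricciVel_eq,
    h.ricciUU_eq, h.weyl_eq, dot_zero_left, Pi.zero_apply, Pi.smul_apply, smul_eq_mul]
  ring

/-- The energy density of `fourthOrder k` in a static frame. -/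
def staticRho (k : FourthCoeffs) (a r α : ℝ) : ℝ :=
  k.b1 * α ^ 2 + k.b2 * (3 * a + r) * α + k.b4 * (3 * a + r) ^ 2 + k.b7 * r ^ 2
    + k.b8 * r * (3 * a + r) + k.b9 * r * α + k.b12 * (3 * a ^ 2 + r ^ 2) + k.b13 * r ^ 2
    + k.b14 * (a * α) + (k.g1 * α + k.g3 * (3 * a + r) + k.g4 * r) * r
    + 2 * (k.h1 * α + k.h3 * (3 * a + r) + k.h4 * r) * r + k.pRR * r ^ 2 + k.pRuRu * r ^ 2

/-- The pressure of `fourthOrder k` in a static frame. -/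
def staticP (k : FourthCoeffs) (a r α : ℝ) : ℝ :=
  k.c1 * α ^ 2 + k.c2 * (3 * a + r) * α + k.c4 * (3 * a + r) ^ 2 + k.c7 * r ^ 2
    + k.c8 * r * (3 * a + r) + k.c9 * r * α + k.c12 * (3 * a ^ 2 + r ^ 2) + k.c13 * r ^ 2
    + k.c14 * (a * α) - (k.g1 * α + k.g3 * (3 * a + r) + k.g4 * r) * a - k.pRR * a ^ 2

lemma StaticFrame.fourthOrder_eq (h : StaticFrame g β x a r α) (k : FourthCoeffs) (μ ν : Fin 4) :
    fourthOrder k g β x μ ν = staticRho k a r α * (vel g β x μ * vel g β x ν)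
        - staticP k a r α * proj g β x μ ν
        + (k.d1 * α + k.d3 * (3 * a + r) + k.d4 * r + 2 * k.pRA * a)
          * (acc g β x μ * acc g β x ν) := by
  unfold fourthOrder accSq vortSq accVort sym staticRho staticP
  simp only [h.vort_eq, h.lvec_eq, h.acc_acc, h.scalar_eq, h.ricciVel_eq,
    h.ricciUU_eq, h.ricciAcc_eq, ricciApply_zero, dot_zero_right, Pi.zero_apply,
    Pi.smul_apply, smul_eq_mul, dot_smul_left, dot_smul_right, h.vel_vel]
  rw [h.ricciSq_eq, h.ricciDot_eq, h.ricci_eq]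
  ring

/-- An observer rotating with `S ω₀² = y`, `ω² = o`, `A² = y o` in a closed Einstein universe with
squared inverse radius `K`. -/
structure RotatingFrame (g : Metric) (β : VField) (x : Coord) (K y o : ℝ) : Prop where
  o_ne : o ≠ 0
  vel_vel : dot g x (vel g β x) (vel g β x) = 1
  acc_acc : dot g x (acc g β x) (acc g β x) = y * o
  vort_vort : dot g x (vort g β x) (vort g β x) = o
  acc_vort : dot g x (acc g β x) (vort g β x) = 0
  vel_acc : dot g x (vel g β x) (acc g β x) = 0
  vel_vort : dot g x (vel g β x) (vort g β x) = 0
  vel_lvec : dot g x (vel g β x) (lvec g β x) = 0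
  lvec_vel : dot g x (lvec g β x) (vel g β x) = 0
  lvec_acc : dot g x (lvec g β x) (acc g β x) = 0
  lvec_vort : dot g x (lvec g β x) (vort g β x) = 0
  lvec_lvec : dot g x (lvec g β x) (lvec g β x) = -(y * o ^ 2)
  lvec_mul : ∀ μ ν, lvec g β x μ * lvec g β x ν = -(y * o ^ 2) * proj g β x μ ν
    + o * (acc g β x μ * acc g β x ν) + y * o * (vort g β x μ * vort g β x ν)
  ricci_eq : ∀ μ ν, ricci g x μ ν = 2 * K * (-(y * (1 - y)⁻¹) * (vel g β x μ * vel g β x ν)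
    + (1 - y)⁻¹ * proj g β x μ ν - (1 - y)⁻¹ * o⁻¹ * sym (vel g β x) (lvec g β x) μ ν
    - (1 - y)⁻¹ * o⁻¹ * (acc g β x μ * acc g β x ν)
    - y * (1 - y)⁻¹ * o⁻¹ * (vort g β x μ * vort g β x ν))
  scalar_eq : scalarCurv g x = 6 * K
  ricciVel_eq : ricciVel g β x = (-(2 * K * (y * (1 - y)⁻¹))) • vel g β x
    + (-(2 * K * ((1 - y)⁻¹ * o⁻¹))) • lvec g β x
  ricciAcc_eq : ricciApply g x (acc g β x) = (2 * K) • acc g β x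
  ricciVort_eq : ricciApply g x (vort g β x) = (2 * K) • vort g β x
  ricciLvec_eq : ricciApply g x (lvec g β x) = (2 * K * (y * o * (1 - y)⁻¹)) • vel g β x
    + (2 * K * (1 - y)⁻¹) • lvec g β x
  ricciSq_eq : ∑ α, dot g x (fun τ => ricci g x τ α) (fun τ => ∑ γ, (g x)⁻¹ α γ * ricci g x τ γ)
    = 12 * K ^ 2
  ricciDot_eq : ∀ μ ν, dot g x (ricci g x μ) (ricci g x ν) = 2 * K * ricci g x μ ν
  weyl_eq : ∀ μ ν, weylUU g β x μ ν = 0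

variable {K y o : ℝ}

/-- `E u_μ u_ν - p Δ_{μν} + a A_μ A_ν + w ω_μ ω_ν + s (u_μ l_ν + u_ν l_μ)`. -/
def frameTensor (g : Metric) (β : VField) (x : Coord) (E p a w s : ℝ) : Tensor2 := fun μ ν =>
  E * (vel g β x μ * vel g β x ν) - p * proj g β x μ ν + a * (acc g β x μ * acc g β x ν)
    + w * (vort g β x μ * vort g β x ν) + s * sym (vel g β x) (lvec g β x) μ ν

lemma RotatingFrame.ricciUU_eq (h : RotatingFrame g β x K y o) :
    ricciUU g β x = -(2 * K * (y * (1 - y)⁻¹)) := by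
  rw [ricciUU, h.ricciVel_eq, dot_add_left, dot_smul_left, dot_smul_left, h.vel_vel, h.lvec_vel]
  ring

/-- At second order no `l l` term occurs: the Ricci tensor and `R u` are already expressed through
the five basic tensors. -/
lemma RotatingFrame.secondOrder_eq (h : RotatingFrame g β x K y o) (k : SecondCoeffs) :
    secondOrder k g β x = frameTensor g β x
      (temp g β x ^ 2 * (k.b1 * (y * o) + k.b2 * o + 6 * K * k.b3
        - 2 * K * (k.b4 + k.d4 + 2 * k.d5) * (y * (1 - y)⁻¹)))
      (temp g β x ^ 2 * (k.c1 * (y * o) + k.c2 * o + 6 * K * k.c3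
        - 2 * K * (k.c4 * y + k.d4) * (1 - y)⁻¹))
      (temp g β x ^ 2 * (k.d1 - 2 * K * k.d4 * ((1 - y)⁻¹ * o⁻¹)))
      (temp g β x ^ 2 * (k.d2 - 2 * K * k.d4 * (y * (1 - y)⁻¹ * o⁻¹)))
      (temp g β x ^ 2 * (k.d3 - 2 * K * (k.d4 + k.d5) * ((1 - y)⁻¹ * o⁻¹))) := by
  funext μ ν
  unfold secondOrder frameTensor accSq vortSq sym
  simp only [h.acc_acc, h.vort_vort, h.ricci_eq, h.scalar_eq, h.ricciVel_eq,
    h.ricciUU_eq, h.weyl_eq, Pi.add_apply, Pi.smul_apply, smul_eq_mul, sym]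
  ring

/-- The coefficient of `u_μ u_ν` in `fourthOrder k` in a rotating frame. -/
def rotatingRho (k : FourthCoeffs) (K y o : ℝ) : ℝ :=
  let P := (1 - y)⁻¹
  let α := y * o
  let R := 6 * K
  let Ruu := -(2 * K * (y * P))
  k.b1 * α ^ 2 + k.b2 * R * α + k.b3 * R * o + k.b4 * R ^ 2 + k.b5 * o ^ 2 + k.b6 * α * o
    + k.b7 * Ruu ^ 2 + k.b8 * Ruu * R + k.b9 * Ruu * α + k.b10 * Ruu * o
    + k.b11 * (2 * K * (P * o⁻¹) * (y * o ^ 2)) + k.b12 * (12 * K ^ 2)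
    + k.b13 * (4 * K ^ 2 * ((y * P) ^ 2 - (P * o⁻¹) ^ 2 * (y * o ^ 2))) + k.b14 * (2 * K * α)
    + k.b15 * (2 * K * o)
    + (k.g1 * α + k.g2 * o + k.g3 * R + k.g4 * Ruu + 2 * K * k.pRR) * Ruu
    + 2 * (k.h1 * α + k.h2 * o + k.h3 * R + k.h4 * Ruu) * Ruu
    + k.pRuRu * Ruu ^ 2 + k.puRl * (4 * K * (α * P))

/-- The coefficient of `-Δ_{μν}` in `fourthOrder k` in a rotating frame. -/
def rotatingP (k : FourthCoeffs) (K y o : ℝ) : ℝ :=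
  let P := (1 - y)⁻¹
  let α := y * o
  let R := 6 * K
  let Ruu := -(2 * K * (y * P))
  k.c1 * α ^ 2 + k.c2 * R * α + k.c3 * R * o + k.c4 * R ^ 2 + k.c5 * o ^ 2 + k.c6 * α * o
    + k.c7 * Ruu ^ 2 + k.c8 * Ruu * R + k.c9 * Ruu * α + k.c10 * Ruu * o
    + k.c11 * (2 * K * (P * o⁻¹) * (y * o ^ 2)) + k.c12 * (12 * K ^ 2)
    + k.c13 * (4 * K ^ 2 * ((y * P) ^ 2 - (P * o⁻¹) ^ 2 * (y * o ^ 2))) + k.c14 * (2 * K * α)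
    + k.c15 * (2 * K * o)
    - (k.g1 * α + k.g2 * o + k.g3 * R + k.g4 * Ruu + 2 * K * k.pRR) * (2 * K * P)
    + (k.pRuRu * (2 * K * (P * o⁻¹)) ^ 2 - k.plRu * (4 * K * (P * o⁻¹))) * (y * o ^ 2)

/-- The coefficient of `A_μ A_ν` in `fourthOrder k` in a rotating frame. -/
def rotatingA (k : FourthCoeffs) (K y o : ℝ) : ℝ :=
  let P := (1 - y)⁻¹
  let α := y * o
  let R := 6 * K
  let Ruu := -(2 * K * (y * P))
  k.d1 * α + k.d2 * o + k.d3 * R + k.d4 * Ruu + 4 * K * k.pRA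
    - (k.g1 * α + k.g2 * o + k.g3 * R + k.g4 * Ruu + 2 * K * k.pRR) * (2 * K * (P * o⁻¹))
    + (k.pRuRu * (2 * K * (P * o⁻¹)) ^ 2 - k.plRu * (4 * K * (P * o⁻¹))) * o

/-- The coefficient of `ω_μ ω_ν` in `fourthOrder k` in a rotating frame. -/
def rotatingW (k : FourthCoeffs) (K y o : ℝ) : ℝ :=
  let P := (1 - y)⁻¹
  let α := y * o
  let R := 6 * K
  let Ruu := -(2 * K * (y * P))
  k.e1 * α + k.e2 * o + k.e3 * R + k.e4 * Ruu + 4 * K * k.pRw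
    - (k.g1 * α + k.g2 * o + k.g3 * R + k.g4 * Ruu + 2 * K * k.pRR) * (2 * K * (y * P * o⁻¹))
    + (k.pRuRu * (2 * K * (P * o⁻¹)) ^ 2 - k.plRu * (4 * K * (P * o⁻¹))) * (y * o)

/-- The coefficient of `u_μ l_ν + u_ν l_μ` in `fourthOrder k` in a rotating frame. -/
def rotatingG (k : FourthCoeffs) (K y o : ℝ) : ℝ :=
  let P := (1 - y)⁻¹
  let α := y * o
  let R := 6 * K
  let Ruu := -(2 * K * (y * P))
  k.f1 * α + k.f2 * o + k.f3 * R + k.f4 * Ruu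
    - (k.g1 * α + k.g2 * o + k.g3 * R + k.g4 * Ruu + 2 * K * k.pRR) * (2 * K * (P * o⁻¹))
    - (k.h1 * α + k.h2 * o + k.h3 * R + k.h4 * Ruu) * (2 * K * (P * o⁻¹))
    + k.pRuRu * (4 * K ^ 2 * (y * P * (P * o⁻¹))) + k.puRl * (2 * K * P) + k.plRu * Ruu

lemma RotatingFrame.fourthOrder_eq (h : RotatingFrame g β x K y o) (k : FourthCoeffs) :
    fourthOrder k g β x = frameTensor g β x (rotatingRho k K y o) (rotatingP k K y o)
      (rotatingA k K y o) (rotatingW k K y o) (rotatingG k K y o) := by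
  funext μ ν
  -- Since `R u` contains `l`, the terms `pRuRu` and `plRu` produce `l_μ l_ν`. The completeness
  -- relation of the orthogonal frame eliminates this product.
  have hl := h.lvec_mul μ ν
  unfold fourthOrder frameTensor accSq vortSq accVort sym rotatingRho rotatingP rotatingA
    rotatingW rotatingG
  simp only [h.acc_acc, h.vort_vort, h.acc_vort, h.scalar_eq, h.ricciVel_eq, h.ricciDot_eq,
    h.ricciUU_eq, h.ricciAcc_eq, h.ricciVort_eq, h.ricciLvec_eq, h.ricciSq_eq, dot_add_left,
    dot_add_right, Pi.add_apply,
    Pi.smul_apply, smul_eq_mul, dot_smul_left, dot_smul_right, h.vel_vel, h.vel_lvec,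
    h.lvec_lvec, h.lvec_vel]
  simp only [h.ricci_eq, sym]
  linear_combination (k.pRuRu * (2 * K * ((1 - y)⁻¹ * o⁻¹)) ^ 2
    - k.plRu * (4 * K * ((1 - y)⁻¹ * o⁻¹))) * hl

end

/-! ### The three space-times realize the adapted frames. -/

lemma weylUU_eq_zero {g : Metric} {β : VField} {x : Coord} (h : ∀ μ ν ρ σ, weyl g x μ ν ρ σ = 0)
    (μ ν : Fin 4) : weylUU g β x μ ν = 0 := by
  simp [weylUU, h]

lemma staticFrame_spaceForm {K : ℝ} {x : Coord} (h : SpaceFormRegular K x) :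
    StaticFrame (spaceForm K) (staticKilling 1) x (-3 * K) (-3 * K)
      (-(K ^ 2 * x 1 ^ 2 / (1 + K * x 1 ^ 2))) := by
  have hg := spaceForm_apply K x
  have hv := h.diag_ne_zero
  have hp := h.f_pos
  have hp' := hp.ne'
  have h2 := Real.sq_sqrt hp.le
  have hr := ricci_spaceForm h
  have hr' : ∀ μ ν, ricci (spaceForm K) x μ ν
      = if μ = ν then (fun _ => -3 * K) μ * spaceFormDiag K x μ else 0 := hr
  have hgμ : ∀ μ ν, spaceForm K x μ ν = if μ = ν then spaceFormDiag K x μ else 0 := fun μ ν => by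
    rw [hg, Matrix.diagonal_apply]
  refine ⟨vort_spaceForm h, lvec_spaceForm h, ?_, ?_, ?_, ?_, ?_, ?_, ?_, ?_,
    weylUU_eq_zero (weyl_spaceForm h)⟩
  · rw [dot_diagonal hg hv, vel_spaceForm h, Fin.sum_univ_four]
    simp [spaceFormDiag]
    rw [← pow_two, h2, div_self hp']
  · rw [dot_diagonal hg hv, acc_spaceForm h, Fin.sum_univ_four]
    simp [spaceFormDiag]
    field_simp
  · intro μ ν
    rw [hr, proj, hgμ]
    split_ifs <;> ring
  · rw [scalarCurv_diagonal hg hv hr']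
    simp
    ring
  · funext i
    rw [ricciVel, ricciApply_diagonal hg hv hr']
    rfl
  · funext i
    rw [ricciApply_diagonal hg hv hr']
    rfl
  · rw [ricciSq_diagonal hg hv hr']
    simp
    ring
  · intro μ ν
    rw [ricciDot_diagonal hg hv hr', proj, hgμ]
    split_ifs <;> ring

section

variable {κ w : ℝ} {x : Coord}

lemma ceuGamma_zero (x : Coord) : ceuGamma 0 x = 1 := by simp [ceuGamma, ceuLapse]

lemma vel_ceu_static (hκ : 0 < κ) (x : Coord) :
    vel (ceuMetric κ) (staticKilling 1) x = ![1, 0, 0, 0] := by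
  rw [← ceuKilling_zero κ 1, vel_ceu hκ, ceuGamma_zero]
  simp

lemma staticFrame_ceu (hκ : 0 < κ) (h : CEURegular x) :
    StaticFrame (ceuMetric κ) (staticKilling 1) x (2 * κ ^ 2) 0 0 := by
  have hg := ceuMetric_apply κ x
  have hv := h.diag_ne_zero hκ
  have hr' := ricci_ceu hκ h
  have hgμ : ∀ μ ν, ceuMetric κ x μ ν = if μ = ν then ceuDiag κ x μ else 0 := fun μ ν => by
    rw [hg, Matrix.diagonal_apply]
  have ha : acc (ceuMetric κ) (staticKilling 1) x = 0 := by
    rw [← ceuKilling_zero κ 1, acc_ceu hκ le_rfl one_pos h]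
    simp
  have hu := vel_ceu_static hκ x
  refine ⟨?_, ?_, ?_, ?_, ?_, ?_, ?_, ?_, ?_, ?_, weylUU_eq_zero (weyl_ceu hκ h)⟩
  · rw [← ceuKilling_zero κ 1, vort_ceu hκ le_rfl one_pos h]
    simp
  · rw [← ceuKilling_zero κ 1, lvec_ceu hκ le_rfl one_pos h]
    simp
  · rw [dot_diagonal hg hv, hu, Fin.sum_univ_four]
    simp [ceuDiag]
  · rw [ha, dot_zero_left]
  · intro μ ν
    rw [hr', proj, hgμ, hu]
    fin_cases μ <;> fin_cases ν <;> simp [spatial, ceuDiag]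
  · rw [scalarCurv_diagonal hg hv hr', Fin.sum_univ_four]
    simp [spatial]
    ring
  · funext i
    rw [ricciVel, ricciApply_diagonal hg hv hr', hu]
    fin_cases i <;> simp [spatial]
  · rw [ha, ricciApply_zero, smul_zero]
  · rw [ricciSq_diagonal hg hv hr', Fin.sum_univ_four]
    simp [spatial]
    ring
  · intro μ ν
    rw [ricciDot_diagonal hg hv hr', proj, hgμ, hu]
    fin_cases μ <;> fin_cases ν <;> simp [spatial, ceuDiag]

/-- `ω²` of the rotating observers. -/
def ceuVortSq (κ w : ℝ) (x : Coord) : ℝ :=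
  -(κ ^ 2 * w ^ 2 * (1 - ceuS x) / (1 - ceuS x * w ^ 2) ^ 2)

/-- The mixed Ricci tensor is `2κ²` times the projector orthogonal to `∂_t`. Rewriting it in the
frame of the rotating observer gives the formulas with `(1 - y)⁻¹`; the condition `S ≠ 1` ensures `ω
≠ 0`. -/
lemma rotatingFrame_ceu (hκ : 0 < κ) (hw : 0 < w) (hw1 : w < 1) (h : CEURegular x)
    (hS : ceuS x ≠ 1) :
    RotatingFrame (ceuMetric κ) (ceuKilling κ w 1) x (κ ^ 2) (ceuS x * w ^ 2)
      (ceuVortSq κ w x) := by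
  have hg := ceuMetric_apply κ x
  have hv := h.diag_ne_zero hκ
  have hr' := ricci_ceu hκ h
  have hgμ : ∀ μ ν, ceuMetric κ x μ ν = if μ = ν then ceuDiag κ x μ else 0 := fun μ ν => by
    rw [hg, Matrix.diagonal_apply]
  have hP : 0 < 1 - ceuS x * w ^ 2 := ceuLapse_pos hw.le hw1 x
  have hγ : ceuGamma w x ^ 2 * (1 - ceuS x * w ^ 2) = 1 := ceuGamma_sq hw.le hw1 x
  have hS' : 1 - ceuS x ≠ 0 := sub_ne_zero.mpr hS.symm
  have ho : ceuVortSq κ w x = -(κ ^ 2 * w ^ 2 * (1 - ceuS x) * ceuGamma w x ^ 4) := by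
    unfold ceuVortSq
    rw [neg_inj, div_eq_iff (pow_ne_zero 2 hP.ne')]
    linear_combination (-(κ ^ 2 * w ^ 2 * (1 - ceuS x))
      * (ceuGamma w x ^ 2 * (1 - ceuS x * w ^ 2) + 1)) * hγ
  have hPγ : (1 - ceuS x * w ^ 2)⁻¹ = ceuGamma w x ^ 2 :=
    inv_eq_of_mul_eq_one_left hγ
  have hγ0 : ceuGamma w x ≠ 0 := by
    rintro h0
    rw [h0] at hγ
    simp at hγ
  have h1 := h.sin_pos'.ne'
  have h2 := h.sin_pos.ne'
  have t1 := Real.cos_sq' (x 1)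
  have t2 := Real.cos_sq' (x 2)
  have hSx : ceuS x = Real.sin (x 1) ^ 2 * Real.sin (x 2) ^ 2 := rfl
  have hu := vel_ceu hκ w x
  have ha := acc_ceu hκ hw.le hw1 h
  have hω := vort_ceu hκ hw.le hw1 h
  have hl := lvec_ceu hκ hw.le hw1 h
  have o_ne : ceuVortSq κ w x ≠ 0 := by
    rw [ho]
    exact neg_ne_zero.mpr (by positivity)
  -- From here `o` and `γ` are symbols tied only by `ho` and `hγ`, and each field becomes a rational
  -- identity.
  generalize ceuVortSq κ w x = o at *
  generalize ceuGamma w x = γ at *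
  refine ⟨o_ne, ?_, ?_, ?_, ?_, ?_, ?_, ?_, ?_, ?_, ?_, ?_, ?_, ?_, ?_, ?_, ?_, ?_, ?_, ?_, ?_,
    weylUU_eq_zero (weyl_ceu hκ h)⟩
  · rw [dot_diagonal hg hv, hu, Fin.sum_univ_four]
    simp [ceuDiag]
    field_simp
    grind
  · rw [dot_diagonal hg hv, ha, Fin.sum_univ_four]
    simp [ceuDiag]
    field_simp
    grind
  · rw [dot_diagonal hg hv, hω, Fin.sum_univ_four]
    simp [ceuDiag]
    field_simp
    grind
  · rw [dot_diagonal hg hv, ha, hω, Fin.sum_univ_four]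
    simp [ceuDiag]
    field_simp
    ring
  · rw [dot_diagonal hg hv, hu, ha, Fin.sum_univ_four]
    simp
  · rw [dot_diagonal hg hv, hu, hω, Fin.sum_univ_four]
    simp
  · rw [dot_diagonal hg hv, hu, hl, Fin.sum_univ_four]
    simp [ceuDiag]
    field_simp
    grind
  · rw [dot_diagonal hg hv, hu, hl, Fin.sum_univ_four]
    simp [ceuDiag]
    field_simp
    grind
  · rw [dot_diagonal hg hv, ha, hl, Fin.sum_univ_four]
    simp
  · rw [dot_diagonal hg hv, hω, hl, Fin.sum_univ_four]
    simp
  · rw [dot_diagonal hg hv, hl, Fin.sum_univ_four, ho]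
    simp [ceuDiag]
    field_simp
    rw [hSx] at hγ ⊢
    linear_combination (-(Real.sin (x 1) ^ 2 * Real.sin (x 2) ^ 2) ^ 2) * hγ
  · intro μ ν
    rw [proj, hgμ, hl, hu, ha, hω]
    -- These trigonometric identities are the residues of the completeness relation in the `(χ, θ)`
    -- block after clearing denominators.
    have e1 : ceuS x * (1 - ceuS x) + -(Real.sin (x 1) ^ 2 * Real.cos (x 1) ^ 2
        * Real.sin (x 2) ^ 4) + -(ceuS x * Real.cos (x 2) ^ 2) = 0 := by
      rw [t1, t2, hSx]
      ring
    have e2 : ceuS x * (1 - ceuS x) + -(Real.sin (x 1) ^ 2 * Real.sin (x 2) ^ 2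
        * Real.cos (x 2) ^ 2) + -(ceuS x * Real.sin (x 2) ^ 2 * Real.cos (x 1) ^ 2) = 0 := by
      rw [t1, t2, hSx]
      ring
    have e3 : -(Real.sin (x 1) ^ 2 * Real.sin (x 2) ^ 2) + ceuS x = 0 := by
      rw [hSx]
      ring
    fin_cases μ <;> fin_cases ν <;> simp [ceuDiag]
    all_goals
      first
        | ring1
        | subst ho; field_simp; done
        | subst ho
          field_simp
          first
            | rw [e1, mul_zero]
            | rw [e2, mul_zero]
            | rw [e3, mul_zero]
            | linear_combination (-ceuS x) * hγ
            | linear_combination ceuS x ^ 2 * hγ + ceuS x * hSx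
  · intro μ ν
    rw [hr', proj, hgμ, hl, hu, ha, hω, hPγ]
    fin_cases μ <;> fin_cases ν <;> simp [ceuDiag, spatial, sym]
    all_goals
      clear hg hv hr' hgμ hu ha hω hl hPγ hP o_ne hS h hw1
      first | ring1 | (subst ho; field_simp; done) | (subst ho; field_simp; grind)
  · rw [scalarCurv_diagonal hg hv hr', Fin.sum_univ_four]
    simp [spatial]
    ring
  · funext i
    rw [ricciVel, ricciApply_diagonal hg hv hr', hu, hl, hPγ]
    fin_cases i <;> simp [spatial]
    all_goals
      clear hg hv hr' hgμ hu ha hω hl hPγ hP o_ne hS h hw1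
      first | ring1 | (subst ho; field_simp; done) | (subst ho; field_simp; grind)
  · funext i
    rw [ricciApply_diagonal hg hv hr', ha]
    fin_cases i <;> simp [spatial]
  · funext i
    rw [ricciApply_diagonal hg hv hr', hω]
    fin_cases i <;> simp [spatial]
  · funext i
    rw [ricciApply_diagonal hg hv hr', hu, hl, hPγ]
    fin_cases i <;> simp [spatial]
    all_goals
      clear hg hv hr' hgμ hu ha hω hl hPγ hP o_ne hS h hw1
      first | ring1 | (subst ho; field_simp; done) | (subst ho; field_simp; grind)
  · rw [ricciSq_diagonal hg hv hr', Fin.sum_univ_four]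
    simp [spatial]
    ring
  · intro μ ν
    rw [ricciDot_diagonal hg hv hr', hr']
    fin_cases μ <;> fin_cases ν <;> simp [spatial] <;> ring

end

/-! ### Matching conditions -/

/-- An order decomposition allows all five powers of `T₀`, so identifying its `T₀²` part amounts to
uniqueness of the coefficients of a quartic polynomial. -/
lemma isOrderPart_two_iff {F G : ℝ → ℂ} {d0 d2 d4 f : ℂ}
    (hF : ∀ T : ℝ, 0 < T → F T = d0 * (T : ℂ) ^ 4 + d2 * (T : ℂ) ^ 2 + d4)
    (hG : ∀ T : ℝ, 0 < T → G T = (T : ℂ) ^ 2 * f) : IsOrderPart 2 F G ↔ f = d2 := by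
  constructor
  · rintro ⟨c, hc⟩
    have h : ∀ T : ℝ, 0 < T → c 0 * (T : ℂ) ^ 4 + c 1 * (T : ℂ) ^ 3 + c 2 * (T : ℂ) ^ 2
        + c 3 * (T : ℂ) + c 4 = d0 * (T : ℂ) ^ 4 + d2 * (T : ℂ) ^ 2 + d4 := fun T hT => by
      have := (hc T hT).1
      rw [hF T hT] at this
      simp only [Finset.sum_range_succ, Finset.sum_range_zero] at this
      linear_combination -this
    have h1 := h 1 (by norm_num)
    have h2 := h 2 (by norm_num)
    have h3 := h 3 (by norm_num)
    have h4 := h 4 (by norm_num)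
    have h5 := h 5 (by norm_num)
    have h6 := (hc 1 one_pos).2
    rw [hG 1 one_pos] at h6
    push_cast at h1 h2 h3 h4 h5 h6
    -- The weights are the `T²` coefficients of the Lagrange polynomials with nodes `1, …, 5`.
    linear_combination h6 + 71 / 24 * h1 - 59 / 6 * h2 + 49 / 4 * h3 - 41 / 6 * h4 + 35 / 24 * h5
  · rintro rfl
    refine ⟨fun n => if n = 0 then d0 else if n = 2 then f else if n = 4 then d4 else 0,
      fun T hT => ⟨?_, ?_⟩⟩
    · rw [hF T hT]
      simp [Finset.sum_range_succ]
    · rw [hG T hT]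
      simp [mul_comm]

lemma isOrderPart_four_iff {F G : ℝ → ℂ} {d0 d2 d4 f : ℂ}
    (hF : ∀ T : ℝ, 0 < T → F T = d0 * (T : ℂ) ^ 4 + d2 * (T : ℂ) ^ 2 + d4)
    (hG : ∀ T : ℝ, 0 < T → G T = f) : IsOrderPart 4 F G ↔ f = d4 := by
  constructor
  · rintro ⟨c, hc⟩
    have h : ∀ T : ℝ, 0 < T → c 0 * (T : ℂ) ^ 4 + c 1 * (T : ℂ) ^ 3 + c 2 * (T : ℂ) ^ 2
        + c 3 * (T : ℂ) + c 4 = d0 * (T : ℂ) ^ 4 + d2 * (T : ℂ) ^ 2 + d4 := fun T hT => by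
      have := (hc T hT).1
      rw [hF T hT] at this
      simp only [Finset.sum_range_succ, Finset.sum_range_zero] at this
      linear_combination -this
    have h1 := h 1 (by norm_num)
    have h2 := h 2 (by norm_num)
    have h3 := h 3 (by norm_num)
    have h4 := h 4 (by norm_num)
    have h5 := h 5 (by norm_num)
    have h6 := (hc 1 one_pos).2
    rw [hG 1 one_pos] at h6
    push_cast at h1 h2 h3 h4 h5 h6
    -- The weights are the values at `0` of the Lagrange polynomials with nodes `1, …, 5`, which
    -- extract the constant term.
    linear_combination h6 + 5 * h1 - 10 * h2 + 10 * h3 - 5 * h4 + h5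
  · rintro rfl
    refine ⟨fun n => if n = 0 then d0 else if n = 2 then d2 else if n = 4 then f else 0,
      fun T hT => ⟨?_, ?_⟩⟩
    · rw [hF T hT]
      simp [Finset.sum_range_succ]
    · rw [hG T hT]
      simp

section

variable {P : ℝ → (Fin 4 → Fin 4 → ℂ) → Prop} {Φ : ℝ → Tensor2} {d0 d2 d4 φ : Tensor2}

/-- When the distillate is known and unique, the existential in the matching condition disappears
and an equality of tensors remains. -/
lemma matchesAtOrder_two_iff
    (hP : ∀ T : ℝ, 0 < T → ∀ D, P T D ↔ ∀ μ ν, D μ ν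
      = ((d0 μ ν * T ^ 4 + d2 μ ν * T ^ 2 + d4 μ ν : ℝ) : ℂ))
    (hΦ : ∀ T : ℝ, 0 < T → ∀ μ ν, Φ T μ ν = T ^ 2 * φ μ ν) :
    MatchesAtOrder 2 P Φ ↔ φ = d2 := by
  have key : ∀ D : ℝ → Fin 4 → Fin 4 → ℂ, (∀ T, 0 < T → P T (D T)) → ∀ μ ν,
      (IsOrderPart 2 (fun T => D T μ ν) (fun T => (Φ T μ ν : ℂ)) ↔ φ μ ν = d2 μ ν) := by
    intro D hD μ ν
    rw [isOrderPart_two_iff (d0 := d0 μ ν) (d2 := d2 μ ν) (d4 := d4 μ ν) (f := φ μ ν)]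
    · norm_cast
    · intro T hT
      have := (hP T hT _).mp (hD T hT) μ ν
      push_cast at this
      exact this
    · intro T hT
      rw [hΦ T hT]
      push_cast
      rfl
  constructor
  · rintro ⟨D, hD, h⟩
    funext μ ν
    exact (key D hD μ ν).mp (h μ ν)
  · intro h
    have hD : ∀ T : ℝ, 0 < T → P T
        (fun μ ν => ((d0 μ ν * T ^ 4 + d2 μ ν * T ^ 2 + d4 μ ν : ℝ) : ℂ)) :=
      fun T hT => (hP T hT _).mpr fun _ _ => rfl
    exact ⟨_, hD, fun μ ν => (key _ hD μ ν).mpr (by rw [h])⟩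

lemma matchesAtOrder_four_iff
    (hP : ∀ T : ℝ, 0 < T → ∀ D, P T D ↔ ∀ μ ν, D μ ν
      = ((d0 μ ν * T ^ 4 + d2 μ ν * T ^ 2 + d4 μ ν : ℝ) : ℂ))
    (hΦ : ∀ T : ℝ, 0 < T → ∀ μ ν, Φ T μ ν = φ μ ν) :
    MatchesAtOrder 4 P Φ ↔ φ = d4 := by
  have key : ∀ D : ℝ → Fin 4 → Fin 4 → ℂ, (∀ T, 0 < T → P T (D T)) → ∀ μ ν,
      (IsOrderPart 4 (fun T => D T μ ν) (fun T => (Φ T μ ν : ℂ)) ↔ φ μ ν = d4 μ ν) := by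
    intro D hD μ ν
    rw [isOrderPart_four_iff (d0 := d0 μ ν) (d2 := d2 μ ν) (d4 := d4 μ ν) (f := φ μ ν)]
    · norm_cast
    · intro T hT
      have := (hP T hT _).mp (hD T hT) μ ν
      push_cast at this
      exact this
    · intro T hT
      rw [hΦ T hT]
  constructor
  · rintro ⟨D, hD, h⟩
    funext μ ν
    exact (key D hD μ ν).mp (h μ ν)
  · intro h
    have hD : ∀ T : ℝ, 0 < T → P T
        (fun μ ν => ((d0 μ ν * T ^ 4 + d2 μ ν * T ^ 2 + d4 μ ν : ℝ) : ℂ)) :=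
      fun T hT => (hP T hT _).mpr fun _ _ => rfl
    exact ⟨_, hD, fun μ ν => (key _ hD μ ν).mpr (by rw [h])⟩

end

/-! ### Explicit distilled tensors in powers of the global temperature. -/

lemma vel_staticKilling {g : Metric} {T : ℝ} (hT : 0 < T) :
    vel g (staticKilling T) = vel g (staticKilling 1) :=
  vel_congr (velUp_div hT (staticKilling_div T))

lemma proj_staticKilling {g : Metric} {T : ℝ} (hT : 0 < T) :
    proj g (staticKilling T) = proj g (staticKilling 1) :=
  proj_congr (velUp_div hT (staticKilling_div T))

/-- `c (3 u_μ u_ν - Δ_{μν})` for a static observer. -/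
def radiationTensor (g : Metric) (x : Coord) (c : ℝ) : Tensor2 := fun μ ν =>
  c * (3 * (vel g (staticKilling 1) x μ * vel g (staticKilling 1) x ν)
    - proj g (staticKilling 1) x μ ν)

/-- Existence comes from the explicit distilled values, uniqueness from `IsDistilledValue.unique`.
The tensor is pure radiation without a `T₀²` part, since `-g + 4 u u = 3 u u - Δ`. -/
lemma isAdSDistillate_iff {ε κ T : ℝ} {x : Coord} (hκ : 0 < κ) (hx : 0 < x 1) (hT : 0 < T)
    (D : Fin 4 → Fin 4 → ℂ) : IsAdSDistillate ε κ T x D ↔ ∀ μ ν, D μ ν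
      = ((radiationTensor (spaceForm (κ ^ 2)) x (Real.pi ^ 2 / 90 / (1 + κ ^ 2 * x 1 ^ 2) ^ 2) μ ν
        * T ^ 4 + (fun _ _ => 0 : Tensor2) μ ν * T ^ 2
        + radiationTensor (spaceForm (κ ^ 2)) x
          (-(κ ^ 4 / (1440 * Real.pi ^ 2)) / (1 + κ ^ 2 * x 1 ^ 2) ^ 2) μ ν : ℝ) : ℂ) := by
  have hq : 0 < κ * x 1 := mul_pos hκ hx
  have hG := distilled_adsG hq hT ε κ
  have hU := distilled_adsU hq hT ε κ
  have hA := distilled_adsA hq hT ε κ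
  have key : ∀ μ ν, ((-((Real.pi ^ 2 / 90 * T ^ 4 - κ ^ 4 / (1440 * Real.pi ^ 2))
        / (1 + (κ * x 1) ^ 2) ^ 2) : ℝ) : ℂ) * (adsMetric κ x μ ν : ℝ)
      + ((4 * ((Real.pi ^ 2 / 90 * T ^ 4 - κ ^ 4 / (1440 * Real.pi ^ 2))
        / (1 + (κ * x 1) ^ 2) ^ 2) : ℝ) : ℂ) * ((vel (adsMetric κ) (staticKilling T) x μ
          * vel (adsMetric κ) (staticKilling T) x ν : ℝ) : ℂ)
      + ((0 : ℝ) : ℂ) * ((acc (adsMetric κ) (staticKilling T) x μ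
          * acc (adsMetric κ) (staticKilling T) x ν : ℝ) : ℂ)
      = ((radiationTensor (spaceForm (κ ^ 2)) x (Real.pi ^ 2 / 90 / (1 + κ ^ 2 * x 1 ^ 2) ^ 2) μ ν
        * T ^ 4 + (fun _ _ => 0 : Tensor2) μ ν * T ^ 2
        + radiationTensor (spaceForm (κ ^ 2)) x
          (-(κ ^ 4 / (1440 * Real.pi ^ 2)) / (1 + κ ^ 2 * x 1 ^ 2) ^ 2) μ ν : ℝ) : ℂ) := by
    intro μ ν
    rw [vel_staticKilling hT, ← adsMetric_eq]
    unfold radiationTensor proj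
    norm_cast
    ring
  constructor
  · rintro ⟨G, U, A, h1, h2, h3, h⟩ μ ν
    obtain rfl := h1.unique hG
    obtain rfl := h2.unique hU
    obtain rfl := h3.unique hA
    rw [h, key]
  · intro h
    exact ⟨_, _, _, hG, hU, hA, fun μ ν => by rw [h, key]⟩

lemma isDSDistillate_iff {κ T : ℝ} {x : Coord} (hT : 0 < T)
    (D : Fin 4 → Fin 4 → ℂ) : IsDSDistillate κ T x D ↔ ∀ μ ν, D μ ν
      = ((radiationTensor (spaceForm (-κ ^ 2)) x
          (Real.pi ^ 2 / 90 / (1 + -κ ^ 2 * x 1 ^ 2) ^ 2) μ ν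
        * T ^ 4 + (fun _ _ => 0 : Tensor2) μ ν * T ^ 2
        + radiationTensor (spaceForm (-κ ^ 2)) x
          (-(κ ^ 4 / (1440 * Real.pi ^ 2)) / (1 + -κ ^ 2 * x 1 ^ 2) ^ 2) μ ν : ℝ) : ℂ) := by
  have hG := distilled_dsPressure (T₀ := T) (κ * x 1) κ
  have key : ∀ μ ν, (((Real.pi ^ 2 / 90 * T ^ 4 - κ ^ 4 / (1440 * Real.pi ^ 2))
        / (1 - (κ * x 1) ^ 2) ^ 2 : ℝ) : ℂ) * ((-(dsMetric κ x μ ν)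
      + 4 * (vel (dsMetric κ) (staticKilling T) x μ
          * vel (dsMetric κ) (staticKilling T) x ν) : ℝ) : ℂ)
      = ((radiationTensor (spaceForm (-κ ^ 2)) x
          (Real.pi ^ 2 / 90 / (1 + -κ ^ 2 * x 1 ^ 2) ^ 2) μ ν
        * T ^ 4 + (fun _ _ => 0 : Tensor2) μ ν * T ^ 2
        + radiationTensor (spaceForm (-κ ^ 2)) x
          (-(κ ^ 4 / (1440 * Real.pi ^ 2)) / (1 + -κ ^ 2 * x 1 ^ 2) ^ 2) μ ν : ℝ) : ℂ) := by
    intro μ ν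
    rw [vel_staticKilling hT, ← dsMetric_eq]
    unfold radiationTensor proj
    norm_cast
    ring
  constructor
  · rintro ⟨G, h1, h⟩ μ ν
    obtain rfl := h1.unique hG
    rw [h, key]
  · intro h
    exact ⟨_, hG, fun μ ν => by rw [h, key]⟩

lemma isCEUStaticDistillate_iff {κ T : ℝ} {x : Coord} (hT : 0 < T)
    (D : Fin 4 → Fin 4 → ℂ) : IsCEUStaticDistillate κ T x D ↔ ∀ μ ν, D μ ν
      = ((radiationTensor (ceuMetric κ) x (Real.pi ^ 2 / 90) μ ν * T ^ 4
        + (fun _ _ => 0 : Tensor2) μ ν * T ^ 2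
        + radiationTensor (ceuMetric κ) x (-(κ ^ 4 / (1440 * Real.pi ^ 2))) μ ν : ℝ) : ℂ) := by
  have hG := distilled_ceuRhoStatic hT κ
  have key : ∀ μ ν, ((Real.pi ^ 2 / 30 * T ^ 4 - κ ^ 4 / (480 * Real.pi ^ 2) : ℝ) : ℂ)
        * ((vel (ceuMetric κ) (staticKilling T) x μ
          * vel (ceuMetric κ) (staticKilling T) x ν : ℝ) : ℂ)
      - ((Real.pi ^ 2 / 30 * T ^ 4 - κ ^ 4 / (480 * Real.pi ^ 2) : ℝ) : ℂ) / 3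
        * (proj (ceuMetric κ) (staticKilling T) x μ ν : ℝ)
      = ((radiationTensor (ceuMetric κ) x (Real.pi ^ 2 / 90) μ ν * T ^ 4
        + (fun _ _ => 0 : Tensor2) μ ν * T ^ 2
        + radiationTensor (ceuMetric κ) x (-(κ ^ 4 / (1440 * Real.pi ^ 2))) μ ν : ℝ) : ℂ) := by
    intro μ ν
    rw [vel_staticKilling hT, proj_staticKilling hT]
    unfold radiationTensor
    norm_cast
    ring
  constructor
  · rintro ⟨G, h1, h⟩ μ ν
    obtain rfl := h1.unique hG
    rw [h, key]
  · intro h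
    exact ⟨_, hG, fun μ ν => by rw [h, key]⟩

lemma isCEUDistillate_iff {κ w T : ℝ} {x : Coord} (hS : ceuS x ≠ 1)
    (hw : 0 < w) (hw1 : w < 1) (hT : 0 < T) (D : Fin 4 → Fin 4 → ℂ) :
    IsCEUDistillate κ w T x D ↔ ∀ μ ν, D μ ν
      = ((frameTensor (ceuMetric κ) (ceuKilling κ w 1) x
          (Real.pi ^ 2 / (30 * (1 - ceuS x * w ^ 2) ^ 2))
          (Real.pi ^ 2 / (90 * (1 - ceuS x * w ^ 2) ^ 2)) 0 0 0 μ ν * T ^ 4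
        + frameTensor (ceuMetric κ) (ceuKilling κ w 1) x
          (κ ^ 2 * w ^ 2 * (1 - ceuS x) / (36 * (1 - ceuS x * w ^ 2) ^ 3))
          (κ ^ 2 * w ^ 2 * (1 - ceuS x) / (36 * (1 - ceuS x * w ^ 2) ^ 3)) 0
          (-1 / (18 * (1 - ceuS x * w ^ 2)))
          (-(1 - w ^ 2) / (18 * (1 - ceuS x) * w ^ 2 * (1 - ceuS x * w ^ 2))) μ ν * T ^ 2
        + frameTensor (ceuMetric κ) (ceuKilling κ w 1) x
          (-(κ ^ 4 * (1 / 20 - 1 / 3 * w ^ 2 + 1 / 6 * w ^ 4 + ceuS x * (8 / 15 * w ^ 2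
            - 5 / 6 * w ^ 4 + 8 / 15 * w ^ 6) + ceuS x ^ 2 * (1 / 6 * w ^ 4 - 1 / 3 * w ^ 6
            + 1 / 20 * w ^ 8)) / (24 * Real.pi ^ 2 * (1 - ceuS x * w ^ 2) ^ 4)))
          (-(κ ^ 4 * (1 / 30 - 2 / 3 * w ^ 2 + 1 / 3 * w ^ 4 + ceuS x * (32 / 15 * w ^ 2
            - 11 / 3 * w ^ 4 + 32 / 15 * w ^ 6) + ceuS x ^ 2 * (1 / 3 * w ^ 4 - 2 / 3 * w ^ 6
            + 1 / 30 * w ^ 8)) / (48 * Real.pi ^ 2 * (1 - ceuS x * w ^ 2) ^ 4)))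
          (κ ^ 2 * (1 - w ^ 2) ^ 2
            / (24 * Real.pi ^ 2 * (1 - ceuS x) * w ^ 2 * (1 - ceuS x * w ^ 2) ^ 2))
          (-(κ ^ 2 * (1 / 3 * w ^ 2 - 1 / 6 * w ^ 4 + ceuS x * (-5 / 6 * w ^ 2 + 4 / 3 * w ^ 4
            - 5 / 6 * w ^ 6) + ceuS x ^ 2 * (-1 / 6 * w ^ 4 + 1 / 3 * w ^ 6))
            / (12 * Real.pi ^ 2 * (1 - ceuS x) * w ^ 2 * (1 - ceuS x * w ^ 2) ^ 2)))
          (κ ^ 2 * (1 - w ^ 4)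
            / (360 * Real.pi ^ 2 * (1 - ceuS x) * w ^ 2 * (1 - ceuS x * w ^ 2))) μ ν
          : ℝ) : ℂ) := by
  have hS0 : 0 ≤ ceuS x := by unfold ceuS; positivity
  have hS1 : ceuS x < 1 := lt_of_le_of_ne (ceuS_le_one x) hS
  have h1 := distilled_ceuRho hS0 hS1.le hw hw1 hT κ
  have h2 := distilled_ceuP hS0 hS1.le hw hw1 hT κ
  have h3 := distilled_ceuA hS0 hS1 hw hw1 hT κ
  have h4 := distilled_ceuW hS0 hS1 hw hw1 hT κ
  have h5 := distilled_ceuG hS0 hS1 hw hw1 hT κ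
  have hv := velUp_div (g := ceuMetric κ) hT (ceuKilling_div κ w T)
  constructor
  · rintro ⟨ρ, p, A, W, G, k1, k2, k3, k4, k5, h⟩ μ ν
    rw [h, k1.unique h1, k2.unique h2, k3.unique h3, k4.unique h4, k5.unique h5, vel_congr hv,
      proj_congr hv, acc_congr hv, vort_congr hv, lvec_congr hv]
    unfold frameTensor
    norm_cast
    ring
  · intro h
    refine ⟨_, _, _, _, _, h1, h2, h3, h4, h5, fun μ ν => ?_⟩
    rw [h, vel_congr hv, proj_congr hv, acc_congr hv, vort_congr hv, lvec_congr hv]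
    unfold frameTensor
    norm_cast
    ring

/-! ### The matching conditions as equations between scalar coefficients -/

/-- The contraction of a bilinear form given by a product of covectors. -/
lemma sum_raise_mul {g : Metric} {x : Coord} {v : Fin 4 → ℝ} (hg : g x = Matrix.diagonal v)
    (hv : ∀ i, v i ≠ 0) (a b m n : Fin 4 → ℝ) :
    ∑ μ, ∑ ν, a μ * b ν * (m μ / v μ * (n ν / v ν)) = dot g x a m * dot g x b n := by
  rw [dot_diagonal hg hv, dot_diagonal hg hv, Finset.sum_mul_sum]
  exact Finset.sum_congr rfl fun _ _ => Finset.sum_congr rfl fun _ _ => by ring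

lemma sum_raise_metric {g : Metric} {x : Coord} {v : Fin 4 → ℝ} (hg : g x = Matrix.diagonal v)
    (hv : ∀ i, v i ≠ 0) (m n : Fin 4 → ℝ) :
    ∑ μ, ∑ ν, g x μ ν * (m μ / v μ * (n ν / v ν)) = dot g x m n := by
  rw [dot_diagonal hg hv]
  refine Finset.sum_congr rfl fun μ _ => ?_
  rw [Finset.sum_eq_single μ]
  · have := hv μ
    rw [hg, Matrix.diagonal_apply_eq]
    field_simp
  · intro ν _ h
    rw [hg, Matrix.diagonal_apply_ne _ h.symm, zero_mul]
  · simp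

lemma sum_raise_frameTensor {g : Metric} {β : VField} {x : Coord} {v : Fin 4 → ℝ}
    (hg : g x = Matrix.diagonal v) (hv : ∀ i, v i ≠ 0) (E p a w s : ℝ) (m n : Fin 4 → ℝ) :
    ∑ μ, ∑ ν, frameTensor g β x E p a w s μ ν * (m μ / v μ * (n ν / v ν))
      = E * (dot g x (vel g β x) m * dot g x (vel g β x) n)
        - p * (dot g x m n - dot g x (vel g β x) m * dot g x (vel g β x) n)
        + a * (dot g x (acc g β x) m * dot g x (acc g β x) n)
        + w * (dot g x (vort g β x) m * dot g x (vort g β x) n)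
        + s * (dot g x (vel g β x) m * dot g x (lvec g β x) n
          + dot g x (lvec g β x) m * dot g x (vel g β x) n) := by
  simp only [← sum_raise_mul hg hv _ _ m n]
  simp only [← sum_raise_metric hg hv m n, Finset.mul_sum, ← Finset.sum_add_distrib,
    ← Finset.sum_sub_distrib]
  refine Finset.sum_congr rfl fun μ _ => Finset.sum_congr rfl fun ν _ => ?_
  unfold frameTensor proj sym
  ring

lemma dot_comm_of_diagonal {g : Metric} {x : Coord} {v : Fin 4 → ℝ}
    (hg : g x = Matrix.diagonal v) (hv : ∀ i, v i ≠ 0)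
    (m n : Fin 4 → ℝ) : dot g x m n = dot g x n m := by
  rw [dot_diagonal hg hv, dot_diagonal hg hv]
  simp only [mul_comm]

/-- Orthogonality of `u`, `A`, `ω`, `l` lets the five coefficients be recovered by contraction.
Nonvanishing of `A²` and `l²` requires `y ≠ 0` and `o ≠ 0`. -/
lemma RotatingFrame.frameTensor_inj {g : Metric} {β : VField} {x : Coord} {v : Fin 4 → ℝ}
    {K y o : ℝ} (hg : g x = Matrix.diagonal v) (hv : ∀ i, v i ≠ 0)
    (h : RotatingFrame g β x K y o) (hy : y ≠ 0) {E p a w s E' p' a' w' s' : ℝ} :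
    frameTensor g β x E p a w s = frameTensor g β x E' p' a' w' s'
      ↔ E = E' ∧ p = p' ∧ a = a' ∧ w = w' ∧ s = s' := by
  refine ⟨fun he => ?_, by rintro ⟨rfl, rfl, rfl, rfl, rfl⟩; rfl⟩
  have key := fun m n : Fin 4 → ℝ => sum_raise_frameTensor (β := β) hg hv E p a w s m n
  simp only [he, sum_raise_frameTensor hg hv] at key
  have c := dot_comm_of_diagonal hg hv
  have h1 := key (vel g β x) (vel g β x)
  have h2 := key (lvec g β x) (lvec g β x)
  have h3 := key (acc g β x) (acc g β x)
  have h4 := key (vort g β x) (vort g β x)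
  have h5 := key (vel g β x) (lvec g β x)
  simp only [c (acc g β x) (vel g β x), c (vort g β x) (vel g β x), c (vort g β x) (acc g β x),
    c (acc g β x) (lvec g β x), c (vort g β x) (lvec g β x),
    h.vel_vel, h.acc_acc, h.vort_vort, h.acc_vort, h.vel_acc, h.vel_vort, h.vel_lvec, h.lvec_vel,
    h.lvec_acc, h.lvec_vort, h.lvec_lvec] at h1 h2 h3 h4 h5
  have ho := h.o_ne
  have hl : y * o ^ 2 ≠ 0 := mul_ne_zero hy (pow_ne_zero 2 ho)
  -- The contraction with `l l` comes first: `l` is orthogonal to `u`, `A` and `ω`, so it sees only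
  -- `p`.
  have hp : p = p' := mul_right_cancel₀ hl (by linear_combination -h2)
  subst hp
  refine ⟨by linear_combination -h1, rfl, ?_, ?_, ?_⟩
  · exact mul_right_cancel₀ (pow_ne_zero 2 (mul_ne_zero hy ho)) (by linear_combination -h3)
  · exact mul_right_cancel₀ (pow_ne_zero 2 ho) (by linear_combination -h4)
  · exact mul_right_cancel₀ hl (by linear_combination h5)

section

variable {κ w : ℝ} {x : Coord}

lemma matches_ceu_two (hκ : 0 < κ) (hw : 0 < w) (hw1 : w < 1) (h : CEURegular x)
    (hS : ceuS x ≠ 1) (k : SecondCoeffs) :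
    MatchesAtOrder 2 (fun T0 => IsCEUDistillate κ w T0 x)
      (fun T0 => secondOrder k (ceuMetric κ) (ceuKilling κ w T0) x) ↔
    (let K := κ ^ 2
     let y := ceuS x * w ^ 2
     let o := ceuVortSq κ w x
     1 / (1 - y) * (k.b1 * (y * o) + k.b2 * o + 6 * K * k.b3
        - 2 * K * (k.b4 + k.d4 + 2 * k.d5) * (y * (1 - y)⁻¹))
        = κ ^ 2 * w ^ 2 * (1 - ceuS x) / (36 * (1 - y) ^ 3) ∧
      1 / (1 - y) * (k.c1 * (y * o) + k.c2 * o + 6 * K * k.c3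
        - 2 * K * (k.c4 * y + k.d4) * (1 - y)⁻¹)
        = κ ^ 2 * w ^ 2 * (1 - ceuS x) / (36 * (1 - y) ^ 3) ∧
      1 / (1 - y) * (k.d1 - 2 * K * k.d4 * ((1 - y)⁻¹ * o⁻¹)) = 0 ∧
      1 / (1 - y) * (k.d2 - 2 * K * k.d4 * (y * (1 - y)⁻¹ * o⁻¹)) = -1 / (18 * (1 - y)) ∧
      1 / (1 - y) * (k.d3 - 2 * K * (k.d4 + k.d5) * ((1 - y)⁻¹ * o⁻¹))
        = -(1 - w ^ 2) / (18 * (1 - ceuS x) * w ^ 2 * (1 - y))) := by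
  have hf := rotatingFrame_ceu hκ hw hw1 h hS
  have hy : ceuS x * w ^ 2 ≠ 0 := mul_ne_zero h.ceuS_pos.ne' (pow_ne_zero 2 hw.ne')
  rw [matchesAtOrder_two_iff (φ := secondOrder k (ceuMetric κ) (ceuKilling κ w 1) x)
    (fun T hT => isCEUDistillate_iff hS hw hw1 hT)
    (fun T hT => secondOrder_div hT (ceuKilling_div κ w T) k), hf.secondOrder_eq,
    temp_ceu hκ hw.le hw1, hf.frameTensor_inj (ceuMetric_apply κ x) (h.diag_ne_zero hκ) hy]
  rfl

lemma matches_ceu_four (hκ : 0 < κ) (hw : 0 < w) (hw1 : w < 1) (h : CEURegular x)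
    (hS : ceuS x ≠ 1) (k : FourthCoeffs) :
    MatchesAtOrder 4 (fun T0 => IsCEUDistillate κ w T0 x)
      (fun T0 => fourthOrder k (ceuMetric κ) (ceuKilling κ w T0) x) ↔
    (let K := κ ^ 2
     let S := ceuS x
     let y := S * w ^ 2
     let o := ceuVortSq κ w x
     rotatingRho k K y o
        = -(κ ^ 4 * (1 / 20 - 1 / 3 * w ^ 2 + 1 / 6 * w ^ 4 + S * (8 / 15 * w ^ 2
            - 5 / 6 * w ^ 4 + 8 / 15 * w ^ 6) + S ^ 2 * (1 / 6 * w ^ 4 - 1 / 3 * w ^ 6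
            + 1 / 20 * w ^ 8)) / (24 * Real.pi ^ 2 * (1 - y) ^ 4)) ∧
      rotatingP k K y o
        = -(κ ^ 4 * (1 / 30 - 2 / 3 * w ^ 2 + 1 / 3 * w ^ 4 + S * (32 / 15 * w ^ 2
            - 11 / 3 * w ^ 4 + 32 / 15 * w ^ 6) + S ^ 2 * (1 / 3 * w ^ 4 - 2 / 3 * w ^ 6
            + 1 / 30 * w ^ 8)) / (48 * Real.pi ^ 2 * (1 - y) ^ 4)) ∧
      rotatingA k K y o
        = κ ^ 2 * (1 - w ^ 2) ^ 2 / (24 * Real.pi ^ 2 * (1 - S) * w ^ 2 * (1 - y) ^ 2) ∧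
      rotatingW k K y o
        = -(κ ^ 2 * (1 / 3 * w ^ 2 - 1 / 6 * w ^ 4 + S * (-5 / 6 * w ^ 2 + 4 / 3 * w ^ 4
            - 5 / 6 * w ^ 6) + S ^ 2 * (-1 / 6 * w ^ 4 + 1 / 3 * w ^ 6))
            / (12 * Real.pi ^ 2 * (1 - S) * w ^ 2 * (1 - y) ^ 2)) ∧
      rotatingG k K y o
        = κ ^ 2 * (1 - w ^ 4) / (360 * Real.pi ^ 2 * (1 - S) * w ^ 2 * (1 - y))) := by
  have hf := rotatingFrame_ceu hκ hw hw1 h hS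
  have hy : ceuS x * w ^ 2 ≠ 0 := mul_ne_zero h.ceuS_pos.ne' (pow_ne_zero 2 hw.ne')
  rw [matchesAtOrder_four_iff (φ := fourthOrder k (ceuMetric κ) (ceuKilling κ w 1) x)
    (fun T hT => isCEUDistillate_iff hS hw hw1 hT)
    (fun T hT => fourthOrder_div hT (ceuKilling_div κ w T) k), hf.fourthOrder_eq,
    hf.frameTensor_inj (ceuMetric_apply κ x) (h.diag_ne_zero hκ) hy]

end

/-- The acceleration is purely radial, so the `φφ` component isolates `p` and the `tt` component
isolates `E`. The `rr` component then gives `a`, for which `K ≠ 0` is needed. -/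
lemma spaceForm_tensor_eq_iff {K : ℝ} {x : Coord} (h : SpaceFormRegular K x) (hK : K ≠ 0)
    (E p a c : ℝ) : (∀ μ ν, E * (vel (spaceForm K) (staticKilling 1) x μ
          * vel (spaceForm K) (staticKilling 1) x ν)
        - p * proj (spaceForm K) (staticKilling 1) x μ ν
        + a * (acc (spaceForm K) (staticKilling 1) x μ
          * acc (spaceForm K) (staticKilling 1) x ν) = radiationTensor (spaceForm K) x c μ ν)
      ↔ E = 3 * c ∧ p = c ∧ a = 0 := by
  have hp := h.f_pos.ne'
  have hr := h.r_pos.ne'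
  have hs := h.sin_pos.ne'
  have h2 := Real.sq_sqrt h.f_pos.le
  unfold radiationTensor
  constructor
  · intro he
    have h00 := he 0 0
    have h11 := he 1 1
    have h33 := he 3 3
    simp only [proj, vel_spaceForm h, acc_spaceForm h, spaceForm_apply, spaceFormDiag,
      Matrix.diagonal_apply_eq, Matrix.cons_val] at h00 h11 h33
    rw [← pow_two, h2] at h00
    have hpc : p = c := by
      have : x 1 ^ 2 * Real.sin (x 2) ^ 2 ≠ 0 := by positivity
      refine mul_right_cancel₀ this ?_
      linear_combination h33
    refine ⟨mul_right_cancel₀ hp ?_, hpc, ?_⟩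
    · linear_combination h00
    · have : (K * x 1 / (1 + K * x 1 ^ 2)) ^ 2 ≠ 0 := by positivity
      refine mul_right_cancel₀ this ?_
      rw [hpc] at h11
      linear_combination h11
  · rintro ⟨rfl, rfl, rfl⟩ μ ν
    ring

/-- Here `A = 0`, so the coefficient `a` is unconstrained. -/
lemma ceu_static_tensor_eq_iff {κ : ℝ} (hκ : 0 < κ) {x : Coord} (h : CEURegular x)
    (E p a c : ℝ) : (∀ μ ν, E * (vel (ceuMetric κ) (staticKilling 1) x μ
          * vel (ceuMetric κ) (staticKilling 1) x ν)
        - p * proj (ceuMetric κ) (staticKilling 1) x μ ν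
        + a * (acc (ceuMetric κ) (staticKilling 1) x μ
          * acc (ceuMetric κ) (staticKilling 1) x ν) = radiationTensor (ceuMetric κ) x c μ ν)
      ↔ E = 3 * c ∧ p = c := by
  have ha : acc (ceuMetric κ) (staticKilling 1) x = 0 := by
    rw [← ceuKilling_zero κ 1, acc_ceu hκ le_rfl one_pos h]
    simp
  unfold radiationTensor
  constructor
  · intro he
    have h00 := he 0 0
    have h11 := he 1 1
    simp only [proj, vel_ceu_static hκ, ha, ceuMetric_apply, ceuDiag, Pi.zero_apply,
      Matrix.diagonal_apply_eq, Matrix.cons_val] at h00 h11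
    have : 1 / κ ^ 2 ≠ 0 := by positivity
    refine ⟨by linear_combination h00, mul_right_cancel₀ this ?_⟩
    linear_combination h11
  · rintro ⟨rfl, rfl⟩ μ ν
    simp only [ha, Pi.zero_apply]
    ring

section

variable {K κ ε : ℝ} {x : Coord}

/-- The target `T₀²` part vanishes, so the positive factor `T²` can be cancelled. The statement
serves AdS and dS alike. -/
lemma secondOrder_static_iff {P : ℝ → (Fin 4 → Fin 4 → ℂ) → Prop} {d0 d4 : Tensor2}
    (h : SpaceFormRegular K x) (hK : K ≠ 0)
    (hP : ∀ T : ℝ, 0 < T → ∀ D, P T D ↔ ∀ μ ν, D μ ν = ((d0 μ ν * T ^ 4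
      + (fun _ _ => 0 : Tensor2) μ ν * T ^ 2 + d4 μ ν : ℝ) : ℂ)) (k : SecondCoeffs) :
    MatchesAtOrder 2 P (fun T0 => secondOrder k (spaceForm K) (staticKilling T0) x) ↔
    (let α := -(K ^ 2 * x 1 ^ 2 / (1 + K * x 1 ^ 2))
     k.b1 * α - 3 * K * (4 * k.b3 + k.b4 + k.d4 + 2 * k.d5) = 0 ∧
      k.c1 * α - 3 * K * (4 * k.c3 + k.c4 - k.d4) = 0 ∧ k.d1 = 0) := by
  have hf := staticFrame_spaceForm h
  have hp := h.f_pos.ne'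
  have ht : temp (spaceForm K) (staticKilling 1) x ^ 2 ≠ 0 := by
    rw [temp_spaceForm h]
    positivity
  rw [matchesAtOrder_two_iff (φ := secondOrder k (spaceForm K) (staticKilling 1) x) hP
    (fun T hT => secondOrder_div hT (staticKilling_div T) k)]
  have h0 : (fun _ _ => 0 : Tensor2) = radiationTensor (spaceForm K) x 0 := by
    funext μ ν
    simp [radiationTensor]
  have h1 := spaceForm_tensor_eq_iff h hK
    (k.b1 * -(K ^ 2 * x 1 ^ 2 / (1 + K * x 1 ^ 2)) - 3 * K * (4 * k.b3 + k.b4 + k.d4 + 2 * k.d5))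
    (k.c1 * -(K ^ 2 * x 1 ^ 2 / (1 + K * x 1 ^ 2)) - 3 * K * (4 * k.c3 + k.c4 - k.d4)) k.d1 0
  rw [mul_zero] at h1
  rw [← h1, funext_iff]
  refine forall_congr' fun μ => ?_
  rw [funext_iff]
  refine forall_congr' fun ν => ?_
  rw [hf.secondOrder_eq]
  have h3 : radiationTensor (spaceForm K) x 0 μ ν = 0 := by simp [radiationTensor]
  rw [h3, mul_eq_zero, or_iff_right ht]
  ring_nf

lemma fourthOrder_static_iff {P : ℝ → (Fin 4 → Fin 4 → ℂ) → Prop} {d0 d2 : Tensor2} {c : ℝ}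
    (h : SpaceFormRegular K x) (hK : K ≠ 0)
    (hP : ∀ T : ℝ, 0 < T → ∀ D, P T D ↔ ∀ μ ν, D μ ν = ((d0 μ ν * T ^ 4
      + d2 μ ν * T ^ 2 + radiationTensor (spaceForm K) x c μ ν : ℝ) : ℂ)) (k : FourthCoeffs) :
    MatchesAtOrder 4 P (fun T0 => fourthOrder k (spaceForm K) (staticKilling T0) x) ↔
    (let α := -(K ^ 2 * x 1 ^ 2 / (1 + K * x 1 ^ 2))
     staticRho k (-3 * K) (-3 * K) α = 3 * c ∧ staticP k (-3 * K) (-3 * K) α = c ∧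
      k.d1 * α + k.d3 * (3 * (-3 * K) + -3 * K) + k.d4 * (-3 * K) + 2 * k.pRA * (-3 * K) = 0) := by
  have hf := staticFrame_spaceForm h
  rw [matchesAtOrder_four_iff (φ := fourthOrder k (spaceForm K) (staticKilling 1) x) hP
    (fun T hT => fourthOrder_div hT (staticKilling_div T) k)]
  simp only
  rw [← spaceForm_tensor_eq_iff h hK, funext_iff]
  refine forall_congr' fun μ => ?_
  rw [funext_iff]
  refine forall_congr' fun ν => ?_
  rw [hf.fourthOrder_eq]

lemma matches_ceuStatic_two (hκ : 0 < κ) (h : CEURegular x) (k : SecondCoeffs) :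
    MatchesAtOrder 2 (fun T0 => IsCEUStaticDistillate κ T0 x)
      (fun T0 => secondOrder k (ceuMetric κ) (staticKilling T0) x) ↔
    k.b3 = 0 ∧ 3 * k.c3 = k.d4 := by
  have hf := staticFrame_ceu hκ h
  have ht : temp (ceuMetric κ) (staticKilling 1) x ^ 2 = 1 := by
    rw [← ceuKilling_zero κ 1, temp_ceu hκ le_rfl one_pos]
    simp [ceuLapse]
  have hk : 2 * κ ^ 2 ≠ 0 := by positivity
  rw [matchesAtOrder_two_iff (φ := secondOrder k (ceuMetric κ) (staticKilling 1) x)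
    (fun T hT => isCEUStaticDistillate_iff hT)
    (fun T hT => secondOrder_div hT (staticKilling_div T) k)]
  have h1 := ceu_static_tensor_eq_iff hκ h (3 * k.b3 * (2 * κ ^ 2))
    ((3 * k.c3 - k.d4) * (2 * κ ^ 2)) k.d1 0
  rw [mul_zero, mul_eq_zero_iff_right hk, mul_eq_zero_iff_right hk, sub_eq_zero,
    mul_eq_zero_iff_left three_ne_zero] at h1
  rw [← h1, funext_iff]
  refine forall_congr' fun μ => ?_
  rw [funext_iff]
  refine forall_congr' fun ν => ?_
  rw [hf.secondOrder_eq, ht]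
  have h3 : radiationTensor (ceuMetric κ) x 0 μ ν = 0 := by simp [radiationTensor]
  rw [h3]
  ring_nf

lemma matches_ceuStatic_four (hκ : 0 < κ) (h : CEURegular x) (k : FourthCoeffs) :
    MatchesAtOrder 4 (fun T0 => IsCEUStaticDistillate κ T0 x)
      (fun T0 => fourthOrder k (ceuMetric κ) (staticKilling T0) x) ↔
    staticRho k (2 * κ ^ 2) 0 0 = 3 * -(κ ^ 4 / (1440 * Real.pi ^ 2)) ∧
      staticP k (2 * κ ^ 2) 0 0 = -(κ ^ 4 / (1440 * Real.pi ^ 2)) := by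
  have hf := staticFrame_ceu hκ h
  rw [matchesAtOrder_four_iff (φ := fourthOrder k (ceuMetric κ) (staticKilling 1) x)
    (fun T hT => isCEUStaticDistillate_iff hT)
    (fun T hT => fourthOrder_div hT (staticKilling_div T) k),
    ← ceu_static_tensor_eq_iff hκ h _ _ (k.d1 * 0 + k.d3 * (3 * (2 * κ ^ 2) + 0) + k.d4 * 0
      + 2 * k.pRA * (2 * κ ^ 2)), funext_iff]
  refine forall_congr' fun μ => ?_
  rw [funext_iff]
  refine forall_congr' fun ν => ?_
  rw [hf.fourthOrder_eq]

end

/-! ### The solution at second order -/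

lemma spaceFormRegular_ads {κ : ℝ} {x : Coord} (h1 : 0 < x 1) (h2 : 0 < x 2)
    (h3 : x 2 < Real.pi) : SpaceFormRegular (κ ^ 2) x :=
  ⟨by positivity, h1, Real.sin_pos_of_pos_of_lt_pi h2 h3⟩

lemma spaceFormRegular_ds {κ : ℝ} {x : Coord} (hκ : 0 < κ) (h1 : 0 < x 1) (hx : κ * x 1 < 1)
    (h2 : 0 < x 2) (h3 : x 2 < Real.pi) : SpaceFormRegular (-κ ^ 2) x :=
  ⟨by nlinarith [mul_pos hκ h1], h1, Real.sin_pos_of_pos_of_lt_pi h2 h3⟩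

lemma ceuRegular_of_mem {x : Coord} (h1 : 0 < x 1) (h1' : x 1 < Real.pi) (h2 : 0 < x 2)
    (h3 : x 2 < Real.pi) : CEURegular x :=
  ⟨Real.sin_pos_of_pos_of_lt_pi h1 h1', Real.sin_pos_of_pos_of_lt_pi h2 h3⟩

/-- On the plane `θ = π/2` one has `S = sin²χ`. -/
lemma exists_ceuS_eq {S : ℝ} (h0 : 0 < S) (h1 : S < 1) : ∃ x : Coord, 0 < x 1 ∧
    x 1 < Real.pi ∧ 0 < x 2 ∧ x 2 < Real.pi ∧ ceuS x = S := by
  have hs := Real.sqrt_pos.mpr h0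
  have hs1 : Real.sqrt S ≤ 1 := Real.sqrt_le_one.mpr h1.le
  have hpi := Real.pi_pos
  refine ⟨![0, Real.arcsin (Real.sqrt S), Real.pi / 2, 0], ?_, ?_, ?_, ?_, ?_⟩
  · exact Real.arcsin_pos.mpr hs
  · exact (Real.arcsin_le_pi_div_two _).trans_lt (by linarith)
  · exact half_pos hpi
  · exact half_lt_self hpi
  · change Real.sin (Real.arcsin (Real.sqrt S)) ^ 2 * Real.sin (Real.pi / 2) ^ 2 = S
    rw [Real.sin_arcsin (by linarith) hs1, Real.sq_sqrt h0.le, Real.sin_pi_div_two]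
    ring

lemma matchesDistillates_two {k : SecondCoeffs} (hk : k.b1 = 0 ∧ k.b2 = -1 / 36 ∧ k.b3 = 0 ∧
    k.b4 = 1 / 18 ∧ k.c1 = 0 ∧ k.c2 = -1 / 36 ∧ k.c3 = 0 ∧ k.c4 = 0 ∧ k.d1 = 0 ∧
    k.d2 = -1 / 18 ∧ k.d3 = 1 / 18 ∧ k.d4 = 0 ∧ k.d5 = -1 / 36) :
    MatchesDistillates 2 (secondOrder k) := by
  obtain ⟨b1, b2, b3, b4, c1, c2, c3, c4, d1, d2, d3, d4, d5⟩ := hk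
  refine ⟨?_, ?_, ?_, ?_⟩
  · intro ε _ κ hκ x h1 h2 h3
    simp only [adsMetric_eq]
    refine (secondOrder_static_iff (spaceFormRegular_ads h1 h2 h3) (by positivity)
      (fun T hT => isAdSDistillate_iff hκ h1 hT) k).mpr ?_
    simp only [b1, b3, b4, c1, c3, c4, d1, d4, d5]
    norm_num
  · intro κ hκ x h1 hx h2 h3
    simp only [dsMetric_eq]
    refine (secondOrder_static_iff (spaceFormRegular_ds hκ h1 hx h2 h3)
      (neg_ne_zero.mpr (by positivity)) (fun T hT => isDSDistillate_iff hT) k).mpr ?_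
    simp only [b1, b3, b4, c1, c3, c4, d1, d4, d5]
    norm_num
  · intro κ hκ x h1 h1' h2 h3
    rw [matches_ceuStatic_two hκ (ceuRegular_of_mem h1 h1' h2 h3)]
    rw [b3, c3, d4]
    norm_num
  · intro κ hκ w hw hw1 x h1 h1' h2 h3 hS
    rw [matches_ceu_two hκ hw hw1 (ceuRegular_of_mem h1 h1' h2 h3) hS]
    have hP : 1 - ceuS x * w ^ 2 ≠ 0 := (ceuLapse_pos hw.le hw1 x).ne'
    have hS' : 1 - ceuS x ≠ 0 := sub_ne_zero.mpr hS.symm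
    simp only [b1, b2, b3, b4, c1, c2, c3, c4, d1, d2, d3, d4, d5, ceuVortSq]
    generalize ceuS x = S at *
    refine ⟨?_, ?_, ?_, ?_, ?_⟩ <;> field_simp <;> ring

lemma ceu_two_equations {k : SecondCoeffs} (hk : MatchesDistillates 2 (secondOrder k)) {S w : ℝ}
    (hS : 0 < S) (hS1 : S < 1) (hw : 0 < w) (hw1 : w < 1) :
    (let y := S * w ^ 2
     let o := -(1 ^ 2 * w ^ 2 * (1 - S) / (1 - y) ^ 2)
     1 / (1 - y) * (k.b1 * (y * o) + k.b2 * o + 6 * 1 ^ 2 * k.b3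
        - 2 * 1 ^ 2 * (k.b4 + k.d4 + 2 * k.d5) * (y * (1 - y)⁻¹))
        = 1 ^ 2 * w ^ 2 * (1 - S) / (36 * (1 - y) ^ 3) ∧
      1 / (1 - y) * (k.c1 * (y * o) + k.c2 * o + 6 * 1 ^ 2 * k.c3
        - 2 * 1 ^ 2 * (k.c4 * y + k.d4) * (1 - y)⁻¹)
        = 1 ^ 2 * w ^ 2 * (1 - S) / (36 * (1 - y) ^ 3) ∧
      1 / (1 - y) * (k.d1 - 2 * 1 ^ 2 * k.d4 * ((1 - y)⁻¹ * o⁻¹)) = 0 ∧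
      1 / (1 - y) * (k.d2 - 2 * 1 ^ 2 * k.d4 * (y * (1 - y)⁻¹ * o⁻¹)) = -1 / (18 * (1 - y)) ∧
      1 / (1 - y) * (k.d3 - 2 * 1 ^ 2 * (k.d4 + k.d5) * ((1 - y)⁻¹ * o⁻¹))
        = -(1 - w ^ 2) / (18 * (1 - S) * w ^ 2 * (1 - y))) := by
  obtain ⟨x, h1, h1', h2, h3, rfl⟩ := exists_ceuS_eq hS hS1
  exact (matches_ceu_two one_pos hw hw1 (ceuRegular_of_mem h1 h1' h2 h3) hS1.ne k).mp
    (hk.ceu 1 one_pos w hw hw1 x h1 h1' h2 h3 hS1.ne)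

/-- Finitely many sample points give a linear system that already determines the thirteen
coefficients, so neither dS nor other values of `κ` and `ε` are needed for necessity. -/
lemma secondCoeffs_of_matches {k : SecondCoeffs} (hk : MatchesDistillates 2 (secondOrder k)) :
    k.b1 = 0 ∧ k.b2 = -1 / 36 ∧ k.b3 = 0 ∧
    k.b4 = 1 / 18 ∧ k.c1 = 0 ∧ k.c2 = -1 / 36 ∧ k.c3 = 0 ∧ k.c4 = 0 ∧ k.d1 = 0 ∧
    k.d2 = -1 / 18 ∧ k.d3 = 1 / 18 ∧ k.d4 = 0 ∧ k.d5 = -1 / 36 := by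
  have hpi := Real.pi_pos
  have ads : ∀ r : ℝ, 0 < r → _ := fun r hr =>
    (secondOrder_static_iff (x := ![0, r, Real.pi / 2, 0])
      (spaceFormRegular_ads (κ := 1) hr (half_pos hpi) (half_lt_self hpi)) (by norm_num)
      (fun T hT => isAdSDistillate_iff one_pos hr hT) k).mp
      (hk.ads 0 (by simp) 1 one_pos ![0, r, Real.pi / 2, 0] hr (half_pos hpi)
        (half_lt_self hpi))
  -- Two radii give two values of `A²` at fixed curvature, which separates `b1` and `c1` from the
  -- curvature coefficients.
  obtain ⟨a1, a2, d1⟩ := ads 1 one_pos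
  obtain ⟨a3, a4, -⟩ := ads 2 two_pos
  simp only [Matrix.cons_val_one, Matrix.cons_val_zero] at a1 a2 a3 a4
  norm_num at a1 a2 a3 a4
  obtain ⟨x, h1, h1', h2, h3, -⟩ := exists_ceuS_eq (S := 1 / 2) (by norm_num) (by norm_num)
  obtain ⟨b3, c3⟩ := (matches_ceuStatic_two one_pos (ceuRegular_of_mem h1 h1' h2 h3) k).mp
    (hk.ceuStatic 1 one_pos x h1 h1' h2 h3)
  obtain ⟨e1, e2, e3, e4, e5⟩ := ceu_two_equations hk (S := 1 / 2) (w := 1 / 2)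
    (by norm_num) (by norm_num) (by norm_num) (by norm_num)
  -- A second angular velocity separates `d3` from `d4 + d5` in the coefficient of `u l`.
  obtain ⟨-, -, -, -, e6⟩ := ceu_two_equations hk (S := 1 / 2) (w := 1 / 3)
    (by norm_num) (by norm_num) (by norm_num) (by norm_num)
  norm_num at e1 e2 e3 e4 e5 e6
  refine ⟨?_, ?_, ?_, ?_, ?_, ?_, ?_, ?_, ?_, ?_, ?_, ?_, ?_⟩ <;> linarith

/-! ### The solutions at fourth order -/

/-- A solution of the matching conditions at fourth order. -/
def fourthSolution : FourthCoeffs where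
  b1 := -1 / (480 * Real.pi ^ 2)
  b2 := -1 / (1440 * Real.pi ^ 2)
  b3 := -1 / (432 * Real.pi ^ 2)
  b4 := -1 / (4320 * Real.pi ^ 2)
  b5 := -1 / (144 * Real.pi ^ 2)
  b6 := -1 / (45 * Real.pi ^ 2)
  b7 := -17 / (1440 * Real.pi ^ 2)
  b8 := 19 / (4320 * Real.pi ^ 2)
  b9 := 1 / (240 * Real.pi ^ 2)
  b10 := -7 / (360 * Real.pi ^ 2)
  b11 := 0
  b12 := 1 / (1920 * Real.pi ^ 2)
  b13 := 0
  b14 := 0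
  b15 := 0
  b16 := 0
  c1 := -1 / (1440 * Real.pi ^ 2)
  c2 := -1 / (4320 * Real.pi ^ 2)
  c3 := 5 / (432 * Real.pi ^ 2)
  c4 := 7 / (6480 * Real.pi ^ 2)
  c5 := -1 / (144 * Real.pi ^ 2)
  c6 := -2 / (45 * Real.pi ^ 2)
  c7 := 1 / (480 * Real.pi ^ 2)
  c8 := -1 / (240 * Real.pi ^ 2)
  c9 := 1 / (720 * Real.pi ^ 2)
  c10 := 1 / (360 * Real.pi ^ 2)
  c11 := 0
  c12 := 1 / (5760 * Real.pi ^ 2)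
  c13 := 0
  c14 := 0
  c15 := 0
  c16 := 0
  d1 := 0
  d2 := -1 / (24 * Real.pi ^ 2)
  d3 := 0
  d4 := 0
  e1 := -5 / (72 * Real.pi ^ 2)
  e2 := -1 / (72 * Real.pi ^ 2)
  e3 := -1 / (216 * Real.pi ^ 2)
  e4 := 1 / (36 * Real.pi ^ 2)
  f1 := -1 / (360 * Real.pi ^ 2)
  f2 := 1 / (360 * Real.pi ^ 2)
  f3 := 1 / (72 * Real.pi ^ 2)
  f4 := -7 / (180 * Real.pi ^ 2)
  g1 := 0
  g2 := 1 / (24 * Real.pi ^ 2)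
  g3 := 1 / (288 * Real.pi ^ 2)
  g4 := -1 / (96 * Real.pi ^ 2)
  h1 := 0
  h2 := 0
  h3 := -7 / (2160 * Real.pi ^ 2)
  h4 := 13 / (1440 * Real.pi ^ 2)
  i1 := 0
  pRA := 0
  pRw := 0
  pRR := 0
  pRuRu := 0
  puRl := 0
  plRu := 0

lemma fourthSolution_static {K r : ℝ} (h : 1 + K * r ^ 2 ≠ 0) :
    (let α := -(K ^ 2 * r ^ 2 / (1 + K * r ^ 2))
     let c := -(K ^ 2 / (1440 * Real.pi ^ 2)) / (1 + K * r ^ 2) ^ 2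
     staticRho fourthSolution (-3 * K) (-3 * K) α = 3 * c ∧
      staticP fourthSolution (-3 * K) (-3 * K) α = c ∧
      fourthSolution.d1 * α + fourthSolution.d3 * (3 * (-3 * K) + -3 * K)
        + fourthSolution.d4 * (-3 * K) + 2 * fourthSolution.pRA * (-3 * K) = 0) := by
  have hpi := Real.pi_ne_zero
  simp only [staticRho, staticP, fourthSolution]
  refine ⟨?_, ?_, by ring⟩ <;> field_simp <;> ring

lemma fourthSolution_rotating {κ w S : ℝ} (hκ : κ ≠ 0) (hw : w ≠ 0) (hS : 1 - S ≠ 0)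
    (hP : 1 - S * w ^ 2 ≠ 0) :
    (let K := κ ^ 2
     let y := S * w ^ 2
     let o := -(κ ^ 2 * w ^ 2 * (1 - S) / (1 - S * w ^ 2) ^ 2)
     rotatingRho fourthSolution K y o
        = -(κ ^ 4 * (1 / 20 - 1 / 3 * w ^ 2 + 1 / 6 * w ^ 4 + S * (8 / 15 * w ^ 2
            - 5 / 6 * w ^ 4 + 8 / 15 * w ^ 6) + S ^ 2 * (1 / 6 * w ^ 4 - 1 / 3 * w ^ 6
            + 1 / 20 * w ^ 8)) / (24 * Real.pi ^ 2 * (1 - y) ^ 4)) ∧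
      rotatingP fourthSolution K y o
        = -(κ ^ 4 * (1 / 30 - 2 / 3 * w ^ 2 + 1 / 3 * w ^ 4 + S * (32 / 15 * w ^ 2
            - 11 / 3 * w ^ 4 + 32 / 15 * w ^ 6) + S ^ 2 * (1 / 3 * w ^ 4 - 2 / 3 * w ^ 6
            + 1 / 30 * w ^ 8)) / (48 * Real.pi ^ 2 * (1 - y) ^ 4)) ∧
      rotatingA fourthSolution K y o
        = κ ^ 2 * (1 - w ^ 2) ^ 2 / (24 * Real.pi ^ 2 * (1 - S) * w ^ 2 * (1 - y) ^ 2) ∧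
      rotatingW fourthSolution K y o
        = -(κ ^ 2 * (1 / 3 * w ^ 2 - 1 / 6 * w ^ 4 + S * (-5 / 6 * w ^ 2 + 4 / 3 * w ^ 4
            - 5 / 6 * w ^ 6) + S ^ 2 * (-1 / 6 * w ^ 4 + 1 / 3 * w ^ 6))
            / (12 * Real.pi ^ 2 * (1 - S) * w ^ 2 * (1 - y) ^ 2)) ∧
      rotatingG fourthSolution K y o
        = κ ^ 2 * (1 - w ^ 4) / (360 * Real.pi ^ 2 * (1 - S) * w ^ 2 * (1 - y))) := by
  have hpi := Real.pi_ne_zero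
  simp only [rotatingRho, rotatingP, rotatingA, rotatingW, rotatingG, fourthSolution]
  refine ⟨?_, ?_, ?_, ?_, ?_⟩ <;> field_simp <;> ring

/-- All conditions reduce to rational identities in `K`, `r` and in `κ`, `S`, `w`. The coefficients
of `A · ω` terms never enter, because `A · ω = 0` in every state considered. -/
lemma matchesDistillates_fourthSolution : MatchesDistillates 4 (fourthOrder fourthSolution) := by
  refine ⟨?_, ?_, ?_, ?_⟩
  · intro ε _ κ hκ x h1 h2 h3
    have h := spaceFormRegular_ads (κ := κ) h1 h2 h3
    simp only [adsMetric_eq]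
    refine (fourthOrder_static_iff h (by positivity)
      (fun T hT => isAdSDistillate_iff hκ h1 hT) _).mpr ?_
    have := fourthSolution_static h.f_pos.ne'
    simp only [show (κ ^ 2) ^ 2 = κ ^ 4 by ring] at this ⊢
    exact this
  · intro κ hκ x h1 hx h2 h3
    have h := spaceFormRegular_ds hκ h1 hx h2 h3
    simp only [dsMetric_eq]
    refine (fourthOrder_static_iff h (neg_ne_zero.mpr (by positivity))
      (fun T hT => isDSDistillate_iff hT) _).mpr ?_
    have := fourthSolution_static h.f_pos.ne'
    simp only [show (-κ ^ 2) ^ 2 = κ ^ 4 by ring] at this ⊢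
    exact this
  · intro κ hκ x h1 h1' h2 h3
    rw [matches_ceuStatic_four hκ (ceuRegular_of_mem h1 h1' h2 h3)]
    have hpi := Real.pi_ne_zero
    simp only [staticRho, staticP, fourthSolution]
    constructor <;> field_simp <;> ring
  · intro κ hκ w hw hw1 x h1 h1' h2 h3 hS
    rw [matches_ceu_four hκ hw hw1 (ceuRegular_of_mem h1 h1' h2 h3) hS]
    exact fourthSolution_rotating hκ.ne' hw.ne' (sub_ne_zero.mpr hS.symm)
      (ceuLapse_pos hw.le hw1 x).ne'

/-- The matching conditions in a closed Einstein universe of unit radius, in terms of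
`y = S ω₀²` and `u = -ω²`. -/
lemma ceu_four_equations {k : FourthCoeffs} (hk : MatchesDistillates 4 (fourthOrder k)) {y u : ℝ}
    (hy : 0 < y) (hy1 : y < 1) (hu : 0 < u) (hu1 : u * (1 - y) < 1) :
    (let t := y + (1 - y) ^ 2 * u
     rotatingRho k 1 y (-u) = -((1 / 20 - 1 / 3 * t + 1 / 6 * t ^ 2
        + y * (8 / 15 - 5 / 6 * t + 8 / 15 * t ^ 2) + y ^ 2 * (1 / 6 - 1 / 3 * t
        + 1 / 20 * t ^ 2)) / (24 * Real.pi ^ 2 * (1 - y) ^ 4)) ∧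
      rotatingP k 1 y (-u) = -((1 / 30 - 2 / 3 * t + 1 / 3 * t ^ 2
        + y * (32 / 15 - 11 / 3 * t + 32 / 15 * t ^ 2) + y ^ 2 * (1 / 3 - 2 / 3 * t
        + 1 / 30 * t ^ 2)) / (48 * Real.pi ^ 2 * (1 - y) ^ 4)) ∧
      u * rotatingA k 1 y (-u) = (1 - t) ^ 2 / (24 * Real.pi ^ 2 * (1 - y) ^ 4) ∧
      u * rotatingW k 1 y (-u) = -((1 / 3 * t - 1 / 6 * t ^ 2
        + y * (-5 / 6 + 4 / 3 * t - 5 / 6 * t ^ 2) + y ^ 2 * (-1 / 6 + 1 / 3 * t))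
        / (12 * Real.pi ^ 2 * (1 - y) ^ 4)) ∧
      u * rotatingG k 1 y (-u) = (1 - t ^ 2) / (360 * Real.pi ^ 2 * (1 - y) ^ 3)) := by
  intro t
  have hy2 : 0 < 1 - y := sub_pos.mpr hy1
  have hyt : y < t := lt_add_of_pos_right _ (by positivity)
  have ht : 0 < t := hy.trans hyt
  have ht1 : t < 1 := by
    have : (1 - y) * (u * (1 - y)) < (1 - y) * 1 := mul_lt_mul_of_pos_left hu1 hy2
    change y + (1 - y) ^ 2 * u < 1
    linarith
  have hw := Real.sqrt_pos.mpr ht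
  have hw2 := Real.sq_sqrt ht.le
  have hw1 : Real.sqrt t < 1 := (Real.sqrt_lt' one_pos).mpr (by simpa using ht1)
  obtain ⟨x, h1, h1', h2, h3, hx⟩ := exists_ceuS_eq (div_pos hy ht) ((div_lt_one ht).mpr hyt)
  have hS : ceuS x ≠ 1 := hx ▸ ((div_lt_one ht).mpr hyt).ne
  have key := (matches_ceu_four one_pos hw hw1 (ceuRegular_of_mem h1 h1' h2 h3) hS k).mp
    (hk.ceu 1 one_pos _ hw hw1 x h1 h1' h2 h3 hS)
  have hn : ∀ n, Real.sqrt t ^ (2 * n) = t ^ n := fun n => by rw [pow_mul, hw2]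
  have h4 : Real.sqrt t ^ 4 = t ^ 2 := hn 2
  have h6 : Real.sqrt t ^ 6 = t ^ 3 := hn 3
  have h8 : Real.sqrt t ^ 8 = t ^ 4 := hn 4
  have ho : ceuVortSq 1 (Real.sqrt t) x = -u := by
    unfold ceuVortSq
    rw [hw2, hx, div_mul_cancel₀ _ ht.ne', neg_inj, div_eq_iff (by positivity), mul_assoc,
      mul_sub, mul_div_cancel₀ _ ht.ne']
    ring
  -- The denominator `ω₀² (1 - S)` of the last three coefficients is proportional to `u`, so
  -- multiplying those equations by `u` clears it.
  have hden : t * (1 - y / t) = (1 - y) ^ 2 * u := by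
    rw [mul_sub, mul_div_cancel₀ _ ht.ne']
    ring
  simp only [ho, hw2, h4, h6, h8, hx, div_mul_cancel₀ _ ht.ne', one_pow, one_mul] at key
  obtain ⟨e1, e2, e3, e4, e5⟩ := key
  have hpi := Real.pi_ne_zero
  have hy3 := hy2.ne'
  have ht0 := ht.ne'
  rw [mul_assoc _ (1 - y / t), mul_comm (1 - y / t), hden] at e3 e4 e5
  rw [e1, e2, e3, e4, e5]
  refine ⟨?_, ?_, ?_, ?_, ?_⟩ <;> field_simp

/-- At fixed `y` the functions `ρ` and `p` are quadratic in `u = -ω²`, and so are the other three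
coefficients times `u`. Terms with curvature have lower degree in `u`, so the `u²` coefficient
contains exactly the flat terms. With `A² = y ω²` it is a polynomial in `y` whose coefficients are
the wanted numbers. -/
lemma fourthCoeffs_of_matches {k : FourthCoeffs} (hk : MatchesDistillates 4 (fourthOrder k)) :
    k.b1 = -3 / (1440 * Real.pi ^ 2) ∧ k.b5 = -10 / (1440 * Real.pi ^ 2) ∧
    k.b6 = -32 / (1440 * Real.pi ^ 2) ∧
    k.c1 = -1 / (1440 * Real.pi ^ 2) ∧ k.c5 = -10 / (1440 * Real.pi ^ 2) ∧
    k.c6 = -64 / (1440 * Real.pi ^ 2) ∧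
    k.d1 = 0 ∧ k.d2 = -1 / (24 * Real.pi ^ 2) ∧
    k.e1 = -5 / (72 * Real.pi ^ 2) ∧ k.e2 = -1 / (72 * Real.pi ^ 2) ∧
    k.f1 = -1 / (360 * Real.pi ^ 2) ∧ k.f2 = 1 / (360 * Real.pi ^ 2) := by
  have hpi := Real.pi_ne_zero
  have key : ∀ y : ℝ, 0 < y → y < 1 →
      k.b1 * y ^ 2 + k.b6 * y + k.b5 = -(3 * y ^ 2 + 32 * y + 10) / 1440 * (1 / Real.pi ^ 2) ∧
      k.c1 * y ^ 2 + k.c6 * y + k.c5 = -(y ^ 2 + 64 * y + 10) / 1440 * (1 / Real.pi ^ 2) ∧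
      k.d1 * y + k.d2 = -1 / 24 * (1 / Real.pi ^ 2) ∧
      k.e1 * y + k.e2 = -(5 * y + 1) / 72 * (1 / Real.pi ^ 2) ∧
      k.f1 * y + k.f2 = (1 - y) / 360 * (1 / Real.pi ^ 2) := by
    intro y hy hy1
    have hy2 : 1 - y ≠ 0 := (sub_pos.mpr hy1).ne'
    obtain ⟨r1, p1, a1, w1, g1⟩ := ceu_four_equations hk hy hy1 (u := 1 / 4)
      (by norm_num) (by linarith)
    obtain ⟨r2, p2, a2, w2, g2⟩ := ceu_four_equations hk hy hy1 (u := 1 / 2)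
      (by norm_num) (by linarith)
    obtain ⟨r3, p3, a3, w3, g3⟩ := ceu_four_equations hk hy hy1 (u := 3 / 4)
      (by norm_num) (by linarith)
    refine ⟨?_, ?_, ?_, ?_, ?_⟩
    -- A second difference with step `1/4` is `1/8` of the `u²` coefficient and kills all lower
    -- powers.
    · trans 8 * (rotatingRho k 1 y (-(1 / 4)) - 2 * rotatingRho k 1 y (-(1 / 2))
        + rotatingRho k 1 y (-(3 / 4)))
      · unfold rotatingRho
        ring
      · rw [r1, r2, r3]
        field_simp
        ring
    · trans 8 * (rotatingP k 1 y (-(1 / 4)) - 2 * rotatingP k 1 y (-(1 / 2))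
        + rotatingP k 1 y (-(3 / 4)))
      · unfold rotatingP
        ring
      · rw [p1, p2, p3]
        field_simp
        ring
    -- The flat part `d1 A² + d2 ω²` is linear in `o = -u`; multiplied by `u` it contributes `-u²`,
    -- whence the sign.
    · trans -8 * (1 / 4 * rotatingA k 1 y (-(1 / 4)) - 2 * (1 / 2 * rotatingA k 1 y (-(1 / 2)))
        + 3 / 4 * rotatingA k 1 y (-(3 / 4)))
      · unfold rotatingA
        ring
      · rw [a1, a2, a3]
        field_simp
        ring
    · trans -8 * (1 / 4 * rotatingW k 1 y (-(1 / 4)) - 2 * (1 / 2 * rotatingW k 1 y (-(1 / 2)))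
        + 3 / 4 * rotatingW k 1 y (-(3 / 4)))
      · unfold rotatingW
        ring
      · rw [w1, w2, w3]
        field_simp
        ring
    · trans -8 * (1 / 4 * rotatingG k 1 y (-(1 / 4)) - 2 * (1 / 2 * rotatingG k 1 y (-(1 / 2)))
        + 3 / 4 * rotatingG k 1 y (-(3 / 4)))
      · unfold rotatingG
        ring
      · rw [g1, g2, g3]
        field_simp
        ring
  -- Three values of `y` determine the two quadratics, and two values suffice for the three linear
  -- ones.
  obtain ⟨r1, p1, a1, w1, g1⟩ := key (1 / 4) (by norm_num) (by norm_num)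
  obtain ⟨r2, p2, a2, w2, g2⟩ := key (1 / 2) (by norm_num) (by norm_num)
  obtain ⟨r3, p3, -⟩ := key (3 / 4) (by norm_num) (by norm_num)
  have hdiv : ∀ a b : ℝ, a / (b * Real.pi ^ 2) = a / b * (1 / Real.pi ^ 2) := fun a b => by
    rw [div_mul_div_comm, mul_one]
  simp only [hdiv]
  generalize 1 / Real.pi ^ 2 = q at *
  refine ⟨?_, ?_, ?_, ?_, ?_, ?_, ?_, ?_, ?_, ?_, ?_, ?_⟩ <;> linarith

/-! ### Minkowski space-time -/

lemma christoffel_mink (x : Coord) (μ ν ρ : Fin 4) : christoffel minkMetric x μ ν ρ = 0 := by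
  simp [christoffel, minkMetric, pd]

lemma riemann_mink (x : Coord) (μ ν ρ σ : Fin 4) : riemann minkMetric x μ ν ρ σ = 0 := by
  simp [riemann, christoffel_mink, pd_zero]

lemma ricci_mink (x : Coord) (μ ν : Fin 4) : ricci minkMetric x μ ν = 0 := by
  simp [ricci, riemann_mink]

lemma scalarCurv_mink (x : Coord) : scalarCurv minkMetric x = 0 := by
  simp [scalarCurv, ricci_mink]

lemma weyl_mink (x : Coord) (μ ν ρ σ : Fin 4) : weyl minkMetric x μ ν ρ σ = 0 := by
  simp [weyl, riemann_mink, ricci_mink, scalarCurv_mink]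

lemma ricciApply_mink (x : Coord) (v : Fin 4 → ℝ) : ricciApply minkMetric x v = 0 := by
  funext i
  simp [ricciApply, ricci_mink]

lemma secondOrder_mink (k : SecondCoeffs) (β : VField) (x : Coord) :
    secondOrder k minkMetric β x = frameTensor minkMetric β x
      (temp minkMetric β x ^ 2 * (k.b1 * accSq minkMetric β x + k.b2 * vortSq minkMetric β x))
      (temp minkMetric β x ^ 2 * (k.c1 * accSq minkMetric β x + k.c2 * vortSq minkMetric β x))
      (temp minkMetric β x ^ 2 * k.d1) (temp minkMetric β x ^ 2 * k.d2)
      (temp minkMetric β x ^ 2 * k.d3) := by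
  funext μ ν
  unfold secondOrder frameTensor sym ricciUU ricciVel
  simp only [scalarCurv_mink, ricci_mink, ricciApply_mink, weylUU_eq_zero (weyl_mink x),
    dot_zero_left, Pi.zero_apply]
  ring

/-- Without curvature and with `A · ω = 0` only the twelve flat coefficients remain, exactly those
fixed by the matching. -/
lemma fourthOrder_mink (k : FourthCoeffs) {β : VField} {x : Coord}
    (h : accVort minkMetric β x = 0) :
    fourthOrder k minkMetric β x = (
      let A := accSq minkMetric β x
      let w := vortSq minkMetric β x
      frameTensor minkMetric β x
        (k.b1 * A ^ 2 + k.b5 * w ^ 2 + k.b6 * A * w) (k.c1 * A ^ 2 + k.c5 * w ^ 2 + k.c6 * A * w)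
        (k.d1 * A + k.d2 * w) (k.e1 * A + k.e2 * w) (k.f1 * A + k.f2 * w)) := by
  funext μ ν
  have h0 : ricci minkMetric x = fun _ _ => 0 := by
    funext i j
    exact ricci_mink x i j
  have hz : ∀ v, dot minkMetric x (fun _ => 0) v = 0 := dot_zero_left
  unfold fourthOrder frameTensor sym ricciUU ricciVel
  simp only [scalarCurv_mink, h0, ricciApply_mink, dot_zero_left, hz, h, Pi.zero_apply,
    Finset.sum_const_zero]
  ring

/-- The stress-energy tensor of the massless field in Minkowski space-time, by powers of the
global temperature. -/
lemma minkTensor_minkKilling (b : Fin 4 → ℝ) (ϖ : Matrix (Fin 4) (Fin 4) ℝ) (x : Coord)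
    {T : ℝ} (hT : 0 < T) (μ ν : Fin 4) :
    minkTensor (minkKilling b ϖ T) x μ ν = (
      let β := minkKilling b ϖ 1
      let t := temp minkMetric β x
      let A := accSq minkMetric β x
      let w := vortSq minkMetric β x
      frameTensor minkMetric β x (Real.pi ^ 2 / 30 * t ^ 4) (Real.pi ^ 2 / 90 * t ^ 4) 0 0 0 μ ν
          * T ^ 4
        + frameTensor minkMetric β x (-(t ^ 2 * w / 36)) (-(t ^ 2 * w / 36)) 0 (-(t ^ 2 / 18))
          (t ^ 2 / 18) μ ν * T ^ 2
        + frameTensor minkMetric β x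
          (-((3 * A ^ 2 + 10 * w ^ 2 + 32 * A * w) / (1440 * Real.pi ^ 2)))
          (-((A ^ 2 + 10 * w ^ 2 + 64 * A * w) / (1440 * Real.pi ^ 2)))
          (-(w / (24 * Real.pi ^ 2))) (-((5 * A + w) / (72 * Real.pi ^ 2)))
          ((w - A) / (360 * Real.pi ^ 2)) μ ν) := by
  have hβ := minkKilling_div b ϖ T
  have hv := velUp_div (g := minkMetric) hT hβ
  unfold minkTensor frameTensor accSq vortSq
  rw [temp_div hT hβ, vel_congr hv, proj_congr hv, acc_congr hv, vort_congr hv, lvec_congr hv]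
  ring

lemma isOrderPart_two_of_real {F G : ℝ → ℝ} {d0 d2 d4 : ℝ}
    (hF : ∀ T : ℝ, 0 < T → F T = d0 * T ^ 4 + d2 * T ^ 2 + d4)
    (hG : ∀ T : ℝ, 0 < T → G T = T ^ 2 * d2) :
    IsOrderPart 2 (fun T => (F T : ℂ)) (fun T => (G T : ℂ)) :=
  (isOrderPart_two_iff (d0 := d0) (d2 := d2) (d4 := d4)
    (fun T hT => by rw [hF T hT]; push_cast; rfl)
    (fun T hT => by rw [hG T hT]; push_cast; rfl)).mpr rfl

lemma isOrderPart_four_of_real {F G : ℝ → ℝ} {d0 d2 d4 : ℝ}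
    (hF : ∀ T : ℝ, 0 < T → F T = d0 * T ^ 4 + d2 * T ^ 2 + d4)
    (hG : ∀ T : ℝ, 0 < T → G T = d4) :
    IsOrderPart 4 (fun T => (F T : ℂ)) (fun T => (G T : ℂ)) :=
  (isOrderPart_four_iff (d0 := d0) (d2 := d2) (d4 := d4)
    (fun T hT => by rw [hF T hT]; push_cast; rfl)
    (fun T hT => by rw [hG T hT])).mpr rfl

/-- The Minkowski tensor is already split by powers of `T₀`, so it suffices to compare frame
coefficients. -/
lemma secondOrder_isOrderPart_mink {k : SecondCoeffs}
    (hk : MatchesDistillates 2 (secondOrder k)) (b : Fin 4 → ℝ) (ϖ : Matrix (Fin 4) (Fin 4) ℝ)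
    (x : Coord) (μ ν : Fin 4) :
    IsOrderPart 2 (fun T0 => (minkTensor (minkKilling b ϖ T0) x μ ν : ℂ))
      (fun T0 => (secondOrder k minkMetric (minkKilling b ϖ T0) x μ ν : ℂ)) := by
  obtain ⟨b1, b2, -, -, c1, c2, -, -, d1, d2, d3, -, -⟩ := secondCoeffs_of_matches hk
  refine isOrderPart_two_of_real (fun T hT => minkTensor_minkKilling b ϖ x hT μ ν) fun T hT => ?_
  rw [secondOrder_div hT (minkKilling_div b ϖ T) k, secondOrder_mink, b1, b2, c1, c2,
    d1, d2, d3]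
  unfold frameTensor
  ring

lemma fourthOrder_isOrderPart_mink {k : FourthCoeffs}
    (hk : MatchesDistillates 4 (fourthOrder k)) (b : Fin 4 → ℝ) (ϖ : Matrix (Fin 4) (Fin 4) ℝ)
    (x : Coord) (h : accVort minkMetric (minkKilling b ϖ 1) x = 0) (μ ν : Fin 4) :
    IsOrderPart 4 (fun T0 => (minkTensor (minkKilling b ϖ T0) x μ ν : ℂ))
      (fun T0 => (fourthOrder k minkMetric (minkKilling b ϖ T0) x μ ν : ℂ)) := by
  obtain ⟨b1, b5, b6, c1, c5, c6, d1, d2, e1, e2, f1, f2⟩ := fourthCoeffs_of_matches hk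
  refine isOrderPart_four_of_real (fun T hT => minkTensor_minkKilling b ϖ x hT μ ν) fun T hT => ?_
  rw [fourthOrder_div hT (minkKilling_div b ϖ T) k, fourthOrder_mink k h, b1, b5, b6, c1, c5, c6,
    d1, d2, e1, e2, f1, f2]
  unfold frameTensor
  ring

end ThermalDistillate

end

theorem mainTheorem5 :
    -- second order: the linear system has exactly this solution (`d6` is left undetermined)
    (∀ k : ThermalDistillate.SecondCoeffs,
      ThermalDistillate.MatchesDistillates 2 (ThermalDistillate.secondOrder k) ↔
        (k.b1 = 0 ∧ k.b2 = -1 / 36 ∧ k.b3 = 0 ∧ k.b4 = 1 / 18 ∧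
         k.c1 = 0 ∧ k.c2 = -1 / 36 ∧ k.c3 = 0 ∧ k.c4 = 0 ∧
         k.d1 = 0 ∧ k.d2 = -1 / 18 ∧ k.d3 = 1 / 18 ∧ k.d4 = 0 ∧ k.d5 = -1 / 36)) ∧
    -- the resulting covariant form, in an arbitrary space-time
    (∀ k : ThermalDistillate.SecondCoeffs,
      ThermalDistillate.MatchesDistillates 2 (ThermalDistillate.secondOrder k) →
      ∀ (g : ThermalDistillate.Metric) (β : ThermalDistillate.VField)
        (x : ThermalDistillate.Coord) (μ ν : Fin 4),
        ThermalDistillate.secondOrder k g β x μ ν =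
          (-(1 / 36) * ThermalDistillate.temp g β x ^ 2 * ThermalDistillate.vortSq g β x
            + 1 / 18 * ThermalDistillate.temp g β x ^ 2 * ThermalDistillate.ricciUU g β x)
              * (ThermalDistillate.vel g β x μ * ThermalDistillate.vel g β x ν)
          + 1 / 36 * ThermalDistillate.temp g β x ^ 2 * ThermalDistillate.vortSq g β x
              * ThermalDistillate.proj g β x μ ν
          - 1 / 18 * ThermalDistillate.temp g β x ^ 2
              * (ThermalDistillate.vort g β x μ * ThermalDistillate.vort g β x ν)
          + 1 / 18 * ThermalDistillate.temp g β x ^ 2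
              * (ThermalDistillate.vel g β x μ * ThermalDistillate.lvec g β x ν
                + ThermalDistillate.vel g β x ν * ThermalDistillate.lvec g β x μ)
          - 1 / 36 * ThermalDistillate.temp g β x ^ 2
              * (ThermalDistillate.vel g β x μ * ThermalDistillate.ricciVel g β x ν
                + ThermalDistillate.vel g β x ν * ThermalDistillate.ricciVel g β x μ)
          + k.d6 * ThermalDistillate.temp g β x ^ 2 * ThermalDistillate.weylUU g β x μ ν) ∧
    -- at zero curvature it is the second order part of the Minkowski result
    (∀ k : ThermalDistillate.SecondCoeffs,
      ThermalDistillate.MatchesDistillates 2 (ThermalDistillate.secondOrder k) →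
      ∀ (b : Fin 4 → ℝ) (ϖ : Matrix (Fin 4) (Fin 4) ℝ) (x : ThermalDistillate.Coord),
        ϖ.transpose = -ϖ →
        0 < ThermalDistillate.betaSq ThermalDistillate.minkMetric
          (ThermalDistillate.minkKilling b ϖ 1) x →
        ∀ μ ν : Fin 4, ThermalDistillate.IsOrderPart 2
          (fun T0 => (ThermalDistillate.minkTensor
            (ThermalDistillate.minkKilling b ϖ T0) x μ ν : ℂ))
          (fun T0 => (ThermalDistillate.secondOrder k ThermalDistillate.minkMetric
            (ThermalDistillate.minkKilling b ϖ T0) x μ ν : ℂ))) ∧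
    -- fourth order: the system is solvable and determines the flat-space coefficients
    (∃ k : ThermalDistillate.FourthCoeffs,
      ThermalDistillate.MatchesDistillates 4 (ThermalDistillate.fourthOrder k)) ∧
    (∀ k : ThermalDistillate.FourthCoeffs,
      ThermalDistillate.MatchesDistillates 4 (ThermalDistillate.fourthOrder k) →
        (k.b1 = -3 / (1440 * Real.pi ^ 2) ∧ k.b5 = -10 / (1440 * Real.pi ^ 2) ∧
         k.b6 = -32 / (1440 * Real.pi ^ 2) ∧
         k.c1 = -1 / (1440 * Real.pi ^ 2) ∧ k.c5 = -10 / (1440 * Real.pi ^ 2) ∧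
         k.c6 = -64 / (1440 * Real.pi ^ 2) ∧
         k.d1 = 0 ∧ k.d2 = -1 / (24 * Real.pi ^ 2) ∧
         k.e1 = -5 / (72 * Real.pi ^ 2) ∧ k.e2 = -1 / (72 * Real.pi ^ 2) ∧
         k.f1 = -1 / (360 * Real.pi ^ 2) ∧ k.f2 = 1 / (360 * Real.pi ^ 2))) ∧
    -- and it recovers the fourth order part of the Minkowski result
    (∀ k : ThermalDistillate.FourthCoeffs,
      ThermalDistillate.MatchesDistillates 4 (ThermalDistillate.fourthOrder k) →
      ∀ (b : Fin 4 → ℝ) (ϖ : Matrix (Fin 4) (Fin 4) ℝ) (x : ThermalDistillate.Coord),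
        ϖ.transpose = -ϖ →
        0 < ThermalDistillate.betaSq ThermalDistillate.minkMetric
          (ThermalDistillate.minkKilling b ϖ 1) x →
        ThermalDistillate.accVort ThermalDistillate.minkMetric
          (ThermalDistillate.minkKilling b ϖ 1) x = 0 →
        ∀ μ ν : Fin 4, ThermalDistillate.IsOrderPart 4
          (fun T0 => (ThermalDistillate.minkTensor
            (ThermalDistillate.minkKilling b ϖ T0) x μ ν : ℂ))
          (fun T0 => (ThermalDistillate.fourthOrder k ThermalDistillate.minkMetric
            (ThermalDistillate.minkKilling b ϖ T0) x μ ν : ℂ))) := by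
  refine ⟨fun k => ⟨ThermalDistillate.secondCoeffs_of_matches,
      ThermalDistillate.matchesDistillates_two⟩, fun k hk g β x μ ν => ?_,
    fun k hk b ϖ x _ _ μ ν => ThermalDistillate.secondOrder_isOrderPart_mink hk b ϖ x μ ν,
    ⟨_, ThermalDistillate.matchesDistillates_fourthSolution⟩,
    fun k hk => ThermalDistillate.fourthCoeffs_of_matches hk,
    fun k hk b ϖ x _ _ h μ ν => ThermalDistillate.fourthOrder_isOrderPart_mink hk b ϖ x h μ ν⟩
  obtain ⟨b1, b2, b3, b4, c1, c2, c3, c4, d1, d2, d3, d4, d5⟩ :=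
    ThermalDistillate.secondCoeffs_of_matches hk
  unfold ThermalDistillate.secondOrder ThermalDistillate.sym
  simp only [b1, b2, b3, b4, c1, c2, c3, c4, d1, d2, d3, d4, d5]
  ring
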